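/- For $R\ge 1$ and $0<\lambda\le \tfrac12$ let $$\Sigma_\lambda=\{(\xi_1,\xi_2,\xi_1^4+\xi_2^4):\ \lambda\le \xi_1\le 2\lambda,\ 0\le \xi_2\le R^{-1/4}\}\subset\mathbb R^3,$$ and let $\mathcal N_{R^{-1}}(\Sigma_\lambda)$ be its closed $R^{-1}$-neighbourhood. Fix $a\in\mathbb R$, and for $k\in\mathbb Z$ let $$\vartheta_k=\{\xi\in\mathcal N_{R^{-1}}(\Sigma_\lambda):\ a+k\lambda^{-1}R^{-1/2}\le \xi_1<a+(k+1)\lambda^{-1}R^{-1/2}\}.$$ These sets are (up to absolute constants in the dimensions, and up to truncation at the ends) slabs of size $\lambda^{-1}R^{-1/2}\times R^{-1/4}\times R^{-1}$; they partition $\mathcal N_{R^{-1}}(\Sigma_\lambda)$, and only finitely many are non-empty. Let $2\le p\le 4$. There is a constant $C$, depending only on $p$, such that for all $R\ge1$, all $0<\lambda\le\frac12$, all $a\in\mathbb R$ and every function $F$ on $\mathbb R^3$ that is the inverse Fourier transform of an integrable function $\widehat F$ supported in $\mathcal N_{R^{-1}}(\Sigma_\lambda)$, $$\|F\|_{L^p(\mathbb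 R^3)}\le C\,\Big\|\Big(\sum_{k\in\mathbb Z}|F_{\vartheta_k}|^2\Big)^{1/2}\Big\|_{L^p(\mathbb R^3)},\qquad F_{\vartheta}:=\mathcal F^{-1}\big(\widehat F\,\chi_{\vartheta}\big),\quad \mathcal F^{-1}h(x)=\int_{\mathbb R^3}e^{2\pi i x\cdot\xi}h(\xi)\,d\xi .$$ (Both sides may be infinite.) -/

import Mathlib

open MeasureTheory
open scoped ENNReal NNReal FourierTransform

/-- The piece of the surface `ξ₃ = ξ₁⁴ + ξ₂⁴` over `[lam, 2 lam] × [0, R^{-1/4}]`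
(coordinates are numbered `0, 1, 2`). -/
def surfacePiece (R lam : ℝ) : Set (EuclideanSpace ℝ (Fin 3)) :=
  {ξ | ξ 0 ∈ Set.Icc lam (2 * lam) ∧ ξ 1 ∈ Set.Icc 0 (R ^ (-(1 / 4) : ℝ)) ∧
    ξ 2 = ξ 0 ^ 4 + ξ 1 ^ 4}

/-- The (closed) `R⁻¹`-neighbourhood of the surface piece, in the Euclidean distance. -/
def surfaceNhd (R lam : ℝ) : Set (EuclideanSpace ℝ (Fin 3)) :=
  Metric.cthickening R⁻¹ (surfacePiece R lam)

/-- The width `lam⁻¹ R^{-1/2}` of a slab in the `ξ₁`-direction. -/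
noncomputable def slabWidth (R lam : ℝ) : ℝ :=
  lam⁻¹ * R ^ (-(1 / 2) : ℝ)

/-- The slab with index `k`: the part of the `R⁻¹`-neighbourhood over the `k`-th interval of the
tiling of the `ξ₁`-axis by half-open intervals of length `lam⁻¹ R^{-1/2}` with `a` as an end point.
Over such an interval the neighbourhood is, up to absolute constants in the dimensions, a slab of
size `lam⁻¹ R^{-1/2} × R^{-1/4} × R⁻¹`. The slabs are pairwise disjoint and cover the
neighbourhood; all but finitely many are empty. -/
def slab (R lam a : ℝ) (k : ℤ) : Set (EuclideanSpace ℝ (Fin 3)) :=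
  {ξ ∈ surfaceNhd R lam |
    a + k * slabWidth R lam ≤ ξ 0 ∧ ξ 0 < a + (k + 1) * slabWidth R lam}

/-- The piece `F_ϑ`, the inverse Fourier transform of `F̂ χ_ϑ`, as a function of `F̂`. -/
noncomputable def slabPiece (R lam a : ℝ) (k : ℤ) (Fhat : EuclideanSpace ℝ (Fin 3) → ℂ) :
    EuclideanSpace ℝ (Fin 3) → ℂ :=
  𝓕⁻ ((slab R lam a k).indicator Fhat)

/-- The square function `(∑_ϑ |F_ϑ|²)^{1/2}`; for `Fhat` supported in the neighbourhood of the
surface piece (`R ≥ 1`, `lam > 0`) only finitely many terms are nonzero. -/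
noncomputable def slabSquareFunction (R lam a : ℝ) (Fhat : EuclideanSpace ℝ (Fin 3) → ℂ)
    (x : EuclideanSpace ℝ (Fin 3)) : ℝ :=
  √(∑' k : ℤ, ‖slabPiece R lam a k Fhat x‖ ^ 2)

namespace SquareFunction

open Complex ComplexConjugate

/-! On the surface the second frequency is at most `R^{-1/4}`, so its fourth power is at most `R⁻¹`
and disappears into the thickness of the neighbourhood. With the second physical variable frozen, F
becomes a function of two variables with spectrum in an `O(R⁻¹)`-neighbourhood of the planar curve
`ξ₃ = ξ₁⁴`, `ξ₁ ∼ lam`. The affine map `((ξ₁ - a) / slabWidth, R ξ₃)` turns the slabs into caps over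
unit intervals `[k, k + 1)`, inside a neighbourhood of bounded height of a curve whose second
derivative lies between absolute constants (`mem_capSet_of_mem_slab`, `hasSpectrum_slice`). It
therefore suffices to prove a planar estimate with uniform constants,
`exists_plane_square_function`, and to integrate it over slices.

In the plane, with `p = 2s` and `H = ∑ F_k`, the claim is `∫ |H|^{2s} ≲ ∫ (∑ |F_k|²)^s`. For `s = 1`
it is orthogonality. For `1 < s ≤ 2`, the double sum `|H|²` is split by a Whitney decomposition into
near-diagonal terms, dominated by the square function, and one bilinear term `bilin` per dyadic node
ν, a block of n consecutive indices. The frequencies of `bilin` at ν are differences of points of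
the curve at distance about n, lying near a line whose slope is that of the curve at ν. Two facts
are used. Pairs at one node are almost orthogonal, because by convexity a difference of points at
distance about n determines the points (`ConvexCurve.transversality`). Different nodes have
boundedly overlapping frequency regions, so the smooth projections `proj` onto them satisfy Bessel's
inequality (`Projector.exists_bessel`).

Pair `|H|²` with `g = |H|^{2(s-1)}` restricted to a ball. At each node g may be replaced by its
projection, and Cauchy–Schwarz is applied with the weights `A_ν^{s-2}` and `A_ν^{2-s}`. Here `A_ν =
localAvg` is the average, over boxes dual to the caps near ν, of the part of the square function
(squared) living near ν.

The first factor is bounded by `∫ (∑ |F_k|²)^s` (`exists_sum_bilin_weighted`): `A_ν` is essentially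
constant on the boxes, so almost orthogonality survives the weight; `A_ν` dominates the local sum by
the uncertainty principle; and the remaining sum over Whitney pairs telescopes by concavity of `u ↦
u^{s-1}`.

The second factor is bounded by `∫ (∑ |F_k|²)^s + ∫ |g|^{s/(s-1)}`
(`Projector.exists_weighted_square`). This rests on a Carleson embedding: the regions `{A_ν > β}`
are covered by heavy boxes, a Vitali selection makes these disjoint in the product of the plane and
the index set, and on each selected box the projections of a bounded function obey a localised
Bessel inequality. A layer-cake integration with g truncated at a level depending on β passes to the
power weight. The last integral is that of `|H|^{2s}` over the ball; it is finite, so with a small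
constant it is absorbed (`exists_square_function_on_ball`). -/

/-- The character `x ↦ exp (2πix)` of the line. -/
noncomputable def ee (x : ℝ) : ℂ := Complex.exp (2 * Real.pi * x * I)

theorem ee_eq (x : ℝ) : ee x = (Real.fourierChar x : Circle) := by
  rw [Real.fourierChar_apply, ee]; push_cast; rfl

@[simp] theorem norm_ee (x : ℝ) : ‖ee x‖ = 1 := by rw [ee_eq]; exact Circle.norm_coe _

@[simp] theorem ee_zero : ee 0 = 1 := by simp [ee]

theorem ee_add (x y : ℝ) : ee (x + y) = ee x * ee y := by
  rw [ee, ee, ee, ← Complex.exp_add]; push_cast; ring_nf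

@[simp] theorem conj_ee (x : ℝ) : conj (ee x) = ee (-x) := by
  rw [ee, ee, ← Complex.exp_conj]; simp [Complex.conj_ofNat]

@[fun_prop] theorem continuous_ee : Continuous ee := by unfold ee; fun_prop

theorem fourierChar_smul (x : ℝ) (z : ℂ) : Real.fourierChar x • z = z * ee x := by
  rw [ee_eq, Circle.smul_def, smul_eq_mul, mul_comm]

/-! ### Schwartz kernels on the line -/

/-- A pair consisting of a function and its Fourier transform, both continuous and integrable. -/
structure FourierPair (φ χ : ℝ → ℂ) : Prop where
  cont_left : Continuous φ
  cont_right : Continuous χ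
  int_left : Integrable φ
  int_right : Integrable χ
  fourier : ∀ t, ∫ x, φ x * ee (-(x * t)) = χ t
  fourierInv : ∀ x, ∫ t, χ t * ee (x * t) = φ x

theorem exists_fourierPair {χ : ℝ → ℂ} (h₁ : HasCompactSupport χ) (h₂ : ContDiff ℝ (⊤ : ℕ∞) χ) :
    ∃ φ : ℝ → ℂ, FourierPair φ χ ∧ ∀ M : ℕ, ∃ B : ℝ, 0 < B ∧ ∀ x, ‖φ x‖ ≤ B * ((1 + x ^ 2) ^ M)⁻¹ := by
  let X : SchwartzMap ℝ ℂ := h₁.toSchwartzMap h₂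
  let Φ : SchwartzMap ℝ ℂ := 𝓕⁻ X
  have hX : (X : ℝ → ℂ) = χ := rfl
  have hΦ : (Φ : ℝ → ℂ) = 𝓕⁻ χ := by
    rw [← hX]; exact SchwartzMap.fourierInv_coe X
  have hF : 𝓕 (Φ : ℝ → ℂ) = χ := by
    rw [← SchwartzMap.fourier_coe]
    simp [Φ, hX]
  refine ⟨Φ, ⟨Φ.continuous, hX ▸ X.continuous, Φ.integrable, hX ▸ X.integrable, ?_, ?_⟩, ?_⟩
  · intro t
    have := congrFun hF t
    rw [Real.fourier_real_eq] at this
    rw [← this]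
    refine integral_congr_ae (.of_forall fun x => ?_)
    exact (fourierChar_smul _ _).symm
  · intro x
    rw [hΦ, Real.fourierInv_eq]
    refine integral_congr_ae (.of_forall fun t => ?_)
    show χ t * ee (x * t) = _
    rw [mul_comm x t]
    exact ((fourierChar_smul _ _).symm.trans (by simp [mul_comm]))
  · intro M
    have := SchwartzMap.one_add_le_sup_seminorm_apply (𝕜 := ℂ) (m := (2 * M, 0)) (le_refl (2 * M))
      (le_refl 0) Φ
    set B := 2 ^ (2 * M, 0).1 * ((Finset.Iic (2 * M, 0)).sup fun m =>
      SchwartzMap.seminorm ℂ m.1 m.2) Φ with hB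
    refine ⟨|B| + 1, by positivity, fun x => ?_⟩
    have hx := this x
    rw [norm_iteratedFDeriv_zero] at hx
    have h1 : (1 + x ^ 2) ^ M ≤ (1 + ‖x‖) ^ (2 * M) := by
      rw [pow_mul]
      refine pow_le_pow_left₀ (by positivity) ?_ _
      rw [Real.norm_eq_abs]
      nlinarith [sq_abs x, abs_nonneg x]
    rw [← div_eq_mul_inv, le_div_iff₀ (by positivity)]
    calc ‖Φ x‖ * (1 + x ^ 2) ^ M ≤ ‖Φ x‖ * (1 + ‖x‖) ^ (2 * M) := by gcongr
      _ ≤ B := by rw [mul_comm]; exact hx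
      _ ≤ |B| + 1 := by linarith [le_abs_self B]

theorem exists_plateau {C : ℝ} (hC : 0 < C) :
    ∃ χ : ℝ → ℝ, ContDiff ℝ (⊤ : ℕ∞) χ ∧ (∀ t, |t| ≤ C → χ t = 1) ∧ (∀ t, 2 * C ≤ |t| → χ t = 0) ∧
      (∀ t, 0 ≤ χ t) ∧ (∀ t, χ t ≤ 1) := by
  let f : ContDiffBump (0 : ℝ) := ⟨C, 2 * C, hC, by linarith⟩
  refine ⟨f, f.contDiff, fun t ht => ?_, fun t ht => ?_, fun t => f.nonneg, fun t => f.le_one⟩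
  · exact f.one_of_mem_closedBall (by simpa [Real.dist_eq] using ht)
  · exact f.zero_of_le_dist (by simpa [Real.dist_eq] using ht)

theorem hasCompactSupport_of_abs {χ : ℝ → ℂ} {C : ℝ} (h : ∀ t, C ≤ |t| → χ t = 0) :
    HasCompactSupport χ := by
  refine HasCompactSupport.intro (isCompact_Icc (a := -C) (b := C)) fun t ht => h t ?_
  by_contra hlt
  push Not at hlt
  exact ht ⟨by linarith [neg_abs_le t], by linarith [le_abs_self t]⟩

/-- A low-pass kernel. -/
theorem exists_lowpass {C : ℝ} (hC : 0 < C) :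
    ∃ φ χ : ℝ → ℂ, FourierPair φ χ ∧ (∀ t, |t| ≤ C → χ t = 1) ∧ (∀ t, 2 * C ≤ |t| → χ t = 0) ∧
      (∀ t, ‖χ t‖ ≤ 1) ∧
      ∀ M : ℕ, ∃ B : ℝ, 0 < B ∧ ∀ x, ‖φ x‖ ≤ B * ((1 + x ^ 2) ^ M)⁻¹ := by
  obtain ⟨χ, h1, h2, h3, h4, h5⟩ := exists_plateau hC
  obtain ⟨φ, hφ, hd⟩ := exists_fourierPair (χ := fun t => (χ t : ℂ))
    (hasCompactSupport_of_abs (C := 2 * C) fun t ht => by simp [h3 t ht])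
    (ofRealCLM.contDiff.comp h1)
  refine ⟨φ, _, hφ, fun t ht => by simp [h2 t ht], fun t ht => by simp [h3 t ht], fun t => ?_, hd⟩
  simpa [abs_of_nonneg (h4 t)] using h5 t

/-- A band-pass kernel. -/
theorem exists_bandpass :
    ∃ φ χ : ℝ → ℂ, FourierPair φ χ ∧ (∀ t, 1 / 2 ≤ |t| → |t| ≤ 2 → χ t = 1) ∧
      (∀ t, χ t ≠ 0 → 1 / 4 ≤ |t| ∧ |t| ≤ 4) ∧ (∀ t, ‖χ t‖ ≤ 1) ∧
      ∀ M : ℕ, ∃ B : ℝ, 0 < B ∧ ∀ x, ‖φ x‖ ≤ B * ((1 + x ^ 2) ^ M)⁻¹ := by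
  obtain ⟨χ, h1, h2, h3, h4, h5⟩ := exists_plateau (C := 2) (by norm_num)
  have h8 : ∀ t : ℝ, |8 * t| = 8 * |t| := fun t => by rw [abs_mul]; norm_num
  obtain ⟨φ, hφ, hd⟩ := exists_fourierPair (χ := fun t => ((χ t - χ (8 * t) : ℝ) : ℂ))
    (hasCompactSupport_of_abs (C := 4) fun t ht => by
      simp [h3 t (by linarith), h3 (8 * t) (by rw [h8]; linarith)])
    (ofRealCLM.contDiff.comp (h1.sub (h1.comp (contDiff_const.mul contDiff_id))))
  refine ⟨φ, _, hφ, fun t ht ht' => ?_, fun t ht => ?_, fun t => ?_, hd⟩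
  · simp [h2 t ht', h3 (8 * t) (by rw [h8]; linarith)]
  · by_contra hcon
    rw [not_and_or] at hcon
    apply ht
    rcases hcon with h | h
    · simp [h2 t (by linarith), h2 (8 * t) (by rw [h8]; linarith)]
    · simp [h3 t (by linarith), h3 (8 * t) (by rw [h8]; linarith)]
  · rw [norm_real, Real.norm_eq_abs, abs_le]
    constructor <;> linarith [h4 t, h5 t, h4 (8 * t), h5 (8 * t)]

/-- A nonnegative, rapidly decaying weight whose Fourier transform has support in `(-C, C)`. -/
theorem exists_weight {C : ℝ} (hC : 0 < C) :
    ∃ w : ℝ → ℝ, Continuous w ∧ (∀ x, 0 ≤ w x) ∧ Integrable w ∧ 0 < w 0 ∧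
      (∀ t, C ≤ |t| → ∫ x, (w x : ℂ) * ee (x * t) = 0) ∧
      ∀ M : ℕ, ∃ B : ℝ, 0 < B ∧ ∀ x, w x ≤ B * ((1 + x ^ 2) ^ M)⁻¹ := by
  -- The weight is `|φ|²`, whose transform is the autocorrelation of χ. Support of χ in `|t| < C /
  -- 2` puts the autocorrelation in `|t| < C`.
  obtain ⟨χ, h1, h2, h3, h4, h5⟩ := exists_plateau (C := C / 4) (by linarith)
  obtain ⟨φ, hφ, hd⟩ := exists_fourierPair (χ := fun t => (χ t : ℂ))
    (hasCompactSupport_of_abs (C := 2 * (C / 4)) fun t ht => by simp [h3 t ht])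
    (ofRealCLM.contDiff.comp h1)
  have hdecay : ∀ M : ℕ, ∃ B : ℝ, 0 < B ∧ ∀ x, ‖φ x‖ ^ 2 ≤ B * ((1 + x ^ 2) ^ M)⁻¹ := by
    intro M
    obtain ⟨B, hB, h⟩ := hd M
    refine ⟨B ^ 2, by positivity, fun x => ?_⟩
    have h0 : ((1 + x ^ 2) ^ M)⁻¹ ≤ 1 := inv_le_one_of_one_le₀ (one_le_pow₀ (by nlinarith))
    calc ‖φ x‖ ^ 2 ≤ (B * ((1 + x ^ 2) ^ M)⁻¹) ^ 2 := by
          gcongr; exact h x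
      _ = B ^ 2 * (((1 + x ^ 2) ^ M)⁻¹ * ((1 + x ^ 2) ^ M)⁻¹) := by ring
      _ ≤ B ^ 2 * (((1 + x ^ 2) ^ M)⁻¹ * 1) := by gcongr
      _ = _ := by ring
  have hcont : Continuous fun x => ‖φ x‖ ^ 2 := hφ.cont_left.norm.pow 2
  refine ⟨fun x => ‖φ x‖ ^ 2, hcont, fun x => by positivity, ?_, ?_, ?_, hdecay⟩
  · obtain ⟨B, hB, h⟩ := hdecay 1
    refine (integrable_inv_one_add_sq.const_mul B).mono' hcont.aestronglyMeasurable
      (.of_forall fun x => ?_)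
    rw [Real.norm_of_nonneg (by positivity)]
    simpa using h x
  · have h0 : φ 0 = ((∫ t, χ t : ℝ) : ℂ) := by
      rw [← hφ.fourierInv 0]
      simp [integral_complex_ofReal]
    have hpos : 0 < ∫ t, χ t := by
      refine h1.continuous.integral_pos_of_hasCompactSupport_nonneg_nonzero ?_ h4 (x := 0) ?_
      · refine HasCompactSupport.intro (isCompact_Icc (a := -(2 * (C / 4))) (b := 2 * (C / 4)))
          fun t ht => h3 t ?_
        by_contra hlt
        push Not at hlt
        exact ht ⟨by linarith [neg_abs_le t], by linarith [le_abs_self t]⟩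
      · rw [h2 0 (by simp; linarith)]; norm_num
    show 0 < ‖φ 0‖ ^ 2
    rw [h0, norm_real]
    have := abs_pos.2 hpos.ne'
    positivity
  · intro t ht
    -- Fourier inversion is applied to one factor of `|φ|²` only; Fubini then produces the
    -- autocorrelation of χ.
    have e1 : ∀ x, ((‖φ x‖ ^ 2 : ℝ) : ℂ) * ee (x * t)
        = ∫ u, (conj (φ x) * ee (x * t)) * ((χ u : ℂ) * ee (x * u)) := by
      intro x
      rw [integral_const_mul, hφ.fourierInv x, mul_right_comm, ← normSq_eq_conj_mul_self,
        normSq_eq_norm_sq]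
    simp_rw [e1]
    rw [integral_integral_swap]
    · have e2 : ∀ u, ∫ x, (conj (φ x) * ee (x * t)) * ((χ u : ℂ) * ee (x * u))
          = (χ u : ℂ) * conj (χ (t + u) : ℂ) := by
        intro u
        rw [← hφ.fourier (t + u), ← integral_conj, ← integral_const_mul]
        refine integral_congr_ae (.of_forall fun x => ?_)
        simp only [map_mul, conj_ee, neg_neg, mul_add, ee_add]
        ring
      simp_rw [e2]
      rw [← integral_zero ℝ ℂ]
      refine integral_congr_ae (.of_forall fun u => ?_)
      by_cases hu : 2 * (C / 4) ≤ |u|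
      · simp [h3 u hu]
      · have : 2 * (C / 4) ≤ |t + u| := by
          have := abs_sub_abs_le_abs_sub t (-u)
          rw [abs_neg, sub_neg_eq_add] at this
          linarith
        simp [h3 _ this]
    · have hi : Integrable (fun z : ℝ × ℝ => conj (φ z.1) * (χ z.2 : ℂ)) (volume.prod volume) :=
        (hφ.int_left.norm.mono' (continuous_conj.comp hφ.cont_left).aestronglyMeasurable
          (.of_forall fun x => by simp)).mul_prod hφ.int_right
      refine hi.norm.mono' ?_ (.of_forall fun z => ?_)
      · refine Continuous.aestronglyMeasurable ?_
        refine Continuous.mul (.mul (continuous_conj.comp (hφ.cont_left.comp continuous_fst)) ?_)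
          (.mul (hφ.cont_right.comp continuous_snd) ?_)
        · fun_prop
        · fun_prop
      · simp [Function.uncurry]

/-! ### Plane waves and sheared dilations -/

/-- The plane wave with frequency `ξ`. -/
noncomputable def wave (ξ z : ℝ × ℝ) : ℂ := ee (z.1 * ξ.1 + z.2 * ξ.2)

@[simp] theorem norm_wave (ξ z : ℝ × ℝ) : ‖wave ξ z‖ = 1 := norm_ee _

theorem wave_comm (ξ z : ℝ × ℝ) : wave ξ z = wave z ξ := by
  simp only [wave, mul_comm]

theorem wave_add (ξ η z : ℝ × ℝ) : wave (ξ + η) z = wave ξ z * wave η z := by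
  rw [wave, wave, wave, ← ee_add]; congr 1; simp only [Prod.fst_add, Prod.snd_add]; ring

theorem wave_add_right (ξ z w : ℝ × ℝ) : wave ξ (z + w) = wave ξ z * wave ξ w := by
  rw [wave_comm, wave_add, wave_comm z, wave_comm w]

@[simp] theorem conj_wave (ξ z : ℝ × ℝ) : conj (wave ξ z) = wave (-ξ) z := by
  rw [wave, wave, conj_ee]; congr 1; simp only [Prod.fst_neg, Prod.snd_neg]; ring

theorem wave_neg_right (ξ z : ℝ × ℝ) : wave ξ (-z) = wave (-ξ) z := by
  rw [wave, wave]; congr 1; simp only [Prod.fst_neg, Prod.snd_neg]; ring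

theorem continuous_wave_uncurry : Continuous fun p : (ℝ × ℝ) × (ℝ × ℝ) => wave p.1 p.2 := by
  unfold wave; fun_prop

@[fun_prop] theorem continuous_wave {X : Type*} [TopologicalSpace X] {f g : X → ℝ × ℝ}
    (hf : Continuous f) (hg : Continuous g) : Continuous fun x => wave (f x) (g x) :=
  continuous_wave_uncurry.comp (hf.prodMk hg)

theorem measurable_wave {X : Type*} [MeasurableSpace X] {f g : X → ℝ × ℝ}
    (hf : Measurable f) (hg : Measurable g) : Measurable (fun x => wave (f x) (g x)) := by
  have h : Measurable (fun x => (g x).1 * (f x).1 + (g x).2 * (f x).2) := by fun_prop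
  exact continuous_ee.measurable.comp h

/-- The sheared dilation `(x, y) ↦ (A (x + s y), B y)`. -/
def shear (s A B : ℝ) (z : ℝ × ℝ) : ℝ × ℝ := (A * (z.1 + s * z.2), B * z.2)

@[fun_prop] theorem continuous_shear (s A B : ℝ) : Continuous (shear s A B) := by
  unfold shear; fun_prop

theorem shear_sub (s A B : ℝ) (z w : ℝ × ℝ) : shear s A B (z - w) = shear s A B z - shear s A B w := by
  ext <;> simp [shear] <;> ring

theorem shear_neg (s A B : ℝ) (z : ℝ × ℝ) : shear s A B (-z) = -shear s A B z := by
  ext <;> simp [shear]; ring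

/-- The dual action: shearing space by slope s measures the second frequency relative to the line
`ξ₂ = s ξ₁`. All boxes and multipliers below come from this change of variables. -/
theorem wave_eq_shear {s A B : ℝ} (hA : A ≠ 0) (hB : B ≠ 0) (ξ z : ℝ × ℝ) :
    wave ξ z = wave (ξ.1 / A, (ξ.2 - s * ξ.1) / B) (shear s A B z) := by
  rw [wave, wave]; congr 1; simp only [shear]; field_simp; ring

theorem measurableEmbedding_shear {s A B : ℝ} (hA : A ≠ 0) (hB : B ≠ 0) :
    MeasurableEmbedding (shear s A B) := by
  let e : (ℝ × ℝ) ≃ₜ (ℝ × ℝ) :=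
    { toFun := shear s A B
      invFun := fun w => (w.1 / A - s * (w.2 / B), w.2 / B)
      left_inv := fun z => by ext <;> simp [shear] <;> field_simp; ring
      right_inv := fun z => by ext <;> simp [shear] <;> field_simp
      continuous_toFun := continuous_shear s A B
      continuous_invFun := by fun_prop }
  exact e.measurableEmbedding

theorem map_shear {s A B : ℝ} (hA : 0 < A) (hB : 0 < B) :
    Measure.map (shear s A B) volume = ENNReal.ofReal (A * B)⁻¹ • (volume : Measure (ℝ × ℝ)) := by
  let b := Module.Basis.finTwoProd ℝ
  let M : Matrix (Fin 2) (Fin 2) ℝ := !![A, A * s; 0, B]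
  let f : (ℝ × ℝ) →ₗ[ℝ] (ℝ × ℝ) := Matrix.toLin b b M
  have hf : (f : ℝ × ℝ → ℝ × ℝ) = shear s A B := by
    funext z
    rw [Matrix.toLin_finTwoProd_apply]
    ext <;> simp [shear]; ring
  have hdet : LinearMap.det f = A * B := by
    rw [LinearMap.det_toLin, Matrix.det_fin_two_of]; ring
  have h := Measure.map_linearMap_addHaar_eq_smul_addHaar (volume : Measure (ℝ × ℝ)) (f := f)
    (by rw [hdet]; positivity)
  rw [hf, hdet, abs_of_pos (by positivity)] at h
  exact h

theorem lintegral_comp_shear {s A B : ℝ} (hA : 0 < A) (hB : 0 < B) (Φ : ℝ × ℝ → ℝ≥0∞) :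
    ∫⁻ z, Φ (shear s A B z) = ENNReal.ofReal (A * B)⁻¹ * ∫⁻ z, Φ z := by
  rw [← (measurableEmbedding_shear hA.ne' hB.ne').lintegral_map, map_shear hA hB,
    lintegral_smul_measure, smul_eq_mul]

theorem integral_comp_shear {s A B : ℝ} (hA : 0 < A) (hB : 0 < B) (Φ : ℝ × ℝ → ℂ) :
    ∫ z, Φ (shear s A B z) = ((A * B)⁻¹ : ℝ) * ∫ z, Φ z := by
  rw [← (measurableEmbedding_shear hA.ne' hB.ne').integral_map, map_shear hA hB,
    integral_smul_measure, ENNReal.toReal_ofReal (by positivity), Complex.real_smul]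

theorem integrable_comp_shear {E : Type*} [NormedAddCommGroup E] {s A B : ℝ} (hA : 0 < A)
    (hB : 0 < B) {Φ : ℝ × ℝ → E}
    (h : Integrable Φ) : Integrable fun z => Φ (shear s A B z) := by
  have := (measurableEmbedding_shear (s := s) hA.ne' hB.ne').integrable_map_iff (μ := volume) (g := Φ)
  refine this.1 ?_
  rw [map_shear hA hB]
  exact h.smul_measure ENNReal.ofReal_ne_top

/-! ### Kernels in the plane -/

/-- A kernel `K` in the plane together with its Fourier transform `m`. -/
structure KernelPair (K m : ℝ × ℝ → ℂ) : Prop where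
  cont_left : Continuous K
  cont_right : Continuous m
  int_left : Integrable K
  int_right : Integrable m
  fourier : ∀ ξ, ∫ z, K z * wave (-ξ) z = m ξ
  fourierInv : ∀ z, ∫ ξ, m ξ * wave ξ z = K z

theorem FourierPair.prod {φ₁ χ₁ φ₂ χ₂ : ℝ → ℂ} (h₁ : FourierPair φ₁ χ₁) (h₂ : FourierPair φ₂ χ₂) :
    KernelPair (fun z => φ₁ z.1 * φ₂ z.2) (fun ξ => χ₁ ξ.1 * χ₂ ξ.2) where
  cont_left := (h₁.cont_left.comp continuous_fst).mul (h₂.cont_left.comp continuous_snd)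
  cont_right := (h₁.cont_right.comp continuous_fst).mul (h₂.cont_right.comp continuous_snd)
  int_left := h₁.int_left.mul_prod h₂.int_left
  int_right := h₁.int_right.mul_prod h₂.int_right
  fourier := fun ξ => by
    rw [← h₁.fourier, ← h₂.fourier, ← integral_prod_mul]
    refine integral_congr_ae (.of_forall fun z => ?_)
    simp only [wave, Prod.fst_neg, Prod.snd_neg, mul_neg, ee_add]; ring
  fourierInv := fun z => by
    rw [← h₁.fourierInv, ← h₂.fourierInv, ← integral_prod_mul]
    refine integral_congr_ae (.of_forall fun ξ => ?_)
    simp only [wave, ee_add]; ring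

theorem KernelPair.comp_shear {K m : ℝ × ℝ → ℂ} (h : KernelPair K m) {s A B : ℝ} (hA : 0 < A)
    (hB : 0 < B) :
    KernelPair (fun z => (A * B : ℝ) * K (shear s A B z))
      (fun ξ => m (ξ.1 / A, (ξ.2 - s * ξ.1) / B)) := by
  have key : ∀ ξ : ℝ × ℝ, ((ξ.1 / A, (ξ.2 - s * ξ.1) / B) : ℝ × ℝ)
      = (shear (-s) B⁻¹ A⁻¹ ξ.swap).swap := by
    intro ξ; simp only [shear, Prod.swap]; ext <;> simp <;> ring
  have hswap : ∀ {Φ : ℝ × ℝ → ℂ}, Integrable Φ → Integrable fun z : ℝ × ℝ => Φ z.swap := fun h => h.swap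
  have hswap' : ∀ Φ : ℝ × ℝ → ℂ, ∫ z : ℝ × ℝ, Φ z.swap = ∫ z, Φ z :=
    fun Φ => integral_prod_swap Φ
  have hne : ((A * B : ℝ) : ℂ) ≠ 0 := by
    rw [Complex.ofReal_ne_zero]; positivity
  refine ⟨?_, ?_, ?_, ?_, ?_, ?_⟩
  · exact continuous_const.mul (h.cont_left.comp (continuous_shear s A B))
  · exact h.cont_right.comp (by fun_prop)
  · exact (integrable_comp_shear hA hB h.int_left).const_mul _
  · simp_rw [key]
    exact hswap (integrable_comp_shear (inv_pos.2 hB) (inv_pos.2 hA) (hswap h.int_right))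
  · intro ξ
    rw [← h.fourier]
    have := integral_comp_shear (s := s) hA hB
      (fun w => K w * wave (-(ξ.1 / A, (ξ.2 - s * ξ.1) / B)) w)
    rw [Complex.ofReal_inv, eq_inv_mul_iff_mul_eq₀ hne, ← integral_const_mul] at this
    rw [← this]
    refine integral_congr_ae (.of_forall fun z => ?_)
    simp only
    rw [wave_eq_shear (s := s) hA.ne' hB.ne', mul_assoc]
    congr 3
    simp only [Prod.fst_neg, Prod.snd_neg, Prod.neg_mk]
    congr 1 <;> ring
  · intro z
    have e1 : ∀ ξ : ℝ × ℝ, m (ξ.1 / A, (ξ.2 - s * ξ.1) / B) * wave ξ z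
        = (fun η : ℝ × ℝ => (fun ζ : ℝ × ℝ => m ζ.swap * wave ζ.swap (shear s A B z))
          (shear (-s) B⁻¹ A⁻¹ η)) ξ.swap := by
      intro ξ
      simp only
      rw [← key, ← wave_eq_shear hA.ne' hB.ne']
    rw [integral_congr_ae (.of_forall e1), hswap' (fun η : ℝ × ℝ => (fun ζ : ℝ × ℝ => m ζ.swap * wave ζ.swap (shear s A B z))
          (shear (-s) B⁻¹ A⁻¹ η)), integral_comp_shear (inv_pos.2 hB) (inv_pos.2 hA)
        (fun ζ : ℝ × ℝ => m ζ.swap * wave ζ.swap (shear s A B z)),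
      hswap' (fun ζ => m ζ * wave ζ (shear s A B z)), h.fourierInv]
    congr 2
    field_simp

/-! ### Convolution with a kernel -/

/-- Convolution with the kernel `K`. -/
noncomputable def cv (K g : ℝ × ℝ → ℂ) (z : ℝ × ℝ) : ℂ := ∫ z', K (z - z') * g z'

theorem integrable_cv_integrand {K g : ℝ × ℝ → ℂ} (hK : Integrable K) (hg : Integrable g) :
    Integrable (fun p : (ℝ × ℝ) × (ℝ × ℝ) => K (p.1 - p.2) * g p.2) (volume.prod volume) := by
  have := Integrable.convolution_integrand (ContinuousLinearMap.mul ℂ ℂ) hg hK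
  simpa [mul_comm] using this

theorem integrable_cv {K g : ℝ × ℝ → ℂ} (hK : Integrable K) (hg : Integrable g) :
    Integrable (cv K g) :=
  (integrable_cv_integrand hK hg).integral_prod_left

theorem integral_cv_mul_wave {K g : ℝ × ℝ → ℂ} (hK : Integrable K) (hg : Integrable g)
    (ξ : ℝ × ℝ) :
    ∫ z, cv K g z * wave ξ z = (∫ z, K z * wave ξ z) * ∫ z, g z * wave ξ z := by
  have e1 : ∀ z, cv K g z * wave ξ z = ∫ z', K (z - z') * g z' * wave ξ z := fun z => by
    rw [cv, ← integral_mul_const]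
  simp_rw [e1]
  rw [integral_integral_swap]
  · rw [← integral_const_mul]
    refine integral_congr_ae (.of_forall fun z' => ?_)
    simp only
    rw [← integral_sub_right_eq_self (fun u => K u * wave ξ u) z', mul_comm, ← integral_const_mul]
    refine integral_congr_ae (.of_forall fun z => ?_)
    simp only
    have : wave ξ z = wave ξ (z - z') * wave ξ z' := by rw [← wave_add_right, sub_add_cancel]
    rw [this]; ring
  · refine (integrable_cv_integrand hK hg).mul_bdd (c := 1) ?_ (.of_forall fun p => ?_)
    · exact (measurable_wave measurable_const measurable_fst).aestronglyMeasurable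
    · simp

/-- Integrability of the multiplier as well as the kernel makes this a plain Fubini argument, valid
at every point, with no extension to square-integrable functions. -/
theorem cv_eq_integral_multiplier {K m g : ℝ × ℝ → ℂ} (h : KernelPair K m) (hg : Integrable g)
    (z : ℝ × ℝ) : cv K g z = ∫ ξ, m ξ * (∫ z', g z' * wave (-ξ) z') * wave ξ z := by
  have e1 : ∀ z', K (z - z') * g z' = ∫ ξ, m ξ * g z' * (wave (-ξ) z' * wave ξ z) := fun z' => by
    rw [← h.fourierInv, ← integral_mul_const]
    refine integral_congr_ae (.of_forall fun ξ => ?_)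
    simp only
    rw [sub_eq_add_neg, wave_add_right, wave_neg_right]; ring
  rw [cv]
  simp_rw [e1]
  rw [integral_integral_swap]
  · refine integral_congr_ae (.of_forall fun ξ => ?_)
    simp only
    rw [← integral_const_mul, ← integral_mul_const]
    refine integral_congr_ae (.of_forall fun z' => ?_)
    simp only; ring
  · have hi : Integrable (fun p : (ℝ × ℝ) × (ℝ × ℝ) => m p.2 * g p.1) (volume.prod volume) := by
      simpa [mul_comm] using hg.mul_prod h.int_right
    refine hi.mul_bdd (c := 1) ?_ (.of_forall fun p => by simp)
    exact ((measurable_wave measurable_snd.neg measurable_fst).mul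
      (measurable_wave measurable_snd measurable_const)).aestronglyMeasurable

/-- Plancherel's identity for a convolution. -/
theorem integral_conj_cv_mul_cv {K m g : ℝ × ℝ → ℂ} (h : KernelPair K m) (hg : Integrable g) :
    ∫ z, conj (cv K g z) * cv K g z =
      ∫ ξ, conj (m ξ * ∫ z, g z * wave (-ξ) z) * (m ξ * ∫ z, g z * wave (-ξ) z) := by
  have hcv := integrable_cv h.int_left hg
  have hcont : Continuous fun ξ => ∫ z, g z * wave (-ξ) z := by
    refine continuous_of_dominated (bound := fun z => ‖g z‖) (fun ξ => ?_) (fun ξ => ?_) hg.norm ?_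
    · exact hg.aestronglyMeasurable.mul (measurable_wave (by fun_prop) (by fun_prop)).aestronglyMeasurable
    · exact .of_forall fun z => by simp
    · exact .of_forall fun z => by fun_prop
  have hmg : Integrable fun ξ => m ξ * ∫ z, g z * wave (-ξ) z := by
    refine h.int_right.mul_bdd (c := ∫ z, ‖g z‖) hcont.aestronglyMeasurable (.of_forall fun ξ => ?_)
    refine (norm_integral_le_integral_norm _).trans (le_of_eq ?_)
    simp
  -- Only one copy of the convolution is expanded through its multiplier; after Fubini the other
  -- copy is integrated against plane waves.
  have e1 : ∀ z, conj (cv K g z) * cv K g z =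
      ∫ ξ, conj (cv K g z) * ((m ξ * ∫ z, g z * wave (-ξ) z) * wave ξ z) := fun z => by
    rw [integral_const_mul, ← cv_eq_integral_multiplier h hg]
  simp_rw [e1]
  rw [integral_integral_swap]
  · refine integral_congr_ae (.of_forall fun ξ => ?_)
    simp only
    rw [← h.fourier, ← integral_cv_mul_wave h.int_left hg, ← integral_conj, ← integral_mul_const]
    refine integral_congr_ae (.of_forall fun z => ?_)
    simp only [map_mul, conj_wave, neg_neg]; ring
  · have hc : Integrable fun z => conj (cv K g z) :=
      hcv.norm.mono' (continuous_conj.comp_aestronglyMeasurable hcv.aestronglyMeasurable)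
        (.of_forall fun z => by simp)
    have hi := hc.mul_prod hmg
    have : (Function.uncurry fun z ξ =>
        conj (cv K g z) * ((m ξ * ∫ z, g z * wave (-ξ) z) * wave ξ z)) = fun p =>
        (conj (cv K g p.1) * (m p.2 * ∫ z, g z * wave (-p.2) z)) * wave p.2 p.1 := by
      funext p; simp only [Function.uncurry]; ring
    rw [this]
    refine hi.mul_bdd (c := 1) ?_ (.of_forall fun p => by simp)
    exact (measurable_wave measurable_snd measurable_fst).aestronglyMeasurable

/-! ### The planar Fourier transform and mean-square bounds for convolutions -/

/-- The Fourier transform of an integrable function on the plane. -/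
noncomputable def planeFourier (g : ℝ × ℝ → ℂ) (ξ : ℝ × ℝ) : ℂ := ∫ z, g z * wave (-ξ) z

theorem continuous_planeFourier {g : ℝ × ℝ → ℂ} (hg : Integrable g) :
    Continuous (planeFourier g) := by
  refine continuous_of_dominated (bound := fun z => ‖g z‖) (fun ξ => ?_) (fun ξ => ?_) hg.norm ?_
  · exact hg.aestronglyMeasurable.mul (measurable_wave (by fun_prop) (by fun_prop)).aestronglyMeasurable
  · exact .of_forall fun z => by simp
  · exact .of_forall fun z => by fun_prop

theorem norm_planeFourier_le (g : ℝ × ℝ → ℂ) (ξ : ℝ × ℝ) :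
    ‖planeFourier g ξ‖ ≤ ∫ z, ‖g z‖ := by
  refine (norm_integral_le_integral_norm _).trans (le_of_eq ?_)
  simp

theorem ofReal_integral_conj_mul_self {f : ℝ × ℝ → ℂ} (hf : Integrable f) {C : ℝ}
    (hC : ∀ z, ‖f z‖ ≤ C) :
    ∫⁻ z, ‖f z‖ₑ ^ 2 = ENNReal.ofReal (∫ z, conj (f z) * f z).re := by
  have hi : Integrable fun z => ‖f z‖ ^ 2 := by
    have := hf.norm.mul_bdd (c := C) hf.norm.aestronglyMeasurable
      (.of_forall fun z => by simpa using hC z)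
    refine this.congr (.of_forall fun z => ?_)
    simp [sq]
  have e1 : ∫ z, conj (f z) * f z = ((∫ z, ‖f z‖ ^ 2 : ℝ) : ℂ) := by
    rw [← integral_complex_ofReal]
    refine integral_congr_ae (.of_forall fun z => ?_)
    simp only
    rw [← normSq_eq_conj_mul_self, normSq_eq_norm_sq]
  rw [e1, ofReal_re, ofReal_integral_eq_lintegral_ofReal hi (.of_forall fun z => by positivity)]
  refine lintegral_congr fun z => ?_
  rw [ENNReal.ofReal_pow (norm_nonneg _), ofReal_norm]

theorem norm_cv_le {K m g : ℝ × ℝ → ℂ} (h : KernelPair K m) (hg : Integrable g) :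
    ∃ C, ∀ z, ‖cv K g z‖ ≤ C := by
  refine ⟨∫ ξ, ‖m ξ * planeFourier g ξ‖, fun z => ?_⟩
  rw [cv_eq_integral_multiplier h hg]
  refine (norm_integral_le_integral_norm _).trans (le_of_eq ?_)
  simp [planeFourier]

theorem lintegral_cv_sq {K m g : ℝ × ℝ → ℂ} (h : KernelPair K m) (hg : Integrable g)
    {B : ℝ} (hm : ∀ ξ, ‖m ξ‖ ≤ B) :
    ∫⁻ z, ‖cv K g z‖ₑ ^ 2 = ∫⁻ ξ, ‖m ξ‖ₑ ^ 2 * ‖planeFourier g ξ‖ₑ ^ 2 := by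
  obtain ⟨C, hC⟩ := norm_cv_le h hg
  have hB : 0 ≤ B := (norm_nonneg _).trans (hm 0)
  have hmg : Integrable fun ξ => m ξ * planeFourier g ξ :=
    h.int_right.mul_bdd (c := ∫ z, ‖g z‖) (continuous_planeFourier hg).aestronglyMeasurable
      (.of_forall fun ξ => norm_planeFourier_le g ξ)
  rw [ofReal_integral_conj_mul_self (integrable_cv h.int_left hg) hC,
    integral_conj_cv_mul_cv h hg]
  have := ofReal_integral_conj_mul_self hmg (C := B * ∫ z, ‖g z‖) fun ξ => by
    rw [norm_mul]
    exact mul_le_mul (hm ξ) (norm_planeFourier_le g ξ) (norm_nonneg _) hB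
  simp only [planeFourier] at this
  rw [← this]
  refine lintegral_congr fun ξ => ?_
  rw [enorm_mul, mul_pow]; rfl

theorem enorm_cv_le (K g : ℝ × ℝ → ℂ) (z : ℝ × ℝ) :
    ‖cv K g z‖ₑ ≤ ∫⁻ z', ‖K (z - z')‖ₑ * ‖g z'‖ₑ := by
  refine (enorm_integral_le_lintegral_enorm _).trans (le_of_eq ?_)
  simp [enorm_mul]

/-- Cauchy–Schwarz for the measure with density f, obtained by splitting `f = f^{1/2} · f^{1/2}`. -/
theorem lintegral_mul_sq_le {α : Type*} [MeasurableSpace α] {μ : Measure α} {f g : α → ℝ≥0∞}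
    (hf : AEMeasurable f μ) (hg : AEMeasurable g μ) :
    (∫⁻ a, f a * g a ∂μ) ^ 2 ≤ (∫⁻ a, f a ∂μ) * ∫⁻ a, f a * g a ^ 2 ∂μ := by
  have h := ENNReal.lintegral_mul_le_Lp_mul_Lq μ (p := 2) (q := 2)
    (by constructor <;> norm_num) (hf.pow_const (1 / 2 : ℝ)) ((hf.pow_const (1 / 2 : ℝ)).mul hg)
  have e1 : ∀ a, f a ^ (1 / 2 : ℝ) * (f a ^ (1 / 2 : ℝ) * g a) = f a * g a := fun a => by
    rw [← mul_assoc, ← ENNReal.rpow_add_of_nonneg _ _ (by norm_num) (by norm_num)]; norm_num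
  have e2 : ∀ a, (f a ^ (1 / 2 : ℝ)) ^ (2 : ℝ) = f a := fun a => by
    rw [← ENNReal.rpow_mul]; norm_num
  have e3 : ∀ a, (f a ^ (1 / 2 : ℝ) * g a) ^ (2 : ℝ) = f a * g a ^ 2 := fun a => by
    rw [ENNReal.mul_rpow_of_nonneg _ _ (by norm_num), e2]; norm_num
  simp only [Pi.mul_apply, e1, e2, e3] at h
  calc _ ≤ _ := pow_le_pow_left₀ zero_le h 2
    _ = _ := by
      rw [mul_pow, ← ENNReal.rpow_natCast, ← ENNReal.rpow_natCast, ← ENNReal.rpow_mul,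
        ← ENNReal.rpow_mul]
      norm_num

/-- Young's inequality for an integrable kernel acting in mean square: Cauchy–Schwarz with respect
to `|K|`, then Tonelli. -/
theorem lintegral_cv_sq_le {K g : ℝ × ℝ → ℂ} (hK : Integrable K) (hg : Integrable g) :
    ∫⁻ z, ‖cv K g z‖ₑ ^ 2 ≤ (∫⁻ z, ‖K z‖ₑ) ^ 2 * ∫⁻ z, ‖g z‖ₑ ^ 2 := by
  have hKm : AEMeasurable (fun p : (ℝ × ℝ) × (ℝ × ℝ) => ‖K (p.1 - p.2)‖ₑ) (volume.prod volume) :=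
    (hK.aestronglyMeasurable.comp_quasiMeasurePreserving
      (quasiMeasurePreserving_sub_of_right_invariant volume volume)).enorm
  have hm : ∀ z, AEMeasurable (fun z' => ‖K (z - z')‖ₑ) :=
    fun z => (hK.aestronglyMeasurable.comp_quasiMeasurePreserving
      (quasiMeasurePreserving_sub_left_of_right_invariant volume z)).enorm
  have h1 : ∀ z, ‖cv K g z‖ₑ ^ 2 ≤ (∫⁻ z, ‖K z‖ₑ) * ∫⁻ z', ‖K (z - z')‖ₑ * ‖g z'‖ₑ ^ 2 := by
    intro z
    refine (pow_le_pow_left₀ zero_le (enorm_cv_le K g z) 2).trans ?_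
    refine (lintegral_mul_sq_le (hm z) hg.aestronglyMeasurable.enorm).trans ?_
    rw [lintegral_sub_left_eq_self (fun u => ‖K u‖ₑ) z]
  calc ∫⁻ z, ‖cv K g z‖ₑ ^ 2
      ≤ ∫⁻ z, (∫⁻ z, ‖K z‖ₑ) * ∫⁻ z', ‖K (z - z')‖ₑ * ‖g z'‖ₑ ^ 2 := lintegral_mono h1
    _ = (∫⁻ z, ‖K z‖ₑ) * ∫⁻ z, ∫⁻ z', ‖K (z - z')‖ₑ * ‖g z'‖ₑ ^ 2 :=
        lintegral_const_mul' _ _ hK.2.ne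
    _ = (∫⁻ z, ‖K z‖ₑ) * ∫⁻ z', ∫⁻ z, ‖K (z - z')‖ₑ * ‖g z'‖ₑ ^ 2 := by
        rw [lintegral_lintegral_swap]
        exact hKm.mul ((hg.aestronglyMeasurable.enorm.pow_const 2).comp_quasiMeasurePreserving
          Measure.quasiMeasurePreserving_snd)
    _ = (∫⁻ z, ‖K z‖ₑ) * ∫⁻ z', (∫⁻ z, ‖K z‖ₑ) * ‖g z'‖ₑ ^ 2 := by
        congr 1
        refine lintegral_congr fun z' => ?_
        rw [lintegral_mul_const' _ _ (by simp),
          lintegral_sub_right_eq_self (fun u => ‖K u‖ₑ) z']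
    _ = _ := by rw [lintegral_const_mul' _ _ hK.2.ne]; ring

/-! ### Functions with prescribed spectrum -/

/-- `H` is the inverse Fourier transform of a (push-forward of a) finite complex measure carried
by `E`. -/
def HasSpectrum (E : Set (ℝ × ℝ)) (H : ℝ × ℝ → ℂ) : Prop :=
  ∃ (Ω : Type) (_ : MeasurableSpace Ω) (μ : Measure Ω) (f : Ω → ℂ) (φ : Ω → ℝ × ℝ),
    SFinite μ ∧ Integrable f μ ∧ Measurable φ ∧ (∀ ω, f ω ≠ 0 → φ ω ∈ E) ∧
      ∀ z, H z = ∫ ω, f ω * wave (φ ω) z ∂μ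

namespace HasSpectrum

variable {E E' : Set (ℝ × ℝ)} {H H' : ℝ × ℝ → ℂ}

theorem bounded (h : HasSpectrum E H) : ∃ C, ∀ z, ‖H z‖ ≤ C := by
  obtain ⟨Ω, _, μ, f, φ, _, hf, hφ, hE, hH⟩ := h
  refine ⟨∫ ω, ‖f ω‖ ∂μ, fun z => ?_⟩
  rw [hH]
  exact (norm_integral_le_integral_norm _).trans (le_of_eq (by simp))

theorem continuous (h : HasSpectrum E H) : Continuous H := by
  obtain ⟨Ω, _, μ, f, φ, _, hf, hφ, hE, hH⟩ := h
  rw [show H = fun z => ∫ ω, f ω * wave (φ ω) z ∂μ from funext hH]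
  refine continuous_of_dominated (bound := fun ω => ‖f ω‖) (fun z => ?_) (fun z => ?_) hf.norm ?_
  · exact hf.aestronglyMeasurable.mul (measurable_wave hφ measurable_const).aestronglyMeasurable
  · exact .of_forall fun ω => by simp
  · exact .of_forall fun ω => by fun_prop

theorem mul (h : HasSpectrum E H) (h' : HasSpectrum E' H') :
    HasSpectrum {ζ | ∃ ξ ∈ E, ∃ η ∈ E', ζ = ξ + η} (fun z => H z * H' z) := by
  obtain ⟨Ω, _, μ, f, φ, _, hf, hφ, hE, hH⟩ := h
  obtain ⟨Ω', _, μ', f', φ', _, hf', hφ', hE', hH'⟩ := h'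
  refine ⟨Ω × Ω', inferInstance, μ.prod μ', fun p => f p.1 * f' p.2, fun p => φ p.1 + φ' p.2,
    inferInstance, hf.mul_prod hf', by fun_prop, fun p hp => ?_, fun z => ?_⟩
  · exact ⟨_, hE _ (left_ne_zero_of_mul hp), _, hE' _ (right_ne_zero_of_mul hp), rfl⟩
  · simp only [hH, hH']
    rw [← integral_prod_mul]
    refine integral_congr_ae (.of_forall fun p => ?_)
    simp only [wave_add]; ring

theorem star (h : HasSpectrum E H) : HasSpectrum {ζ | -ζ ∈ E} (fun z => conj (H z)) := by
  obtain ⟨Ω, _, μ, f, φ, _, hf, hφ, hE, hH⟩ := h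
  refine ⟨Ω, inferInstance, μ, fun ω => conj (f ω), fun ω => -φ ω, inferInstance,
    ?_, hφ.neg, fun ω hω => ?_, fun z => ?_⟩
  · exact hf.norm.mono' (continuous_conj.comp_aestronglyMeasurable hf.aestronglyMeasurable)
      (.of_forall fun z => by simp)
  · show - -φ ω ∈ E
    rw [neg_neg]
    exact hE ω fun h0 => hω (by simp [h0])
  · simp only [hH]
    rw [← integral_conj]
    refine integral_congr_ae (.of_forall fun p => ?_)
    simp

/-- By Fubini, pairing with H only sees the transform of the other factor on the spectrum. This
yields both the vanishing of cross terms and the insertion of frequency projections. -/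
theorem integral_mul_eq (h : HasSpectrum E H) {v w : ℝ × ℝ → ℂ} (hv : Integrable v)
    (hw : Integrable w) (hvw : ∀ ξ ∈ E, ∫ z, v z * wave ξ z = ∫ z, w z * wave ξ z) :
    ∫ z, H z * v z = ∫ z, H z * w z := by
  obtain ⟨Ω, _, μ, f, φ, _, hf, hφ, hE, hH⟩ := h
  have key : ∀ u : ℝ × ℝ → ℂ, Integrable u →
      ∫ z, H z * u z = ∫ ω, f ω * (∫ z, u z * wave (φ ω) z) ∂μ := by
    intro u hu
    have e1 : ∀ z, H z * u z = ∫ ω, f ω * (u z * wave (φ ω) z) ∂μ := fun z => by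
      rw [hH, ← integral_mul_const]
      refine integral_congr_ae (.of_forall fun p => ?_)
      simp only; ring
    simp_rw [e1]
    rw [integral_integral_swap]
    · simp_rw [integral_const_mul]
    · have hi := hu.mul_prod hf
      have e2 : (Function.uncurry fun z ω => f ω * (u z * wave (φ ω) z)) =
          fun p => (u p.1 * f p.2) * wave (φ p.2) p.1 := by
        funext p; simp only [Function.uncurry]; ring
      rw [e2]
      refine hi.mul_bdd (c := 1) ?_ (.of_forall fun p => by simp)
      exact (measurable_wave (hφ.comp measurable_snd) measurable_fst).aestronglyMeasurable
  rw [key v hv, key w hw]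
  refine integral_congr_ae (.of_forall fun ω => ?_)
  simp only
  by_cases h0 : f ω = 0
  · simp [h0]
  · rw [hvw _ (hE ω h0)]

theorem integral_mul_eq_zero (h : HasSpectrum E H) {w : ℝ × ℝ → ℂ}
    (hw : Integrable w) (h0 : ∀ ξ ∈ E, ∫ z, w z * wave ξ z = 0) :
    ∫ z, H z * w z = 0 := by
  rw [h.integral_mul_eq hw (integrable_zero _ _ _) (fun ξ hξ => by simp [h0 ξ hξ])]
  simp

/-- Reproducing formula. -/
theorem eq_integral_sub (h : HasSpectrum E H) {Φ : ℝ × ℝ → ℂ} (hΦ : Integrable Φ)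
    (h1 : ∀ ξ ∈ E, ∫ z, Φ z * wave (-ξ) z = 1) (z : ℝ × ℝ) :
    H z = ∫ z', H (z - z') * Φ z' := by
  obtain ⟨Ω, _, μ, f, φ, _, hf, hφ, hE, hH⟩ := h
  have e1 : ∀ z', H (z - z') * Φ z' = ∫ ω, f ω * (Φ z' * (wave (φ ω) z * wave (-φ ω) z')) ∂μ := by
    intro z'
    rw [hH, ← integral_mul_const]
    refine integral_congr_ae (.of_forall fun p => ?_)
    simp only
    rw [sub_eq_add_neg, wave_add_right, wave_neg_right]; ring
  simp_rw [e1]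
  rw [integral_integral_swap]
  · rw [hH]
    refine integral_congr_ae (.of_forall fun ω => ?_)
    simp only
    by_cases h0 : f ω = 0
    · simp [h0]
    · rw [integral_const_mul]
      have := h1 _ (hE ω h0)
      congr 1
      have e3 : ∀ z', Φ z' * (wave (φ ω) z * wave (-φ ω) z') =
          wave (φ ω) z * (Φ z' * wave (-φ ω) z') := fun z' => by ring
      simp_rw [e3]
      rw [integral_const_mul, this, mul_one]
  · have hi := hΦ.mul_prod hf
    have e2 : (Function.uncurry fun z' ω => f ω * (Φ z' * (wave (φ ω) z * wave (-φ ω) z'))) =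
        fun p => (Φ p.1 * f p.2) * (wave (φ p.2) z * wave (-φ p.2) p.1) := by
      funext p; simp only [Function.uncurry]; ring
    rw [e2]
    refine hi.mul_bdd (c := 1) ?_ (.of_forall fun p => by simp)
    exact ((measurable_wave (hφ.comp measurable_snd) measurable_const).mul
      (measurable_wave (hφ.comp measurable_snd).neg measurable_fst)).aestronglyMeasurable

end HasSpectrum

/-! ### Geometry of a convex curve -/

/-- `Γ` is a function with derivative `σ` and second derivative between `c` and `L`. -/
structure ConvexCurve (c L : ℝ) (Γ σ : ℝ → ℝ) : Prop where
  pos : 0 < c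
  hasDerivAt : ∀ t, HasDerivAt Γ (σ t) t
  lower : ∀ t t', t' ≤ t → c * (t - t') ≤ σ t - σ t'
  upper : ∀ t t', t' ≤ t → σ t - σ t' ≤ L * (t - t')

namespace ConvexCurve

variable {c L : ℝ} {Γ σ : ℝ → ℝ}

theorem le (h : ConvexCurve c L Γ σ) : c ≤ L := by
  have h1 := h.lower 1 0 (by norm_num)
  have h2 := h.upper 1 0 (by norm_num)
  linarith

theorem pos' (h : ConvexCurve c L Γ σ) : 0 < L := h.pos.trans_le h.le

theorem abs_slope_sub_le (h : ConvexCurve c L Γ σ) (t t' : ℝ) : |σ t - σ t'| ≤ L * |t - t'| := by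
  have hc := h.pos
  rcases le_total t' t with ht | ht
  · rw [abs_of_nonneg (sub_nonneg.2 ht), abs_of_nonneg]
    · exact h.upper _ _ ht
    · nlinarith [h.lower _ _ ht]
  · rw [abs_sub_comm, abs_sub_comm t, abs_of_nonneg (sub_nonneg.2 ht), abs_of_nonneg]
    · exact h.upper _ _ ht
    · nlinarith [h.lower _ _ ht]

theorem le_abs_slope_sub (h : ConvexCurve c L Γ σ) (t t' : ℝ) : c * |t - t'| ≤ |σ t - σ t'| := by
  rcases le_total t' t with ht | ht
  · rw [abs_of_nonneg (sub_nonneg.2 ht)]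
    exact (h.lower _ _ ht).trans (le_abs_self _)
  · rw [abs_sub_comm, abs_sub_comm (σ t), abs_of_nonneg (sub_nonneg.2 ht)]
    exact (h.lower _ _ ht).trans (le_abs_self _)

/-- Mean value inequality for `Γ - σ(t) · id`, whose derivative is at most `L R` within distance R
of t. -/
theorem abs_tilt_le (h : ConvexCurve c L Γ σ) {t p q R : ℝ} (hp : |p - t| ≤ R) (hq : |q - t| ≤ R) :
    |Γ p - Γ q - σ t * (p - q)| ≤ L * R * |p - q| := by
  have hd : ∀ u ∈ Set.Icc (t - R) (t + R), HasDerivWithinAt (fun u => Γ u - σ t * u) (σ u - σ t)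
      (Set.Icc (t - R) (t + R)) u := fun u _ => by
    have := (h.hasDerivAt u).sub ((hasDerivAt_id u).const_mul (σ t))
    rw [mul_one] at this
    exact this.hasDerivWithinAt
  have hb : ∀ u ∈ Set.Icc (t - R) (t + R), ‖σ u - σ t‖ ≤ L * R := fun u hu => by
    refine (h.abs_slope_sub_le u t).trans (mul_le_mul_of_nonneg_left ?_ h.pos'.le)
    exact abs_le.2 ⟨by linarith [hu.1], by linarith [hu.2]⟩
  have hm : ∀ {u}, |u - t| ≤ R → u ∈ Set.Icc (t - R) (t + R) := fun hu => by
    rw [abs_le] at hu; exact ⟨by linarith, by linarith⟩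
  have := (convex_Icc (t - R) (t + R)).norm_image_sub_le_of_norm_hasDerivWithin_le hd hb
    (hm hq) (hm hp)
  simp only [Real.norm_eq_abs] at this
  rwa [show Γ p - Γ q - σ t * (p - q) = Γ p - σ t * p - (Γ q - σ t * q) by ring]

/-- The increment of Γ over a chord of fixed width d is monotone in the position of the chord, since
its derivative `σ(u) - σ(u - d)` has size at least `c |d|`. This is where strict convexity enters
transversality. -/
theorem chord_separation (h : ConvexCurve c L Γ σ) (d p q : ℝ) :
    c * |d| * |p - q| ≤ |(Γ p - Γ (p - d)) - (Γ q - Γ (q - d))| := by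
  wlog hqp : q < p generalizing p q
  · rcases (not_lt.1 hqp).eq_or_lt with rfl | hlt
    · simp
    · rw [abs_sub_comm p, abs_sub_comm (Γ p - _)]
      exact this q p hlt
  have hd : ∀ u, HasDerivAt (fun u => Γ u - Γ (u - d)) (σ u - σ (u - d)) u := fun u =>
    (h.hasDerivAt u).sub ((h.hasDerivAt (u - d)).comp_sub_const u d)
  obtain ⟨ξ, -, hξ⟩ := exists_hasDerivAt_eq_slope (fun u => Γ u - Γ (u - d))
    (fun u => σ u - σ (u - d)) hqp (fun u _ => (hd u).continuousAt.continuousWithinAt)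
    (fun u _ => hd u)
  have hpq : 0 < p - q := sub_pos.2 hqp
  rw [eq_div_iff hpq.ne'] at hξ
  rw [← hξ, abs_mul]
  refine mul_le_mul_of_nonneg_right ?_ (abs_nonneg _)
  simpa using h.le_abs_slope_sub ξ (ξ - d)

/-- Transversality: differences of points determine the points. -/
theorem transversality (h : ConvexCurve c L Γ σ) {n t D p q p' q' vp vq vp' vq' : ℝ} (hn : 1 ≤ n)
    (hD : 0 ≤ D)
    (hq' : |q' - t| ≤ 2 * n)
    (hpq : n / 2 ≤ |p - q|) (hvp : |vp - Γ p| ≤ D) (hvq : |vq - Γ q| ≤ D)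
    (hvp' : |vp' - Γ p'| ≤ D) (hvq' : |vq' - Γ q'| ≤ D)
    (hα : |(p - q) - (p' - q')| ≤ 1)
    (hβ : |(vp - vq) - (vp' - vq') - σ t * ((p - q) - (p' - q'))| ≤ n) :
    |p - p'| ≤ 2 * (1 + 4 * D + 3 * L) / c := by
  -- Chords of exactly equal width d, starting at p and at p', are compared. Replacing `q'` by `p' -
  -- d` moves it by at most 1 and costs at most `3 L n` in tilted height.
  set d := p - q with hd
  have h1 := h.chord_separation d p p'
  have hL := h.pos'
  have hc := h.pos
  have e1 : p - d = q := by rw [hd]; ring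
  rw [e1] at h1
  have h2 : |(p' - d) - t| ≤ 3 * n := by
    have : (p' - d) - t = (q' - t) - (d - (p' - q')) := by ring
    rw [this]
    refine (abs_sub _ _).trans ?_
    linarith
  have h3 := h.abs_tilt_le h2 (hq'.trans (by linarith : 2 * n ≤ 3 * n))
  have e2 : p' - d - q' = -(d - (p' - q')) := by ring
  rw [e2, abs_neg] at h3
  have h4 : L * (3 * n) * |d - (p' - q')| ≤ L * (3 * n) * 1 := by gcongr
  have h5 : |(Γ p - Γ q) - (Γ p' - Γ (p' - d))| ≤ n * (1 + 4 * D + 3 * L) := by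
    have e3 : (Γ p - Γ q) - (Γ p' - Γ (p' - d)) =
        ((vp - vq) - (vp' - vq') - σ t * (d - (p' - q'))) - (vp - Γ p) + (vq - Γ q) + (vp' - Γ p')
          - (vq' - Γ q') + (Γ (p' - d) - Γ q' - σ t * -(d - (p' - q'))) := by ring
    rw [e3]
    have hDn : D ≤ n * D := by nlinarith
    have := abs_le.1 hβ
    have := abs_le.1 hvp
    have := abs_le.1 hvq
    have := abs_le.1 hvp'
    have := abs_le.1 hvq'
    have := abs_le.1 (h3.trans h4)
    rw [abs_le]
    constructor <;> linarith
  have h6 : c * |d| * |p - p'| ≤ n * (1 + 4 * D + 3 * L) := h1.trans h5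
  rw [le_div_iff₀ hc]
  have h7 : c * (n / 2) * |p - p'| ≤ n * (1 + 4 * D + 3 * L) := by
    refine le_trans ?_ h6
    gcongr
  have h8 : n * (|p - p'| * c) ≤ n * (2 * (1 + 4 * D + 3 * L)) := by linarith
  exact le_of_mul_le_mul_left h8 (by linarith)

end ConvexCurve

/-- The part of the `D`-neighbourhood of the graph of `Γ` over `[k, k + 1)`. -/
def capSet (Γ : ℝ → ℝ) (D : ℝ) (k : ℤ) : Set (ℝ × ℝ) := {ξ | ⌊ξ.1⌋ = k ∧ |ξ.2 - Γ ξ.1| ≤ D}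

/-! ### Dyadic blocks of integers -/

/-- The index of the dyadic block of length `2 ^ j` containing `k`. -/
def blk (j : ℕ) (k : ℤ) : ℤ := k / 2 ^ j

theorem blk_zero (k : ℤ) : blk 0 k = k := by simp [blk]

theorem blk_succ (j : ℕ) (k : ℤ) : blk (j + 1) k = blk j k / 2 := by
  rw [blk, blk, pow_succ, Int.ediv_ediv_of_nonneg (by positivity)]

theorem floor_mem_blk {j : ℕ} {u : ℝ} {k : ℤ} (hk : ⌊u⌋ = k) :
    (blk j k : ℝ) * 2 ^ j ≤ u ∧ u < (blk j k + 1) * 2 ^ j := by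
  have h1 : k / 2 ^ j * 2 ^ j ≤ k := Int.ediv_mul_le k (by positivity)
  have h2 : k < (k / 2 ^ j + 1) * 2 ^ j := Int.lt_ediv_add_one_mul_self k (by positivity)
  have h3 := Int.floor_le u
  have h4 := Int.lt_floor_add_one u
  rw [hk] at h3 h4
  have h2' : k + 1 ≤ (k / 2 ^ j + 1) * 2 ^ j := h2
  constructor
  · refine le_trans ?_ h3
    exact_mod_cast h1
  · refine h4.trans_le ?_
    exact_mod_cast h2'

/-- Closeness persists at coarser levels, so each pair has a first level of closeness; that level is
its Whitney scale. -/
theorem blk_close_succ {j : ℕ} {k l : ℤ} (h : |blk j k - blk j l| ≤ 1) :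
    |blk (j + 1) k - blk (j + 1) l| ≤ 1 := by
  rw [blk_succ, blk_succ]
  rw [abs_le] at h ⊢
  omega

/-! ### Dyadic nodes and the Whitney decomposition -/

/-- Dyadic nodes `(j, M)`, standing for the block of length `2 ^ j` with index `M`. -/
abbrev Node := ℕ × ℤ

/-- The length of a node. -/
noncomputable def Node.len (ν : Node) : ℝ := 2 ^ ν.1

/-- The left end point of a node. -/
noncomputable def Node.pt (ν : Node) : ℝ := ν.2 * 2 ^ ν.1

theorem Node.len_pos (ν : Node) : 0 < ν.len := by unfold len; positivity

theorem Node.one_le_len (ν : Node) : 1 ≤ ν.len := one_le_pow₀ (by norm_num)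

/-- The indices in the node and its two neighbours. -/
def nbrs (K : Finset ℤ) (ν : Node) : Finset ℤ := K.filter fun k => |blk ν.1 k - ν.2| ≤ 1

/-- The pairs of indices in Whitney position with respect to the node. -/
def pairs (K : Finset ℤ) (ν : Node) : Finset (ℤ × ℤ) :=
  (K ×ˢ K).filter fun P => blk ν.1 P.1 = ν.2 ∧ |blk ν.1 P.1 - blk ν.1 P.2| ≤ 1 ∧
    ¬ |blk (ν.1 - 1) P.1 - blk (ν.1 - 1) P.2| ≤ 1

theorem abs_sub_pt_le {K : Finset ℤ} {ν : Node} {k : ℤ} (hk : k ∈ nbrs K ν) {u : ℝ}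
    (hu : ⌊u⌋ = k) : |u - ν.pt| ≤ 2 * ν.len := by
  have h1 := (Finset.mem_filter.1 hk).2
  obtain ⟨h2, h3⟩ := floor_mem_blk (j := ν.1) hu
  have h4 : ((blk ν.1 k : ℝ) - ν.2) ≤ 1 := by exact_mod_cast (abs_le.1 h1).2
  have h5 : -1 ≤ ((blk ν.1 k : ℝ) - ν.2) := by exact_mod_cast (abs_le.1 h1).1
  have := ν.len_pos
  unfold Node.pt Node.len at *
  rw [abs_le]
  constructor <;> nlinarith

theorem mem_nbrs_of_mem_pairs {K : Finset ℤ} {ν : Node} {P : ℤ × ℤ} (hP : P ∈ pairs K ν) :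
    P.1 ∈ nbrs K ν ∧ P.2 ∈ nbrs K ν := by
  obtain ⟨h1, h2, h3, -⟩ := Finset.mem_filter.1 hP
  rw [Finset.mem_product] at h1
  refine ⟨Finset.mem_filter.2 ⟨h1.1, by simp [h2]⟩, Finset.mem_filter.2 ⟨h1.2, ?_⟩⟩
  rwa [abs_sub_comm, ← h2]

theorem half_len_le_abs_sub {K : Finset ℤ} {ν : Node} (hν : 1 ≤ ν.1) {P : ℤ × ℤ}
    (hP : P ∈ pairs K ν) {u v : ℝ} (hu : ⌊u⌋ = P.1) (hv : ⌊v⌋ = P.2) :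
    ν.len / 2 ≤ |u - v| := by
  obtain ⟨-, -, -, h3⟩ := Finset.mem_filter.1 hP
  obtain ⟨h4, h5⟩ := floor_mem_blk (j := ν.1 - 1) hu
  obtain ⟨h6, h7⟩ := floor_mem_blk (j := ν.1 - 1) hv
  have e : ν.len / 2 = 2 ^ (ν.1 - 1) := by
    obtain ⟨i, hi⟩ : ∃ i, ν.1 = i + 1 := ⟨ν.1 - 1, by omega⟩
    rw [Node.len, hi, pow_succ]; simp
  rw [e]
  have hpos : (0 : ℝ) < 2 ^ (ν.1 - 1) := by positivity
  rw [not_le, lt_abs] at h3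
  rw [le_abs]
  rcases h3 with h3 | h3
  · left
    have : (2 : ℝ) ≤ (blk (ν.1 - 1) P.1 : ℝ) - blk (ν.1 - 1) P.2 := by exact_mod_cast h3
    nlinarith
  · right
    have : (2 : ℝ) ≤ -((blk (ν.1 - 1) P.1 : ℝ) - blk (ν.1 - 1) P.2) := by exact_mod_cast h3
    nlinarith

theorem abs_sub_le_two_len {K : Finset ℤ} {ν : Node} {P : ℤ × ℤ}
    (hP : P ∈ pairs K ν) {u v : ℝ} (hu : ⌊u⌋ = P.1) (hv : ⌊v⌋ = P.2) :
    |u - v| ≤ 2 * ν.len := by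
  obtain ⟨-, -, h3, -⟩ := Finset.mem_filter.1 hP
  obtain ⟨h4, h5⟩ := floor_mem_blk (j := ν.1) hu
  obtain ⟨h6, h7⟩ := floor_mem_blk (j := ν.1) hv
  have h8 : ((blk ν.1 P.1 : ℝ) - blk ν.1 P.2) ≤ 1 := by exact_mod_cast (abs_le.1 h3).2
  have h9 : -1 ≤ ((blk ν.1 P.1 : ℝ) - blk ν.1 P.2) := by exact_mod_cast (abs_le.1 h3).1
  have := ν.len_pos
  unfold Node.len at *
  rw [abs_le]
  constructor <;> nlinarith

/-- A level beyond which all blocks meeting `K` are adjacent. -/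
def topLevel (K : Finset ℤ) : ℕ := K.sup Int.natAbs

/-- Since `|m| < 2^{|m|}`, every index of K lies in block `-1` or `0` at this level. -/
theorem blk_topLevel_close {K : Finset ℤ} {k l : ℤ} (hk : k ∈ K) (hl : l ∈ K) :
    |blk (topLevel K) k - blk (topLevel K) l| ≤ 1 := by
  have key : ∀ m ∈ K, -1 ≤ blk (topLevel K) m ∧ blk (topLevel K) m ≤ 0 := by
    intro m hm
    have h1 : m.natAbs < 2 ^ topLevel K :=
      Nat.lt_two_pow_self.trans_le (Nat.pow_le_pow_right (by norm_num)
        (Finset.le_sup (f := Int.natAbs) hm))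
    have h1' : |m| < 2 ^ topLevel K := by
      rw [Int.abs_eq_natAbs]; exact_mod_cast h1
    rw [abs_lt] at h1'
    have hpos : (0 : ℤ) < 2 ^ topLevel K := by positivity
    unfold blk
    constructor
    · rw [Int.le_ediv_iff_mul_le hpos]; linarith
    · exact Int.lt_add_one_iff.1 (by rw [Int.ediv_lt_iff_lt_mul hpos]; linarith)
  have h1 := key k hk
  have h2 := key l hl
  rw [abs_le]
  constructor <;> linarith

/-- All nodes relevant for the index set `K`. -/
def nodes (K : Finset ℤ) : Finset Node :=
  -- Level 0 is left out: there truncated subtraction makes the two closeness conditions in `pairs`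
  -- contradictory. The product contains superfluous nodes, which carry no pairs.
  (Finset.Icc 1 (topLevel K)) ×ˢ ((Finset.Icc 1 (topLevel K)).biUnion fun j => K.image (blk j))

theorem one_le_of_mem_nodes {K : Finset ℤ} {ν : Node} (h : ν ∈ nodes K) : 1 ≤ ν.1 :=
  (Finset.mem_Icc.1 (Finset.mem_product.1 h).1).1

theorem sum_nodes_pairs {K : Finset ℤ} {A : Type*} [AddCommMonoid A] (Φ : Node → ℤ × ℤ → A) :
    ∑ ν ∈ nodes K, ∑ P ∈ pairs K ν, Φ ν P =
      ∑ P ∈ K ×ˢ K, ∑ j ∈ Finset.Icc 1 (topLevel K),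
        if |blk j P.1 - blk j P.2| ≤ 1 ∧ ¬ |blk (j - 1) P.1 - blk (j - 1) P.2| ≤ 1
          then Φ (j, blk j P.1) P else 0 := by
  rw [nodes, Finset.sum_product, Finset.sum_comm (s := K ×ˢ K)]
  refine Finset.sum_congr rfl fun j hj => ?_
  simp only [pairs, Finset.sum_filter]
  rw [Finset.sum_comm]
  refine Finset.sum_congr rfl fun P hP => ?_
  rw [Finset.sum_eq_single (blk j P.1)]
  · simp
  · intro M _ hM
    rw [if_neg]
    exact fun h => hM h.1.symm
  · intro hM
    exfalso
    exact hM (Finset.mem_biUnion.2 ⟨j, hj, Finset.mem_image_of_mem _ (Finset.mem_product.1 hP).1⟩)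

/-- The Whitney decomposition of a double sum. -/
theorem sum_product_eq_whitney {K : Finset ℤ} {A : Type*} [AddCommGroup A] (Φ : ℤ × ℤ → A) :
    ∑ P ∈ K ×ˢ K, Φ P = ∑ P ∈ (K ×ˢ K).filter (fun P => |P.1 - P.2| ≤ 1), Φ P +
      ∑ ν ∈ nodes K, ∑ P ∈ pairs K ν, Φ P := by
  rw [sum_nodes_pairs (fun _ => Φ), Finset.sum_filter, ← Finset.sum_add_distrib]
  refine Finset.sum_congr rfl fun P hP => ?_
  rw [Finset.mem_product] at hP
  -- The closeness indicator is telescoped in the level: at level 0 it selects the near-diagonal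
  -- pairs, at the top level every pair, and it jumps exactly once in between for the others.
  let q : ℕ → A := fun j => if |blk j P.1 - blk j P.2| ≤ 1 then Φ P else 0
  have h1 : ∀ J, q J = q 0 + ∑ j ∈ Finset.Icc 1 J,
      if |blk j P.1 - blk j P.2| ≤ 1 ∧ ¬ |blk (j - 1) P.1 - blk (j - 1) P.2| ≤ 1
          then Φ P else 0 := by
    intro J
    induction J with
    | zero => simp
    | succ J ih =>
      rw [Finset.sum_Icc_succ_top (by omega), ← add_assoc, ← ih]
      simp only [q, Nat.add_sub_cancel]
      by_cases hJ : |blk J P.1 - blk J P.2| ≤ 1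
      · simp [hJ, blk_close_succ hJ]
      · simp [hJ]
  have h2 : q (topLevel K) = Φ P := if_pos (blk_topLevel_close hP.1 hP.2)
  refine h2.symm.trans ((h1 _).trans ?_)
  simp only [q, blk_zero]

/-! ### Weighted sums over Whitney pairs -/

/-- Concavity of `u ↦ u^{s-1}`, with the tangent taken at the right end point `y + x`. It is one
step of a telescoping sum, arranged without subtraction. -/
theorem increment_mul_rpow_le {s : ℝ} (hs1 : 1 < s) (hs2 : s ≤ 2) {x y : ℝ≥0∞} (hx : x ≠ ∞)
    (hy : y ≠ ∞) :
    x * (y + x) ^ (s - 2) + ENNReal.ofReal (s - 1)⁻¹ * y ^ (s - 1) ≤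
      ENNReal.ofReal (s - 1)⁻¹ * (y + x) ^ (s - 1) := by
  lift x to ℝ≥0 using hx
  lift y to ℝ≥0 using hy
  have hs : 0 < s - 1 := by linarith
  rcases eq_or_ne (y + x) 0 with h0 | h0
  · have : y = 0 ∧ x = 0 := by simpa using h0
    simp [this.1, this.2, hs]
  rw [← ENNReal.coe_add, ← ENNReal.coe_rpow_of_ne_zero h0, ← ENNReal.coe_rpow_of_nonneg _ hs.le,
    ← ENNReal.coe_rpow_of_nonneg _ hs.le, ENNReal.ofReal]
  norm_cast
  rw [← NNReal.coe_le_coe]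
  push_cast
  rw [Real.coe_toNNReal _ (inv_nonneg.2 hs.le)]
  have hpos : (0 : ℝ) < y + x := by
    have := pos_iff_ne_zero.2 h0
    exact_mod_cast this
  have hx0 : (0 : ℝ) ≤ x := x.2
  have hy0 : (0 : ℝ) ≤ y := y.2
  have key : (y : ℝ) ^ (s - 1) ≤ ((y : ℝ) + x) ^ (s - 1) - (s - 1) * (x * ((y : ℝ) + x) ^ (s - 2)) := by
    have h1 := rpow_one_add_le_one_add_mul_self (s := -(x / (y + x) : ℝ)) (p := s - 1)
      (by rw [neg_le_neg_iff, div_le_one hpos]; linarith) hs.le (by linarith)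
    have e1 : 1 + -(x / (y + x) : ℝ) = y / (y + x) := by field_simp; ring
    rw [e1, Real.div_rpow hy0 hpos.le, div_le_iff₀ (Real.rpow_pos_of_pos hpos _)] at h1
    refine h1.trans (le_of_eq ?_)
    have e2 : ((y : ℝ) + x) ^ (s - 1) = (y + x) ^ (s - 2) * (y + x) := by
      rw [← Real.rpow_add_one hpos.ne']; ring_nf
    rw [e2]; field_simp; ring
  have h2 : (s - 1)⁻¹ * (y : ℝ) ^ (s - 1) ≤ (s - 1)⁻¹ *
      (((y : ℝ) + x) ^ (s - 1) - (s - 1) * (x * ((y : ℝ) + x) ^ (s - 2))) :=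
    mul_le_mul_of_nonneg_left key (inv_nonneg.2 hs.le)
  have h3 : (s - 1)⁻¹ * (((y : ℝ) + x) ^ (s - 1) - (s - 1) * (x * ((y : ℝ) + x) ^ (s - 2))) =
    (s - 1)⁻¹ * ((y : ℝ) + x) ^ (s - 1) - x * ((y : ℝ) + x) ^ (s - 2) := by
    field_simp
  linarith

/-- The sum over all Whitney pairs, weighted by the local mass, is controlled by the total mass. -/
theorem sum_pairs_weighted_le {K : Finset ℤ} {s : ℝ} (hs1 : 1 < s) (hs2 : s ≤ 2) {a : ℤ → ℝ≥0∞}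
    (ha : ∀ k, a k ≠ ∞) :
    ∑ ν ∈ nodes K, ∑ P ∈ pairs K ν, a P.1 * a P.2 * (∑ k ∈ nbrs K ν, a k) ^ (s - 2) ≤
      ENNReal.ofReal (s - 1)⁻¹ * (∑ k ∈ K, a k) ^ s := by
  rw [sum_nodes_pairs (fun ν P => a P.1 * a P.2 * (∑ k ∈ nbrs K ν, a k) ^ (s - 2)),
    Finset.sum_product]
  have hfin : ∀ S : Finset ℤ, ∑ k ∈ S, a k ≠ ∞ := fun S => ENNReal.sum_ne_top.2 fun k _ => ha k
  have key : ∀ k ∈ K, ∑ l ∈ K, ∑ j ∈ Finset.Icc 1 (topLevel K),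
      (if |blk j k - blk j l| ≤ 1 ∧ ¬ |blk (j - 1) k - blk (j - 1) l| ≤ 1 then
        a k * a l * (∑ m ∈ nbrs K (j, blk j k), a m) ^ (s - 2) else 0) ≤
      a k * (ENNReal.ofReal (s - 1)⁻¹ * (∑ k ∈ K, a k) ^ (s - 1)) := by
    intro k hk
    let Y : ℕ → ℝ≥0∞ := fun j => ∑ m ∈ nbrs K (j, blk j k), a m
    let x : ℕ → ℝ≥0∞ := fun j => ∑ l ∈ K.filter
      (fun l => |blk (j + 1) k - blk (j + 1) l| ≤ 1 ∧ ¬ |blk j k - blk j l| ≤ 1), a l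
    -- For fixed k the mass near k grows, from one level to the next, exactly by the indices whose
    -- Whitney partner scale with k is `j + 1`. The weight at that node is the mass after the
    -- increment.
    have hY : ∀ j, Y (j + 1) = Y j + x j := by
      intro j
      simp only [Y, x, nbrs, Finset.sum_filter, ← Finset.sum_add_distrib]
      refine Finset.sum_congr rfl fun l _ => ?_
      rw [abs_sub_comm (blk (j + 1) l), abs_sub_comm (blk j l)]
      by_cases hj : |blk j k - blk j l| ≤ 1
      · simp [hj, blk_close_succ hj]
      · simp [hj]
    have hx : ∀ J, ∑ j ∈ Finset.range J, x j * Y (j + 1) ^ (s - 2) ≤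
        ENNReal.ofReal (s - 1)⁻¹ * Y J ^ (s - 1) := by
      intro J
      induction J with
      | zero => simp
      | succ J ih =>
        rw [Finset.sum_range_succ, add_comm]
        refine (add_le_add le_rfl ih).trans ?_
        rw [hY]
        exact increment_mul_rpow_le hs1 hs2 (hfin _) (hfin _)
    calc _ = a k * ∑ j ∈ Finset.range (topLevel K), x j * Y (j + 1) ^ (s - 2) := by
          rw [Finset.sum_comm, ← Finset.Ico_add_one_right_eq_Icc, Finset.sum_Ico_eq_sum_range,
            Finset.mul_sum]
          refine Finset.sum_congr rfl fun j _ => ?_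
          simp only [x, Y, Finset.sum_filter, Finset.sum_mul, Finset.mul_sum, add_comm 1 j,
            Nat.add_sub_cancel]
          refine Finset.sum_congr rfl fun l _ => ?_
          split_ifs
          · rw [mul_assoc]
          · simp
      _ ≤ a k * (ENNReal.ofReal (s - 1)⁻¹ * Y (topLevel K) ^ (s - 1)) := by gcongr; exact hx _
      _ ≤ _ := by
          have hle : Y (topLevel K) ≤ ∑ k ∈ K, a k :=
            Finset.sum_le_sum_of_subset (Finset.filter_subset _ K)
          gcongr
  calc _ ≤ ∑ k ∈ K, a k * (ENNReal.ofReal (s - 1)⁻¹ * (∑ k ∈ K, a k) ^ (s - 1)) :=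
        Finset.sum_le_sum key
    _ = _ := by
        rw [← Finset.sum_mul, mul_left_comm]
        congr 1
        have := ENNReal.rpow_add_of_nonneg (x := ∑ k ∈ K, a k) 1 (s - 1) (by norm_num) (by linarith)
        rw [ENNReal.rpow_one] at this
        rw [← this]; congr 1; ring

/-! ### Almost orthogonality -/

theorem lintegral_enorm_sq_mul_ofReal {f : ℝ × ℝ → ℂ} (hc : Continuous f) {C : ℝ}
    (hb : ∀ z, ‖f z‖ ≤ C) {w : ℝ × ℝ → ℝ} (hw : Integrable w) (hw0 : ∀ z, 0 ≤ w z) :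
    ∫⁻ z, ‖f z‖ₑ ^ 2 * ENNReal.ofReal (w z) = ENNReal.ofReal (∫ z, ‖f z‖ ^ 2 * w z) := by
  have hi : Integrable fun z => ‖f z‖ ^ 2 * w z :=
    hw.bdd_mul (c := C ^ 2) (hc.norm.pow 2).aestronglyMeasurable (.of_forall fun z => by
      rw [Real.norm_of_nonneg (by positivity)]
      exact pow_le_pow_left₀ (norm_nonneg _) (hb z) 2)
  rw [ofReal_integral_eq_lintegral_ofReal hi
    (.of_forall fun z => mul_nonneg (by positivity) (hw0 z))]
  refine lintegral_congr fun z => ?_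
  rw [ENNReal.ofReal_mul (by positivity), ENNReal.ofReal_pow (norm_nonneg _), ofReal_norm]

/-- After expanding the square only cross terms between near indices survive. Each is bounded by
half the sum of the two diagonal terms, and each diagonal term is used at most N times by symmetry
of the relation. -/
theorem lintegral_sum_sq_mul_le {ι : Type*} {S : Finset ι} {H : ι → ℝ × ℝ → ℂ}
    (hc : ∀ i ∈ S, Continuous (H i)) (hb : ∀ i ∈ S, ∃ C, ∀ z, ‖H i z‖ ≤ C)
    {w : ℝ × ℝ → ℝ} (hw : Integrable w) (hw0 : ∀ z, 0 ≤ w z)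
    (near : ι → ι → Prop) [DecidableRel near] (hsymm : ∀ i j, near i j → near j i) {N : ℕ}
    (hN : ∀ i ∈ S, (S.filter (near i)).card ≤ N)
    (h0 : ∀ i ∈ S, ∀ j ∈ S, ¬ near i j → ∫ z, H i z * conj (H j z) * w z = 0) :
    ∫⁻ z, ‖∑ i ∈ S, H i z‖ₑ ^ 2 * ENNReal.ofReal (w z) ≤
      N * ∫⁻ z, (∑ i ∈ S, ‖H i z‖ₑ ^ 2) * ENNReal.ofReal (w z) := by
  choose! C hC using hb
  have hint : ∀ i ∈ S, ∀ j ∈ S, Integrable fun z => ‖H i z‖ * ‖H j z‖ * w z := fun i hi j hj =>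
    hw.bdd_mul (c := C i * C j) ((hc i hi).norm.mul (hc j hj).norm).aestronglyMeasurable
      (.of_forall fun z => by
        rw [Real.norm_of_nonneg (by positivity)]
        exact mul_le_mul (hC i hi z) (hC j hj z) (norm_nonneg _)
          ((norm_nonneg _).trans (hC i hi z)))
  have hintc : ∀ i ∈ S, ∀ j ∈ S, Integrable fun z => H i z * conj (H j z) * w z :=
    fun i hi j hj => by
    refine (hint i hi j hj).mono' ?_ (.of_forall fun z => ?_)
    · exact (((hc i hi).mul (continuous_conj.comp (hc j hj))).aestronglyMeasurable).mul
        (continuous_ofReal.comp_aestronglyMeasurable hw.aestronglyMeasurable)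
    · simp [abs_of_nonneg (hw0 z)]
  have hsum : ∀ z, ‖∑ i ∈ S, H i z‖ ≤ ∑ i ∈ S, C i := fun z =>
    (norm_sum_le _ _).trans (Finset.sum_le_sum fun i hi => hC i hi z)
  rw [lintegral_enorm_sq_mul_ofReal (continuous_finsetSum _ hc) hsum hw hw0]
  have hR : (N : ℝ≥0∞) * ∫⁻ z, (∑ i ∈ S, ‖H i z‖ₑ ^ 2) * ENNReal.ofReal (w z) =
      ENNReal.ofReal (N * ∑ i ∈ S, ∫ z, ‖H i z‖ ^ 2 * w z) := by
    simp_rw [Finset.sum_mul]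
    rw [lintegral_finsetSum' _ fun i hi => ?_]
    · rw [ENNReal.ofReal_mul (by positivity), ENNReal.ofReal_natCast, ENNReal.ofReal_sum_of_nonneg]
      · congr 1
        exact Finset.sum_congr rfl fun i hi =>
          lintegral_enorm_sq_mul_ofReal (hc i hi) (hC i hi) hw hw0
      · exact fun i _ => integral_nonneg fun z => mul_nonneg (by positivity) (hw0 z)
    · exact (((hc i hi).measurable.enorm.pow_const 2).aemeasurable).mul
        hw.aestronglyMeasurable.aemeasurable.ennreal_ofReal
  rw [hR]
  refine ENNReal.ofReal_le_ofReal ?_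
  set I : ι → ℝ := fun i => ∫ z, ‖H i z‖ ^ 2 * w z with hI
  have e1 : ((∫ z, ‖∑ i ∈ S, H i z‖ ^ 2 * w z : ℝ) : ℂ) =
      ∑ i ∈ S, ∑ j ∈ S, ∫ z, H i z * conj (H j z) * w z := by
    rw [← integral_complex_ofReal]
    have : ∀ z, ((‖∑ i ∈ S, H i z‖ ^ 2 * w z : ℝ) : ℂ) =
        ∑ i ∈ S, ∑ j ∈ S, H i z * conj (H j z) * w z := by
      intro z
      rw [ofReal_mul, ← normSq_eq_norm_sq, normSq_eq_conj_mul_self, mul_comm (conj _), map_sum,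
        Finset.sum_mul_sum, Finset.sum_mul]
      simp_rw [Finset.sum_mul]
    simp_rw [this]
    rw [integral_finsetSum _ fun i hi => integrable_finsetSum _ fun j hj => hintc i hi j hj]
    exact Finset.sum_congr rfl fun i hi => integral_finsetSum _ fun j hj => hintc i hi j hj
  have h1 : ∀ i ∈ S, ∀ j ∈ S, ‖∫ z, H i z * conj (H j z) * w z‖ ≤
      if near i j then (I i + I j) / 2 else 0 := by
    intro i hi j hj
    split_ifs with hij
    · refine (norm_integral_le_integral_norm _).trans ?_
      have h2 : (I i + I j) / 2 = ∫ z, (‖H i z‖ * ‖H i z‖ * w z + ‖H j z‖ * ‖H j z‖ * w z) / 2 := by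
        rw [integral_div, integral_add (hint i hi i hi) (hint j hj j hj)]
        simp only [hI, sq]
      rw [h2]
      refine integral_mono (hintc i hi j hj).norm
        (((hint i hi i hi).add (hint j hj j hj)).div_const 2) fun z => ?_
      simp only [norm_mul, RCLike.norm_conj, norm_real, Real.norm_eq_abs, abs_of_nonneg (hw0 z)]
      nlinarith [mul_nonneg (sq_nonneg (‖H i z‖ - ‖H j z‖)) (hw0 z)]
    · rw [h0 i hi j hj hij, norm_zero]
  have hI0 : ∀ i, 0 ≤ I i := fun i => integral_nonneg fun z => mul_nonneg (by positivity) (hw0 z)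
  calc ∫ z, ‖∑ i ∈ S, H i z‖ ^ 2 * w z
      ≤ ‖((∫ z, ‖∑ i ∈ S, H i z‖ ^ 2 * w z : ℝ) : ℂ)‖ := by
        rw [norm_real]; exact le_abs_self _
    _ ≤ ∑ i ∈ S, ∑ j ∈ S, if near i j then (I i + I j) / 2 else 0 := by
        rw [e1]
        refine (norm_sum_le _ _).trans (Finset.sum_le_sum fun i hi => ?_)
        exact (norm_sum_le _ _).trans (Finset.sum_le_sum fun j hj => h1 i hi j hj)
    _ = ∑ i ∈ S, ∑ j ∈ S, (if near i j then I i else 0) := by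
        have : ∀ i j, (if near i j then (I i + I j) / 2 else 0) =
          (if near i j then I i else 0) / 2 + (if near j i then I j else 0) / 2 := by
          intro i j
          by_cases hij : near i j
          · simp [hij, hsymm i j hij]; ring
          · have : ¬ near j i := fun h => hij (hsymm j i h)
            simp [hij, this]
        simp_rw [this, Finset.sum_add_distrib]
        rw [Finset.sum_comm (f := fun i j => (if near j i then I j else 0) / 2)]
        simp_rw [← Finset.sum_div]
        ring
    _ ≤ ∑ i ∈ S, N * I i := by
        refine Finset.sum_le_sum fun i hi => ?_
        rw [← Finset.sum_filter, Finset.sum_const, nsmul_eq_mul]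
        exact mul_le_mul_of_nonneg_right (by exact_mod_cast hN i hi) (hI0 i)
    _ = N * ∑ i ∈ S, I i := by rw [Finset.mul_sum]

/-! ### The weight attached to a node -/

/-- `w` is an admissible profile: nonnegative, continuous, rapidly decaying, and its Fourier
transform vanishes outside `(-1, 1)`. -/
structure Profile (w : ℝ → ℝ) : Prop where
  cont : Continuous w
  nonneg : ∀ x, 0 ≤ w x
  int : Integrable w
  pos : 0 < w 0
  fourier : ∀ t, 1 ≤ |t| → ∫ x, (w x : ℂ) * ee (x * t) = 0
  decay : ∀ M : ℕ, ∃ B : ℝ, 0 < B ∧ ∀ x, w x ≤ B * ((1 + x ^ 2) ^ M)⁻¹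

theorem exists_profile : ∃ w, Profile w := by
  obtain ⟨w, h1, h2, h3, h4, h5, h6⟩ := exists_weight one_pos
  exact ⟨w, h1, h2, h3, h4, h5, h6⟩

/-- The planar weight adapted to slope `s` and length `n`. -/
noncomputable def boxWeight (w : ℝ → ℝ) (s n : ℝ) (z : ℝ × ℝ) : ℝ :=
  n * (w (shear s 1 n z).1 * w (shear s 1 n z).2)

namespace Profile

variable {w : ℝ → ℝ}

theorem boxWeight_nonneg (hw : Profile w) {n : ℝ} (hn : 0 < n) (s : ℝ) (z : ℝ × ℝ) :
    0 ≤ boxWeight w s n z :=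
  mul_nonneg hn.le (mul_nonneg (hw.nonneg _) (hw.nonneg _))

theorem continuous_boxWeight (hw : Profile w) (s n : ℝ) : Continuous (boxWeight w s n) :=
  continuous_const.mul ((hw.cont.comp (continuous_fst.comp (continuous_shear s 1 n))).mul
    (hw.cont.comp (continuous_snd.comp (continuous_shear s 1 n))))

theorem integrable_boxWeight (hw : Profile w) {n : ℝ} (hn : 0 < n) (s : ℝ) :
    Integrable (boxWeight w s n) :=
  (integrable_comp_shear one_pos hn (hw.int.mul_prod hw.int)).const_mul n

/-- The weight lives on a box of size `1 × n⁻¹` sheared by s, so its transform lives on the dual box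
`|ξ₁| < 1`, `|ξ₂ - s ξ₁| < n`, which matches the tolerance in `ConvexCurve.transversality`. -/
theorem integral_boxWeight_mul_wave (hw : Profile w) {n : ℝ} (hn : 0 < n) (s : ℝ) {ξ : ℝ × ℝ}
    (hξ : 1 ≤ |ξ.1| ∨ n ≤ |ξ.2 - s * ξ.1|) :
    ∫ z, (boxWeight w s n z : ℂ) * wave ξ z = 0 := by
  have e1 : ∀ z, (boxWeight w s n z : ℂ) * wave ξ z = n * (fun u : ℝ × ℝ =>
      ((w u.1 : ℂ) * ee (u.1 * ξ.1)) * ((w u.2 : ℂ) * ee (u.2 * ((ξ.2 - s * ξ.1) / n))))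
      (shear s 1 n z) := by
    intro z
    rw [wave_eq_shear (s := s) one_ne_zero hn.ne']
    simp only [wave, boxWeight, ee_add, div_one]
    push_cast; ring
  rw [integral_congr_ae (.of_forall e1), integral_const_mul,
    integral_comp_shear one_pos hn (fun u : ℝ × ℝ =>
      ((w u.1 : ℂ) * ee (u.1 * ξ.1)) * ((w u.2 : ℂ) * ee (u.2 * ((ξ.2 - s * ξ.1) / n)))), Measure.volume_eq_prod,
    integral_prod_mul (fun x => (w x : ℂ) * ee (x * ξ.1))
      (fun y => (w y : ℂ) * ee (y * ((ξ.2 - s * ξ.1) / n)))]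
  rcases hξ with h | h
  · rw [hw.fourier _ h]; simp
  · rw [hw.fourier ((ξ.2 - s * ξ.1) / n)]
    · simp
    · rwa [abs_div, abs_of_pos hn, le_div_iff₀ hn, one_mul]

theorem integral_boxWeight_sub_mul_wave (hw : Profile w) {n : ℝ} (hn : 0 < n) (s : ℝ) {ξ : ℝ × ℝ}
    (hξ : 1 ≤ |ξ.1| ∨ n ≤ |ξ.2 - s * ξ.1|) (z : ℝ × ℝ) :
    ∫ u, (boxWeight w s n (z - u) : ℂ) * wave ξ u = 0 := by
  have e1 : ∀ u, (boxWeight w s n (z - u) : ℂ) * wave ξ u =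
      (fun v => wave ξ z * ((boxWeight w s n v : ℂ) * wave (-ξ) v)) (z - u) := by
    intro u
    simp only
    rw [← wave_neg_right ξ, mul_left_comm, ← wave_add_right]
    congr 2
    abel
  simp_rw [e1]
  rw [integral_sub_left_eq_self (fun v => wave ξ z * ((boxWeight w s n v : ℂ) * wave (-ξ) v)),
    integral_const_mul, hw.integral_boxWeight_mul_wave hn s, mul_zero]
  rw [Prod.fst_neg, Prod.snd_neg, abs_neg]
  rwa [show -ξ.2 - s * -ξ.1 = -(ξ.2 - s * ξ.1) by ring, abs_neg]

end Profile

/-! ### Bilinear terms at a node -/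

/-- The slope at a node. -/
noncomputable def Node.slope (σ : ℝ → ℝ) (ν : Node) : ℝ := σ ν.pt

/-- The bilinear expression attached to a node. -/
noncomputable def bilin (K : Finset ℤ) (F : ℤ → ℝ × ℝ → ℂ) (ν : Node) (z : ℝ × ℝ) : ℂ :=
  ∑ P ∈ pairs K ν, F P.1 z * conj (F P.2 z)

theorem card_near_le (S : Finset (ℤ × ℤ)) (P : ℤ × ℤ) (C : ℕ) :
    (S.filter fun Q => |P.1 - Q.1| ≤ C ∧ |P.2 - Q.2| ≤ C).card ≤ (2 * C + 1) ^ 2 := by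
  calc _ ≤ (Finset.Icc (P.1 - C) (P.1 + C) ×ˢ Finset.Icc (P.2 - C) (P.2 + C)).card := by
        refine Finset.card_le_card fun Q hQ => ?_
        obtain ⟨-, h1, h2⟩ := Finset.mem_filter.1 hQ
        rw [abs_le] at h1 h2
        simp only [Finset.mem_product, Finset.mem_Icc]
        omega
    _ = _ := by
        rw [Finset.card_product, Int.card_Icc, Int.card_Icc, sq]
        congr 1 <;> omega

section

variable {c L D : ℝ} {Γ σ : ℝ → ℝ} {w : ℝ → ℝ} {K : Finset ℤ} {F : ℤ → ℝ × ℝ → ℂ}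

/-- Two pairs interact under the weight only if their difference frequencies agree up to the dual
box. Transversality then makes the pairs close, so each pair interacts with boundedly many others.
In the hypothesis on C, the summand 2 pays for rounding and for passing from the first points to the
second. -/
theorem lintegral_bilin_sq_mul_boxWeight_le (hΓ : ConvexCurve c L Γ σ) (hD : 0 ≤ D)
    (hw : Profile w) (hF : ∀ k ∈ K, HasSpectrum (capSet Γ D k) (F k)) {ν : Node} (hν : 1 ≤ ν.1)
    {C : ℕ} (hC : 2 * (1 + 4 * D + 3 * L) / c + 2 ≤ C) (z : ℝ × ℝ) :
    ∫⁻ u, ‖bilin K F ν u‖ₑ ^ 2 * ENNReal.ofReal (boxWeight w (ν.slope σ) ν.len (z - u)) ≤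
      ((2 * C + 1) ^ 2 : ℕ) * ∫⁻ u, (∑ P ∈ pairs K ν, ‖F P.1 u‖ₑ ^ 2 * ‖F P.2 u‖ₑ ^ 2) *
        ENNReal.ofReal (boxWeight w (ν.slope σ) ν.len (z - u)) := by
  have hmem : ∀ P ∈ pairs K ν, P.1 ∈ K ∧ P.2 ∈ K := fun P hP =>
    Finset.mem_product.1 (Finset.mem_filter.1 hP).1
  have hspec : ∀ P ∈ pairs K ν, HasSpectrum _ (fun u => F P.1 u * conj (F P.2 u)) := fun P hP =>
    (hF _ (hmem P hP).1).mul (hF _ (hmem P hP).2).star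
  have hint := (hw.integrable_boxWeight ν.len_pos (ν.slope σ)).comp_sub_left z
  have := lintegral_sum_sq_mul_le (S := pairs K ν)
    (H := fun P u => F P.1 u * conj (F P.2 u)) (fun P hP => (hspec P hP).continuous)
    (fun P hP => (hspec P hP).bounded) hint
    (fun u => hw.boxWeight_nonneg ν.len_pos _ _)
    (fun P Q => |P.1 - Q.1| ≤ (C : ℤ) ∧ |P.2 - Q.2| ≤ (C : ℤ))
    (fun P Q h => by rwa [abs_sub_comm Q.1, abs_sub_comm Q.2])
    (fun P _ => card_near_le (pairs K ν) P C) ?_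
  · refine this.trans (le_of_eq ?_)
    simp [enorm_mul, mul_pow]
  · intro P hP Q hQ hPQ
    refine ((hspec P hP).mul (hspec Q hQ).star).integral_mul_eq_zero hint.ofReal ?_
    rintro ζ ⟨η, ⟨p, hp, q', hq, rfl⟩, θ, ⟨p', hp', r', hq', hθ⟩, rfl⟩
    obtain ⟨q, rfl⟩ : ∃ q, q' = -q := ⟨-q', by simp⟩
    obtain ⟨r, rfl⟩ : ∃ r, r' = -r := ⟨-r', by simp⟩
    obtain rfl : θ = -(p' + -r) := by rw [← hθ, neg_neg]
    simp only [Set.mem_ofPred_eq, neg_neg] at hq hq'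
    refine hw.integral_boxWeight_sub_mul_wave ν.len_pos _ ?_ z
    by_contra hcon
    push Not at hcon
    obtain ⟨hα, hβ⟩ := hcon
    simp only [Prod.fst_add, Prod.snd_add, Prod.fst_neg, Prod.snd_neg] at hα hβ
    have hα' : |p.1 - q.1 - (p'.1 - r.1)| ≤ 1 := by
      refine le_trans (le_of_eq ?_) hα.le; congr 1
    have hβ' : |(p.2 - q.2) - (p'.2 - r.2) - σ ν.pt * ((p.1 - q.1) - (p'.1 - r.1))| ≤ ν.len := by
      refine le_trans (le_of_eq ?_) hβ.le; rw [Node.slope]; congr 1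
    have key := hΓ.transversality ν.one_le_len hD (t := ν.pt)
      (abs_sub_pt_le (mem_nbrs_of_mem_pairs hQ).2 hq'.1)
      (half_len_le_abs_sub hν hP hp.1 hq.1) hp.2 hq.2 hp'.2 hq'.2 hα' hβ'
    apply hPQ
    have f1 := Int.floor_le p.1
    have f2 := Int.lt_floor_add_one p.1
    have f3 := Int.floor_le q.1
    have f4 := Int.lt_floor_add_one q.1
    have f5 := Int.floor_le p'.1
    have f6 := Int.lt_floor_add_one p'.1
    have f7 := Int.floor_le r.1
    have f8 := Int.lt_floor_add_one r.1
    rw [hp.1] at f1 f2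
    rw [hq.1] at f3 f4
    rw [hp'.1] at f5 f6
    rw [hq'.1] at f7 f8
    have k1 := abs_le.1 key
    have k2 := abs_le.1 hα'
    have t1 : (P.1 : ℝ) - Q.1 < C + 1 := by linarith
    have t2 : (Q.1 : ℝ) - P.1 < C + 1 := by linarith
    have t3 : (P.2 : ℝ) - Q.2 < C + 1 := by linarith
    have t4 : (Q.2 : ℝ) - P.2 < C + 1 := by linarith
    have u1 : P.1 - Q.1 < C + 1 := by exact_mod_cast t1
    have u2 : Q.1 - P.1 < C + 1 := by exact_mod_cast t2
    have u3 : P.2 - Q.2 < C + 1 := by exact_mod_cast t3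
    have u4 : Q.2 - P.2 < C + 1 := by exact_mod_cast t4
    constructor <;> rw [abs_le] <;> omega

end

/-! ### Slowly varying weights -/

/-- The growth function in the definition of slowly varying weights. -/
noncomputable def growth (t : ℝ × ℝ) : ℝ := (4 * (1 + t.1 ^ 2) * (1 + t.2 ^ 2)) ^ 3

theorem one_le_growth (t : ℝ × ℝ) : 1 ≤ growth t := by
  refine one_le_pow₀ ?_
  nlinarith [sq_nonneg t.1, sq_nonneg t.2, mul_nonneg (sq_nonneg t.1) (sq_nonneg t.2)]

theorem growth_neg (t : ℝ × ℝ) : growth (-t) = growth t := by simp [growth]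

theorem continuous_growth : Continuous growth := by unfold growth; fun_prop

/-- `W` is slowly varying at the scale of the box with slope `s` and length `n⁻¹`. -/
def SlowlyVarying (s n : ℝ) (W : ℝ × ℝ → ℝ≥0∞) : Prop :=
  ∀ z u, W z ≤ ENNReal.ofReal (growth (shear s 1 n (z - u))) * W u

/-- In sheared coordinates the growth function bounds the ratio of two values of W from both sides,
being even. The constants are the integrals of the profile against this function and its inverse;
rapid decay makes the first finite and positivity at the origin makes the second nonzero. -/
theorem Profile.exists_average_bounds {w : ℝ → ℝ} (hw : Profile w) :
    ∃ C₁ C₂ : ℝ≥0∞, C₁ ≠ ∞ ∧ C₂ ≠ 0 ∧ ∀ (s n : ℝ), 0 < n → ∀ W : ℝ × ℝ → ℝ≥0∞,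
      SlowlyVarying s n W → ∀ u,
        ∫⁻ z, W z * ENNReal.ofReal (boxWeight w s n (z - u)) ≤ C₁ * W u ∧
        C₂ * W u ≤ ∫⁻ z, W z * ENNReal.ofReal (boxWeight w s n (z - u)) := by
  have hc : Continuous fun t : ℝ × ℝ => w t.1 * w t.2 :=
    (hw.cont.comp continuous_fst).mul (hw.cont.comp continuous_snd)
  refine ⟨∫⁻ t, ENNReal.ofReal (growth t * (w t.1 * w t.2)),
    ∫⁻ t, ENNReal.ofReal ((growth t)⁻¹ * (w t.1 * w t.2)), ?_, ?_, ?_⟩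
  · obtain ⟨B, hB, hd⟩ := hw.decay 4
    have hi : Integrable fun t : ℝ × ℝ => 64 * ((B * (1 + t.1 ^ 2)⁻¹) * (B * (1 + t.2 ^ 2)⁻¹)) :=
      ((integrable_inv_one_add_sq.const_mul B).mul_prod
        (integrable_inv_one_add_sq.const_mul B)).const_mul 64
    refine ne_top_of_le_ne_top hi.lintegral_lt_top.ne
      (lintegral_mono fun t => ENNReal.ofReal_le_ofReal ?_)
    have h1 : ∀ x : ℝ, (1 + x ^ 2) ^ 3 * w x ≤ B * (1 + x ^ 2)⁻¹ := fun x => by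
      have hx : 0 < 1 + x ^ 2 := by positivity
      calc (1 + x ^ 2) ^ 3 * w x ≤ (1 + x ^ 2) ^ 3 * (B * ((1 + x ^ 2) ^ 4)⁻¹) := by
            gcongr; exact hd x
        _ = B * (1 + x ^ 2)⁻¹ := by field_simp
    calc growth t * (w t.1 * w t.2)
        = 64 * (((1 + t.1 ^ 2) ^ 3 * w t.1) * ((1 + t.2 ^ 2) ^ 3 * w t.2)) := by
          unfold growth; ring
      _ ≤ _ := by
          refine mul_le_mul_of_nonneg_left (mul_le_mul (h1 _) (h1 _)
            (mul_nonneg (by positivity) (hw.nonneg _)) (by positivity)) (by norm_num)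
  · intro h0
    have hc' : Continuous fun t : ℝ × ℝ => ENNReal.ofReal ((growth t)⁻¹ * (w t.1 * w t.2)) :=
      ENNReal.continuous_ofReal.comp ((continuous_growth.inv₀ fun t =>
        (zero_lt_one.trans_le (one_le_growth t)).ne').mul hc)
    rw [lintegral_eq_zero_iff hc'.measurable] at h0
    have := congrFun ((hc'.ae_eq_iff_eq volume continuous_zero).1 h0) 0
    simp only [Pi.zero_apply, ENNReal.ofReal_eq_zero] at this
    have hp : 0 < (growth 0)⁻¹ * (w (0 : ℝ × ℝ).1 * w (0 : ℝ × ℝ).2) :=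
      mul_pos (inv_pos.2 (zero_lt_one.trans_le (one_le_growth _))) (mul_pos hw.pos hw.pos)
    linarith
  · intro s n hn W hW u
    have hcv : ∀ (Φ : ℝ × ℝ → ℝ), (∀ t, 0 ≤ Φ t) →
        ∫⁻ z, ENNReal.ofReal (Φ (shear s 1 n (z - u))) * ENNReal.ofReal (boxWeight w s n (z - u)) =
          ∫⁻ t, ENNReal.ofReal (Φ t * (w t.1 * w t.2)) := by
      intro Φ hΦ
      rw [lintegral_sub_right_eq_self (fun z => ENNReal.ofReal (Φ (shear s 1 n z)) *
        ENNReal.ofReal (boxWeight w s n z)) u]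
      have : ∀ z, ENNReal.ofReal (Φ (shear s 1 n z)) * ENNReal.ofReal (boxWeight w s n z) =
          ENNReal.ofReal n * (fun t : ℝ × ℝ => ENNReal.ofReal (Φ t * (w t.1 * w t.2)))
            (shear s 1 n z) := by
        intro z
        simp only
        rw [← ENNReal.ofReal_mul (hΦ _), ← ENNReal.ofReal_mul hn.le]
        congr 1; unfold boxWeight; ring
      rw [lintegral_congr this, lintegral_const_mul' _ _ ENNReal.ofReal_ne_top,
        lintegral_comp_shear one_pos hn (fun t : ℝ × ℝ => ENNReal.ofReal (Φ t * (w t.1 * w t.2))),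
        ← mul_assoc,
        ← ENNReal.ofReal_mul hn.le, one_mul, mul_inv_cancel₀ hn.ne', ENNReal.ofReal_one, one_mul]
    have hg0 : ∀ t, 0 < growth t := fun t => zero_lt_one.trans_le (one_le_growth t)
    have hbm : Measurable fun z => ENNReal.ofReal (boxWeight w s n (z - u)) :=
      ((hw.continuous_boxWeight s n).comp (continuous_id.sub continuous_const)).measurable.ennreal_ofReal
    have hgb : ∀ {Φ : ℝ × ℝ → ℝ}, Continuous Φ → Measurable fun z =>
        ENNReal.ofReal (Φ (shear s 1 n (z - u))) * ENNReal.ofReal (boxWeight w s n (z - u)) :=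
      fun hΦ => (hΦ.comp ((continuous_shear s 1 n).comp
        (continuous_id.sub continuous_const))).measurable.ennreal_ofReal.mul hbm
    constructor
    · rw [← hcv growth fun t => (hg0 t).le, ← lintegral_mul_const _ (hgb continuous_growth)]
      refine lintegral_mono fun z => ?_
      calc W z * ENNReal.ofReal (boxWeight w s n (z - u))
          ≤ ENNReal.ofReal (growth (shear s 1 n (z - u))) * W u *
            ENNReal.ofReal (boxWeight w s n (z - u)) := by gcongr; exact hW z u
        _ = _ := by ring
    · rw [← hcv (fun t => (growth t)⁻¹) fun t => (inv_pos.2 (hg0 t)).le,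
        ← lintegral_mul_const _ (hgb (Φ := fun t => (growth t)⁻¹)
          (continuous_growth.inv₀ fun t => (hg0 t).ne'))]
      refine lintegral_mono fun z => ?_
      have h1 : ENNReal.ofReal (growth (shear s 1 n (z - u)))⁻¹ * W u ≤ W z := by
        have h2 := hW u z
        rw [← neg_sub z u, shear_neg, growth_neg] at h2
        calc _ ≤ ENNReal.ofReal (growth (shear s 1 n (z - u)))⁻¹ *
              (ENNReal.ofReal (growth (shear s 1 n (z - u))) * W z) := by gcongr
          _ = W z := by
            rw [← mul_assoc, ← ENNReal.ofReal_mul (inv_pos.2 (hg0 _)).le,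
              inv_mul_cancel₀ (hg0 _).ne', ENNReal.ofReal_one, one_mul]
      calc _ = ENNReal.ofReal (growth (shear s 1 n (z - u)))⁻¹ * W u *
              ENNReal.ofReal (boxWeight w s n (z - u)) := by ring
        _ ≤ _ := by gcongr

/-- Weighted almost orthogonality: averages against box weights may be replaced by slowly varying
weights. -/
theorem Profile.exists_transfer {w : ℝ → ℝ} (hw : Profile w) (N : ℕ) :
    ∃ C : ℝ≥0, ∀ (s n : ℝ), 0 < n → ∀ f g : ℝ × ℝ → ℝ≥0∞, Measurable f → Measurable g →
      (∀ z, ∫⁻ u, f u * ENNReal.ofReal (boxWeight w s n (z - u)) ≤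
        N * ∫⁻ u, g u * ENNReal.ofReal (boxWeight w s n (z - u))) →
      ∀ W : ℝ × ℝ → ℝ≥0∞, Measurable W → SlowlyVarying s n W →
        ∫⁻ u, f u * W u ≤ C * ∫⁻ u, g u * W u := by
  obtain ⟨C₁, C₂, h1, h2, h3⟩ := hw.exists_average_bounds
  have hfin : C₂⁻¹ * (N * C₁) ≠ ∞ :=
    ENNReal.mul_ne_top (ENNReal.inv_ne_top.2 h2) (ENNReal.mul_ne_top (by simp) h1)
  refine ⟨(C₂⁻¹ * (N * C₁)).toNNReal, fun s n hn f g hf hg hfg W hWm hW => ?_⟩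
  rw [ENNReal.coe_toNNReal hfin]
  -- Testing both bounds on the constant weight 1 gives `C₂ ≤ C₁`, so the infinite case is vacuous
  -- unless W vanishes.
  have hC2 : C₂ ≠ ∞ ∨ ∫⁻ u, f u * W u = 0 := by
    by_cases hC : C₂ = ∞
    · right
      have : ∀ u, W u = 0 := by
        intro u
        by_contra h0
        have h4 := h3 s n hn W hW u
        rw [hC, ENNReal.top_mul h0, top_le_iff] at h4
        have h5 : C₁ * W u = ∞ := top_le_iff.1 (h4.2 ▸ h4.1)
        have h6 : W u = ∞ := by
          by_contra h7
          exact ENNReal.mul_ne_top h1 h7 h5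
        have h8 := h3 s n hn (fun _ => 1) (fun z u => by
          simpa using ENNReal.ofReal_le_ofReal (one_le_growth (shear s 1 n (z - u)))) u
        rw [hC] at h8
        simp only [mul_one, top_le_iff] at h8
        exact h1 (top_le_iff.1 (h8.2 ▸ h8.1))
      simp [this]
    · exact Or.inl hC
  rcases hC2 with hC2 | h0
  swap
  · rw [h0]; exact zero_le
  have hbs : Measurable fun p : (ℝ × ℝ) × (ℝ × ℝ) =>
      ENNReal.ofReal (boxWeight w s n (p.2 - p.1)) :=
    ((hw.continuous_boxWeight s n).comp (continuous_snd.sub continuous_fst)).measurable.ennreal_ofReal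
  have hbz : ∀ z : ℝ × ℝ, Measurable fun u => ENNReal.ofReal (boxWeight w s n (z - u)) := fun z =>
    ((hw.continuous_boxWeight s n).comp (continuous_const.sub continuous_id)).measurable.ennreal_ofReal
  have hbu : ∀ u : ℝ × ℝ, Measurable fun z => ENNReal.ofReal (boxWeight w s n (z - u)) := fun u =>
    ((hw.continuous_boxWeight s n).comp (continuous_id.sub continuous_const)).measurable.ennreal_ofReal
  have swap : ∀ {h : ℝ × ℝ → ℝ≥0∞}, Measurable h →
      ∫⁻ u, h u * ∫⁻ z, W z * ENNReal.ofReal (boxWeight w s n (z - u)) =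
        ∫⁻ z, W z * ∫⁻ u, h u * ENNReal.ofReal (boxWeight w s n (z - u)) := by
    intro h hh
    have e1 : ∀ u, h u * ∫⁻ z, W z * ENNReal.ofReal (boxWeight w s n (z - u)) =
        ∫⁻ z, h u * (W z * ENNReal.ofReal (boxWeight w s n (z - u))) := fun u => by
      have hm : Measurable fun z => W z * ENNReal.ofReal (boxWeight w s n (z - u)) :=
        hWm.mul (hbu u)
      rw [lintegral_const_mul _ hm]
    have e2 : ∀ z, W z * ∫⁻ u, h u * ENNReal.ofReal (boxWeight w s n (z - u)) =
        ∫⁻ u, h u * (W z * ENNReal.ofReal (boxWeight w s n (z - u))) := fun z => by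
      have hm : Measurable fun u => h u * ENNReal.ofReal (boxWeight w s n (z - u)) :=
        hh.mul (hbz z)
      rw [← lintegral_const_mul _ hm]
      exact lintegral_congr fun u => by ring
    rw [lintegral_congr e1, lintegral_congr e2]
    have hm : Measurable fun p : (ℝ × ℝ) × (ℝ × ℝ) =>
        h p.1 * (W p.2 * ENNReal.ofReal (boxWeight w s n (p.2 - p.1))) :=
      (hh.comp measurable_fst).mul ((hWm.comp measurable_snd).mul hbs)
    exact lintegral_lintegral_swap (μ := volume) (ν := volume)
      (f := fun u z => h u * (W z * ENNReal.ofReal (boxWeight w s n (z - u)))) hm.aemeasurable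
  -- W is replaced by its average for f, Tonelli exposes the hypothesis for each centre, and the
  -- average is turned back into W for g.
  calc ∫⁻ u, f u * W u = C₂⁻¹ * ∫⁻ u, f u * (C₂ * W u) := by
        have : ∀ u, f u * (C₂ * W u) = C₂ * (f u * W u) := fun u => by ring
        simp_rw [this]
        rw [lintegral_const_mul' _ _ hC2, ← mul_assoc, ENNReal.inv_mul_cancel h2 hC2, one_mul]
    _ ≤ C₂⁻¹ * ∫⁻ u, f u * ∫⁻ z, W z * ENNReal.ofReal (boxWeight w s n (z - u)) := by
        exact mul_le_mul_right (lintegral_mono fun u => mul_le_mul_right (h3 s n hn W hW u).2 _) _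
    _ = C₂⁻¹ * ∫⁻ z, W z * ∫⁻ u, f u * ENNReal.ofReal (boxWeight w s n (z - u)) := by
        rw [swap hf]
    _ ≤ C₂⁻¹ * ∫⁻ z, W z * (N * ∫⁻ u, g u * ENNReal.ofReal (boxWeight w s n (z - u))) := by
        gcongr with z
        exact hfg z
    _ = C₂⁻¹ * (N * ∫⁻ u, g u * ∫⁻ z, W z * ENNReal.ofReal (boxWeight w s n (z - u))) := by
        have : ∀ z, W z * (N * ∫⁻ u, g u * ENNReal.ofReal (boxWeight w s n (z - u))) =
          N * (W z * ∫⁻ u, g u * ENNReal.ofReal (boxWeight w s n (z - u))) := fun z => by ring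
        simp_rw [this]
        rw [lintegral_const_mul' _ _ (by simp), swap hg]
    _ ≤ C₂⁻¹ * (N * ∫⁻ u, g u * (C₁ * W u)) := by
        gcongr with u
        exact (h3 s n hn W hW u).1
    _ = _ := by
        have : ∀ u, g u * (C₁ * W u) = C₁ * (g u * W u) := fun u => by ring
        simp_rw [this]
        rw [lintegral_const_mul' _ _ h1]
        ring

/-- Almost orthogonality holds for the average around every centre, hence for every weight that is
essentially constant on the boxes of the node. -/
theorem exists_bilin_weighted (c L D : ℝ) (hD : 0 ≤ D) :
    ∃ C : ℝ≥0, ∀ Γ σ : ℝ → ℝ, ConvexCurve c L Γ σ → ∀ (K : Finset ℤ) (F : ℤ → ℝ × ℝ → ℂ),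
      (∀ k ∈ K, HasSpectrum (capSet Γ D k) (F k)) → ∀ ν : Node, 1 ≤ ν.1 →
      ∀ W : ℝ × ℝ → ℝ≥0∞, Measurable W → SlowlyVarying (ν.slope σ) ν.len W →
        ∫⁻ u, ‖bilin K F ν u‖ₑ ^ 2 * W u ≤
          C * ∫⁻ u, (∑ P ∈ pairs K ν, ‖F P.1 u‖ₑ ^ 2 * ‖F P.2 u‖ₑ ^ 2) * W u := by
  obtain ⟨w, hw⟩ := exists_profile
  obtain ⟨N, hN⟩ := exists_nat_ge (2 * (1 + 4 * D + 3 * L) / c + 2)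
  obtain ⟨C, hC⟩ := hw.exists_transfer ((2 * N + 1) ^ 2)
  refine ⟨C, fun Γ σ hΓ K F hF ν hν W hWm hW => ?_⟩
  have hm : ∀ P ∈ pairs K ν, Continuous (F P.1) ∧ Continuous (F P.2) := fun P hP => by
    have := Finset.mem_product.1 (Finset.mem_filter.1 hP).1
    exact ⟨(hF _ this.1).continuous, (hF _ this.2).continuous⟩
  refine hC _ _ ν.len_pos _ _ ?_ ?_
    (lintegral_bilin_sq_mul_boxWeight_le hΓ hD hw hF hν hN) W hWm hW
  · refine Measurable.pow_const (Measurable.enorm ?_) 2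
    refine Finset.measurable_sum _ fun P hP => ?_
    exact ((hm P hP).1.mul (continuous_conj.comp (hm P hP).2)).measurable
  · refine Finset.measurable_sum _ fun P hP => ?_
    exact ((hm P hP).1.measurable.enorm.pow_const 2).mul ((hm P hP).2.measurable.enorm.pow_const 2)

/-! ### Averages over boxes -/

/-- A polynomially decaying bump on the plane. -/
noncomputable def tail (t : ℝ × ℝ) : ℝ := (((1 + t.1 ^ 2) * (1 + t.2 ^ 2)) ^ 3)⁻¹

theorem tail_pos (t : ℝ × ℝ) : 0 < tail t := by unfold tail; positivity

theorem tail_eq_mul (t : ℝ × ℝ) : tail t = ((1 + t.1 ^ 2) ^ 3)⁻¹ * ((1 + t.2 ^ 2) ^ 3)⁻¹ := by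
  rw [tail, mul_pow, mul_inv]

theorem continuous_tail : Continuous tail := by
  unfold tail
  exact Continuous.inv₀ (by fun_prop) fun t => by positivity

theorem integrable_inv_one_add_sq_pow : Integrable fun x : ℝ => ((1 + x ^ 2) ^ 3)⁻¹ := by
  refine integrable_inv_one_add_sq.mono' ?_ (.of_forall fun x => ?_)
  · exact (Continuous.inv₀ (by fun_prop) fun t => by positivity).aestronglyMeasurable
  · rw [Real.norm_of_nonneg (by positivity)]
    exact inv_anti₀ (by positivity) (le_self_pow₀ (by nlinarith) (by norm_num))

theorem integrable_tail : Integrable tail := by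
  have := integrable_inv_one_add_sq_pow.mul_prod integrable_inv_one_add_sq_pow
  exact this.congr (.of_forall fun t => (tail_eq_mul t).symm)

/-- Peetre's inequality in each coordinate; the two factors 2 account for the 4 in `growth`. -/
theorem tail_add_le (x d : ℝ × ℝ) : tail (x + d) ≤ growth d * tail x := by
  have h : ∀ a b : ℝ, 1 + a ^ 2 ≤ 2 * (1 + (a + b) ^ 2) * (1 + b ^ 2) := fun a b => by
    nlinarith [sq_nonneg (a + 2 * b), sq_nonneg ((a + b) * b)]
  unfold tail growth
  rw [← div_eq_mul_inv, le_div_iff₀ (by positivity), inv_mul_le_iff₀ (by positivity), ← mul_pow]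
  refine pow_le_pow_left₀ (by positivity) ?_ 3
  calc (1 + x.1 ^ 2) * (1 + x.2 ^ 2)
      ≤ (2 * (1 + (x.1 + d.1) ^ 2) * (1 + d.1 ^ 2)) * (2 * (1 + (x.2 + d.2) ^ 2) * (1 + d.2 ^ 2)) :=
        mul_le_mul (h _ _) (h _ _) (by positivity) (by positivity)
    _ = _ := by simp only [Prod.fst_add, Prod.snd_add]; ring

/-- The average of `f` over boxes of slope `s` and length `n⁻¹`, with polynomial tails. -/
noncomputable def boxAvg (s n : ℝ) (f : ℝ × ℝ → ℝ≥0∞) (z : ℝ × ℝ) : ℝ≥0∞ :=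
  ∫⁻ u, f u * ENNReal.ofReal (n * tail (shear s 1 n (z - u)))

theorem measurable_tail_kernel (s n : ℝ) : Measurable fun p : (ℝ × ℝ) × (ℝ × ℝ) =>
    ENNReal.ofReal (n * tail (shear s 1 n (p.1 - p.2))) :=
  (continuous_const.mul (continuous_tail.comp ((continuous_shear s 1 n).comp
    (continuous_fst.sub continuous_snd)))).measurable.ennreal_ofReal

theorem measurable_tail_kernel_right (s n : ℝ) (z : ℝ × ℝ) : Measurable fun u : ℝ × ℝ =>
    ENNReal.ofReal (n * tail (shear s 1 n (z - u))) :=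
  (continuous_const.mul (continuous_tail.comp ((continuous_shear s 1 n).comp
    (continuous_const.sub continuous_id)))).measurable.ennreal_ofReal

theorem measurable_boxAvg (s n : ℝ) {f : ℝ × ℝ → ℝ≥0∞} (hf : Measurable f) :
    Measurable (boxAvg s n f) := by
  have : Measurable (Function.uncurry fun z u : ℝ × ℝ =>
      f u * ENNReal.ofReal (n * tail (shear s 1 n (z - u)))) :=
    (hf.comp measurable_snd).mul (measurable_tail_kernel s n)
  exact this.lintegral_prod_right'

theorem lintegral_tail_kernel (s : ℝ) {n : ℝ} (hn : 0 < n) (z : ℝ × ℝ) :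
    ∫⁻ u, ENNReal.ofReal (n * tail (shear s 1 n (z - u))) = ∫⁻ t, ENNReal.ofReal (tail t) := by
  rw [lintegral_sub_left_eq_self (fun u => ENNReal.ofReal (n * tail (shear s 1 n u))) z]
  simp_rw [ENNReal.ofReal_mul hn.le]
  rw [lintegral_const_mul' _ _ ENNReal.ofReal_ne_top,
    lintegral_comp_shear one_pos hn (fun t => ENNReal.ofReal (tail t)), ← mul_assoc,
    ← ENNReal.ofReal_mul hn.le, one_mul, mul_inv_cancel₀ hn.ne', ENNReal.ofReal_one, one_mul]

theorem boxAvg_ne_top (s : ℝ) {n : ℝ} (hn : 0 < n) {f : ℝ × ℝ → ℝ≥0∞} {B : ℝ≥0∞} (hB : B ≠ ∞)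
    (hf : ∀ z, f z ≤ B) (z : ℝ × ℝ) : boxAvg s n f z ≠ ∞ := by
  refine ne_top_of_le_ne_top (b := B * ∫⁻ t, ENNReal.ofReal (tail t))
    (ENNReal.mul_ne_top hB integrable_tail.lintegral_lt_top.ne) ?_
  rw [← lintegral_tail_kernel s hn z, ← lintegral_const_mul' _ _ hB]
  exact lintegral_mono fun u => mul_le_mul_left (hf u) _

theorem boxAvg_sum {ι : Type*} (s n : ℝ) (S : Finset ι) {f : ι → ℝ × ℝ → ℝ≥0∞}
    (hf : ∀ i ∈ S, Measurable (f i)) (z : ℝ × ℝ) :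
    boxAvg s n (fun u => ∑ i ∈ S, f i u) z = ∑ i ∈ S, boxAvg s n (f i) z := by
  unfold boxAvg
  simp_rw [Finset.sum_mul]
  exact lintegral_finsetSum S fun i hi => (hf i hi).mul (measurable_tail_kernel_right s n z)

/-- The polynomial kernel itself varies slowly, and averaging inherits this. A compactly supported
kernel would not do. -/
theorem slowlyVarying_boxAvg (s : ℝ) {n : ℝ} (hn : 0 < n) {f : ℝ × ℝ → ℝ≥0∞} (hf : Measurable f) :
    SlowlyVarying s n (boxAvg s n f) := by
  intro z u
  unfold boxAvg
  have hm : Measurable fun v => f v * ENNReal.ofReal (n * tail (shear s 1 n (u - v))) :=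
    hf.mul (measurable_tail_kernel_right s n u)
  rw [← lintegral_const_mul _ hm]
  refine lintegral_mono fun v => ?_
  have h1 : n * tail (shear s 1 n (z - v)) ≤
      growth (shear s 1 n (z - u)) * (n * tail (shear s 1 n (u - v))) := by
    have : shear s 1 n (z - v) = shear s 1 n (u - v) + shear s 1 n (z - u) := by
      simp only [shear_sub]; abel
    rw [this, mul_left_comm]
    exact mul_le_mul_of_nonneg_left (tail_add_le _ _) hn.le
  calc f v * ENNReal.ofReal (n * tail (shear s 1 n (z - v)))
      ≤ f v * ENNReal.ofReal (growth (shear s 1 n (z - u)) * (n * tail (shear s 1 n (u - v)))) := by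
        gcongr
    _ = _ := by
        rw [ENNReal.ofReal_mul (zero_le_one.trans (one_le_growth _))]; ring

/-- A negative power exchanges the roles of the two points, which is harmless because `growth` is
even; an exponent at least `-1` costs at most one factor of `growth`. The exponent used is `s - 2`.
-/
theorem SlowlyVarying.rpow_neg {s n : ℝ} {W : ℝ × ℝ → ℝ≥0∞} (h : SlowlyVarying s n W) {r : ℝ}
    (hr : -1 ≤ r) (hr0 : r ≤ 0) : SlowlyVarying s n fun z => W z ^ r := by
  intro z u
  have hg := one_le_growth (shear s 1 n (z - u))
  have h2 := h u z
  rw [← neg_sub z u, shear_neg, growth_neg] at h2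
  set G := ENNReal.ofReal (growth (shear s 1 n (z - u))) with hG
  have hG1 : 1 ≤ G := by rw [hG]; exact ENNReal.one_le_ofReal.2 hg
  have hGt : G ≠ ∞ := ENNReal.ofReal_ne_top
  have hG0 : G ≠ 0 := (zero_lt_one.trans_le hG1).ne'
  have h3 : (G * W z) ^ r ≤ W u ^ r := by
    rw [← neg_neg r, ENNReal.rpow_neg (G * W z), ENNReal.rpow_neg (W u), ENNReal.inv_le_inv]
    exact ENNReal.rpow_le_rpow h2 (by linarith)
  calc W z ^ r = G ^ (-r) * (G ^ r * W z ^ r) := by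
        rw [← mul_assoc, ← ENNReal.rpow_add _ _ hG0 hGt]; simp
    _ = G ^ (-r) * (G * W z) ^ r := by
        congr 1
        by_cases hW : W z = ∞
        · rcases hr0.eq_or_lt with rfl | hr0
          · simp
          · rw [hW, ENNReal.mul_top hG0, ENNReal.top_rpow_of_neg hr0, mul_zero]
        · exact (ENNReal.mul_rpow_of_ne_top hGt hW r).symm
    _ ≤ G ^ (1 : ℝ) * W u ^ r := by
        gcongr
        linarith
    _ = _ := by rw [ENNReal.rpow_one]

/-! ### The reproducing inequality -/

/-- Uncertainty principle: seen from the slope of a nearby node, a cap fits in a box of width about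
1 and height about n, so F is reproduced by a kernel concentrated on the dual `1 × n⁻¹` box.
Cauchy–Schwarz passes to squares. -/
theorem HasSpectrum.exists_reproducing (c L D : ℝ) (hD : 0 ≤ D) :
    ∃ C : ℝ≥0, 0 < C ∧ ∀ Γ σ : ℝ → ℝ, ConvexCurve c L Γ σ → ∀ (K : Finset ℤ) (ν : Node),
      ∀ k ∈ nbrs K ν, ∀ F : ℝ × ℝ → ℂ, HasSpectrum (capSet Γ D k) F → ∀ z,
        ‖F z‖ₑ ^ 2 ≤ C * boxAvg (ν.slope σ) ν.len (fun u => ‖F u‖ₑ ^ 2) z := by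
  by_cases hL : 0 < L
  swap
  · exact ⟨1, one_pos, fun Γ σ hΓ => absurd hΓ.pos' hL⟩
  -- The plateau must contain the cap in normalised coordinates: width 1, and height `D + 2 L` from
  -- the thickness and the tilt.
  obtain ⟨φ, χ, hφ, hχ, -, -, hdec⟩ := exists_lowpass (C := 1 + D + 2 * L) (by linarith)
  obtain ⟨B, hB, hb⟩ := hdec 3
  have hpair := hφ.prod hφ
  set k0 : ℝ × ℝ → ℂ := fun z => φ z.1 * φ z.2 with hk0
  have hk0i : Integrable k0 := hpair.int_left
  set A : ℝ≥0∞ := (∫⁻ z, ‖k0 z‖ₑ) with hA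
  have hAt : A * ENNReal.ofReal (B ^ 2) + 1 ≠ ∞ :=
    ENNReal.add_ne_top.2 ⟨ENNReal.mul_ne_top hk0i.2.ne (by simp), by simp⟩
  -- Adding 1 makes the constant positive, as needed when the inequality is raised to a negative
  -- power.
  refine ⟨(A * ENNReal.ofReal (B ^ 2) + 1).toNNReal, ?_, fun Γ σ hΓ K ν k hk F hF z => ?_⟩
  · rw [pos_iff_ne_zero, ENNReal.toNNReal_ne_zero]
    exact ⟨by simp, hAt⟩
  rw [ENNReal.coe_toNNReal hAt]
  have hn := ν.len_pos
  have hn1 := ν.one_le_len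
  have hs := hpair.comp_shear (s := ν.slope σ) (A := 1) (B := ν.len) one_pos hn
  set kk : ℝ × ℝ → ℂ := fun z => ((1 * ν.len : ℝ) : ℂ) * k0 (shear (ν.slope σ) 1 ν.len z) with hkk
  set ξ₀ : ℝ × ℝ := ((k : ℝ), Γ k) with hξ₀
  set Φ : ℝ × ℝ → ℂ := fun z => kk z * wave ξ₀ z with hΦ
  have hΦi : Integrable Φ := by
    refine hs.int_left.mul_bdd (c := 1) ?_ (.of_forall fun z => by simp)
    exact (continuous_wave continuous_const continuous_id).aestronglyMeasurable
  have hrep := hF.eq_integral_sub hΦi (fun ξ hξ => ?_) z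
  swap
  · have e1 : ∀ z, Φ z * wave (-ξ) z = kk z * wave (-(ξ - ξ₀)) z := fun z => by
      rw [hΦ]; simp only
      rw [mul_assoc, ← wave_add]; congr 2; abel
    simp_rw [e1]
    rw [hs.fourier (ξ - ξ₀)]
    have f1 := Int.floor_le ξ.1
    have f2 := Int.lt_floor_add_one ξ.1
    rw [hξ.1] at f1 f2
    have g1 : |(ξ - ξ₀).1| ≤ 1 := by
      rw [Prod.fst_sub, abs_le]; constructor <;> simp only [hξ₀] <;> linarith
    have g2 : |(ξ - ξ₀).2 - ν.slope σ * (ξ - ξ₀).1| ≤ ν.len * (D + 2 * L) := by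
      have t1 := hΓ.abs_tilt_le (t := ν.pt) (abs_sub_pt_le hk hξ.1)
        (abs_sub_pt_le hk (u := (k : ℝ)) (Int.floor_intCast k))
      have t2 : L * (2 * ν.len) * |ξ.1 - k| ≤ L * (2 * ν.len) * 1 :=
        mul_le_mul_of_nonneg_left g1 (by positivity)
      have t3 := abs_le.1 (t1.trans t2)
      have t4 := abs_le.1 hξ.2
      have t5 : D ≤ ν.len * D := by nlinarith
      rw [abs_le, Node.slope]
      simp only [hξ₀, Prod.fst_sub, Prod.snd_sub]
      constructor <;> linarith
    simp only [div_one]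
    rw [hχ _ (g1.trans (by linarith)), hχ, one_mul]
    rw [abs_div, abs_of_pos hn, div_le_iff₀ hn]
    nlinarith
  have hFm : Measurable F := hF.continuous.measurable
  have hkm : Measurable fun u => ‖kk u‖ₑ := hs.cont_left.measurable.enorm
  have hFz : Measurable fun u => ‖F (z - u)‖ₑ :=
    (hF.continuous.comp (continuous_const.sub continuous_id)).measurable.enorm
  have hΦn : ∀ u, ‖Φ u‖ₑ = ‖kk u‖ₑ := fun u => by
    rw [hΦ, enorm_mul, ← ofReal_norm (wave _ _), norm_wave]; simp
  have hkA : ∫⁻ u, ‖kk u‖ₑ = A := by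
    have : ∀ u, ‖kk u‖ₑ = ENNReal.ofReal ν.len * (fun t => ‖k0 t‖ₑ)
        (shear (ν.slope σ) 1 ν.len u) := fun u => by
      rw [hkk]; simp only
      rw [enorm_mul, ← ofReal_norm ((_ : ℝ) : ℂ), norm_real, one_mul, Real.norm_of_nonneg hn.le]
    simp_rw [this]
    rw [lintegral_const_mul' _ _ ENNReal.ofReal_ne_top, lintegral_comp_shear one_pos hn
      (fun t => ‖k0 t‖ₑ), ← mul_assoc, ← ENNReal.ofReal_mul hn.le, one_mul,
      mul_inv_cancel₀ hn.ne', ENNReal.ofReal_one, one_mul]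
  have hkb : ∀ u, ‖kk u‖ₑ ≤
      ENNReal.ofReal (B ^ 2) * ENNReal.ofReal (ν.len * tail (shear (ν.slope σ) 1 ν.len u)) := by
    intro u
    rw [← ENNReal.ofReal_mul (by positivity), ← ofReal_norm]
    refine ENNReal.ofReal_le_ofReal ?_
    rw [hkk]; simp only
    rw [norm_mul, norm_real, one_mul, Real.norm_of_nonneg hn.le, hk0, norm_mul, tail_eq_mul]
    set t := shear (ν.slope σ) 1 ν.len u
    calc ν.len * (‖φ t.1‖ * ‖φ t.2‖)
        ≤ ν.len * ((B * ((1 + t.1 ^ 2) ^ 3)⁻¹) * (B * ((1 + t.2 ^ 2) ^ 3)⁻¹)) := by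
          refine mul_le_mul_of_nonneg_left (mul_le_mul (hb _) (hb _) (norm_nonneg _)
            (by positivity)) hn.le
      _ = _ := by ring
  have h1 : ‖F z‖ₑ ≤ ∫⁻ u, ‖kk u‖ₑ * ‖F (z - u)‖ₑ := by
    rw [hrep]
    refine (enorm_integral_le_lintegral_enorm _).trans (le_of_eq (lintegral_congr fun u => ?_))
    rw [enorm_mul, hΦn, mul_comm]
  calc ‖F z‖ₑ ^ 2 ≤ (∫⁻ u, ‖kk u‖ₑ * ‖F (z - u)‖ₑ) ^ 2 := pow_le_pow_left₀ zero_le h1 2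
    _ ≤ (∫⁻ u, ‖kk u‖ₑ) * ∫⁻ u, ‖kk u‖ₑ * ‖F (z - u)‖ₑ ^ 2 :=
        lintegral_mul_sq_le hkm.aemeasurable hFz.aemeasurable
    _ ≤ A * ∫⁻ u, ENNReal.ofReal (B ^ 2) * (‖F (z - u)‖ₑ ^ 2 *
          ENNReal.ofReal (ν.len * tail (shear (ν.slope σ) 1 ν.len u))) := by
        rw [hkA]
        refine mul_le_mul_right (lintegral_mono fun u => ?_) _
        calc ‖kk u‖ₑ * ‖F (z - u)‖ₑ ^ 2 ≤ _ := mul_le_mul_left (hkb u) _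
          _ = _ := by ring
    _ = A * ENNReal.ofReal (B ^ 2) * boxAvg (ν.slope σ) ν.len (fun u => ‖F u‖ₑ ^ 2) z := by
        rw [lintegral_const_mul' _ _ ENNReal.ofReal_ne_top, mul_assoc, boxAvg,
          ← lintegral_sub_left_eq_self (fun u => ‖F u‖ₑ ^ 2 *
            ENNReal.ofReal (ν.len * tail (shear (ν.slope σ) 1 ν.len (z - u)))) z]
        simp only [sub_sub_cancel]
    _ ≤ _ := mul_le_mul_left le_self_add _

/-! ### Local sums, their averages, and the weighted bilinear bound -/

/-- The part of the square function (squared) attached to a node. -/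
noncomputable def localSum (K : Finset ℤ) (F : ℤ → ℝ × ℝ → ℂ) (ν : Node) (z : ℝ × ℝ) : ℝ≥0∞ :=
  ∑ k ∈ nbrs K ν, ‖F k z‖ₑ ^ 2

/-- The average of `localSum` over the boxes attached to the node. -/
noncomputable def localAvg (σ : ℝ → ℝ) (K : Finset ℤ) (F : ℤ → ℝ × ℝ → ℂ) (ν : Node) :
    ℝ × ℝ → ℝ≥0∞ :=
  boxAvg (ν.slope σ) ν.len (localSum K F ν)

theorem nbrs_subset (K : Finset ℤ) (ν : Node) : nbrs K ν ⊆ K := Finset.filter_subset _ _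

section

variable {K : Finset ℤ} {F : ℤ → ℝ × ℝ → ℂ}

theorem measurable_localSum (hF : ∀ k ∈ K, Continuous (F k)) (ν : Node) :
    Measurable (localSum K F ν) :=
  Finset.measurable_sum _ fun k hk => (hF k (nbrs_subset K ν hk)).measurable.enorm.pow_const 2

theorem measurable_localAvg (σ : ℝ → ℝ) (hF : ∀ k ∈ K, Continuous (F k)) (ν : Node) :
    Measurable (localAvg σ K F ν) :=
  measurable_boxAvg _ _ (measurable_localSum hF ν)

theorem localAvg_ne_top (σ : ℝ → ℝ) (hF : ∀ k ∈ K, ∃ C, ∀ z, ‖F k z‖ ≤ C) (ν : Node) (z : ℝ × ℝ) :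
    localAvg σ K F ν z ≠ ∞ := by
  choose! C hC using hF
  refine boxAvg_ne_top _ ν.len_pos (B := ∑ k ∈ nbrs K ν, ENNReal.ofReal (C k) ^ 2)
    (ENNReal.sum_ne_top.2 fun k _ => by simp) (fun z => ?_) z
  refine Finset.sum_le_sum fun k hk => ?_
  rw [← ofReal_norm]
  exact pow_le_pow_left₀ zero_le (ENNReal.ofReal_le_ofReal (hC k (nbrs_subset K ν hk) z)) 2

end

theorem exists_localSum_le_localAvg (c L D : ℝ) (hD : 0 ≤ D) :
    ∃ C : ℝ≥0, 0 < C ∧ ∀ Γ σ : ℝ → ℝ, ConvexCurve c L Γ σ → ∀ (K : Finset ℤ) (F : ℤ → ℝ × ℝ → ℂ),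
      (∀ k ∈ K, HasSpectrum (capSet Γ D k) (F k)) → ∀ ν z,
        localSum K F ν z ≤ C * localAvg σ K F ν z := by
  obtain ⟨C, hC0, hC⟩ := HasSpectrum.exists_reproducing c L D hD
  refine ⟨C, hC0, fun Γ σ hΓ K F hF ν z => ?_⟩
  unfold localAvg
  rw [show localSum K F ν = fun u => ∑ k ∈ nbrs K ν, ‖F k u‖ₑ ^ 2 from rfl,
    boxAvg_sum (f := fun k u => ‖F k u‖ₑ ^ 2) _ _ _ fun k hk =>
      (hF k (nbrs_subset K ν hk)).continuous.measurable.enorm.pow_const 2, Finset.mul_sum]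
  exact Finset.sum_le_sum fun k hk => hC Γ σ hΓ K ν k hk _ (hF k (nbrs_subset K ν hk)) z

/-- The first Cauchy–Schwarz factor. Almost orthogonality needs the slowly varying weight
`localAvg`, while the telescoping over scales needs the pointwise weight `localSum`; as `s - 2 ≤ 0`,
the reproducing inequality allows passing from one to the other. -/
theorem exists_sum_bilin_weighted (c L D : ℝ) (hD : 0 ≤ D) {s : ℝ} (hs1 : 1 < s) (hs2 : s ≤ 2) :
    ∃ C : ℝ≥0, ∀ Γ σ : ℝ → ℝ, ConvexCurve c L Γ σ → ∀ (K : Finset ℤ) (F : ℤ → ℝ × ℝ → ℂ),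
      (∀ k ∈ K, HasSpectrum (capSet Γ D k) (F k)) →
        ∑ ν ∈ nodes K, ∫⁻ u, ‖bilin K F ν u‖ₑ ^ 2 * localAvg σ K F ν u ^ (s - 2) ≤
          C * ∫⁻ u, (∑ k ∈ K, ‖F k u‖ₑ ^ 2) ^ s := by
  obtain ⟨C₁, h1⟩ := exists_bilin_weighted c L D hD
  obtain ⟨C₂, hC₂, h2⟩ := exists_localSum_le_localAvg c L D hD
  have hC₂' : (C₂ : ℝ≥0∞) ≠ 0 := by simpa using hC₂.ne'
  set E : ℝ≥0∞ := C₁ * ((C₂ : ℝ≥0∞) ^ (2 - s) * ENNReal.ofReal (s - 1)⁻¹) with hE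
  have hEt : E ≠ ∞ := ENNReal.mul_ne_top (by simp) (ENNReal.mul_ne_top
    (ENNReal.rpow_ne_top_of_nonneg (by linarith) (by simp)) (by simp))
  refine ⟨E.toNNReal, fun Γ σ hΓ K F hF => ?_⟩
  rw [ENNReal.coe_toNNReal hEt]
  have hc : ∀ k ∈ K, Continuous (F k) := fun k hk => (hF k hk).continuous
  have hm : ∀ ν, ∀ P ∈ pairs K ν, Measurable (F P.1) ∧ Measurable (F P.2) := fun ν P hP => by
    have := Finset.mem_product.1 (Finset.mem_filter.1 hP).1
    exact ⟨(hc _ this.1).measurable, (hc _ this.2).measurable⟩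
  set g : Node → ℝ × ℝ → ℝ≥0∞ := fun ν u =>
    ∑ P ∈ pairs K ν, ‖F P.1 u‖ₑ ^ 2 * ‖F P.2 u‖ₑ ^ 2 * localSum K F ν u ^ (s - 2) with hg
  have hgm : ∀ ν, Measurable (g ν) := fun ν => Finset.measurable_sum _ fun P hP =>
    (((hm ν P hP).1.enorm.pow_const 2).mul ((hm ν P hP).2.enorm.pow_const 2)).mul
      ((measurable_localSum hc ν).pow_const _)
  have step : ∀ ν ∈ nodes K, ∫⁻ u, ‖bilin K F ν u‖ₑ ^ 2 * localAvg σ K F ν u ^ (s - 2) ≤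
      C₁ * ((C₂ : ℝ≥0∞) ^ (2 - s) * ∫⁻ u, g ν u) := by
    intro ν hν
    refine (h1 Γ σ hΓ K F hF ν (one_le_of_mem_nodes hν) _
      ((measurable_localAvg σ hc ν).pow_const _)
      ((slowlyVarying_boxAvg _ ν.len_pos (measurable_localSum hc ν)).rpow_neg
        (by linarith) (by linarith))).trans ?_
    rw [← lintegral_const_mul _ (hgm ν)]
    refine mul_le_mul_right (lintegral_mono fun u => ?_) _
    have hle : localAvg σ K F ν u ^ (s - 2) ≤ (C₂ : ℝ≥0∞) ^ (2 - s) * localSum K F ν u ^ (s - 2) := by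
      have h3 : ((C₂ : ℝ≥0∞) * localAvg σ K F ν u) ^ (s - 2) ≤ localSum K F ν u ^ (s - 2) := by
        rw [← neg_neg (s - 2), ENNReal.rpow_neg (_ * _), ENNReal.rpow_neg (localSum _ _ _ _),
          ENNReal.inv_le_inv]
        exact ENNReal.rpow_le_rpow (h2 Γ σ hΓ K F hF ν u) (by linarith)
      refine le_trans (le_of_eq ?_) (mul_le_mul_right h3 _)
      rw [ENNReal.mul_rpow_of_ne_top (by simp)
        (localAvg_ne_top σ (fun k hk => (hF k hk).bounded) ν u), ← mul_assoc,
        ← ENNReal.rpow_add _ _ hC₂' (by simp)]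
      simp
    rw [hg]; simp only
    rw [← Finset.sum_mul]
    calc _ ≤ (∑ P ∈ pairs K ν, ‖F P.1 u‖ₑ ^ 2 * ‖F P.2 u‖ₑ ^ 2) *
          ((C₂ : ℝ≥0∞) ^ (2 - s) * localSum K F ν u ^ (s - 2)) := mul_le_mul_right hle _
      _ = _ := by ring
  calc _ ≤ ∑ ν ∈ nodes K, C₁ * ((C₂ : ℝ≥0∞) ^ (2 - s) * ∫⁻ u, g ν u) := Finset.sum_le_sum step
    _ = C₁ * ((C₂ : ℝ≥0∞) ^ (2 - s) * ∫⁻ u, ∑ ν ∈ nodes K, g ν u) := by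
        rw [lintegral_finsetSum _ fun ν _ => hgm ν, Finset.mul_sum, Finset.mul_sum]
    _ ≤ C₁ * ((C₂ : ℝ≥0∞) ^ (2 - s) *
          ∫⁻ u, ENNReal.ofReal (s - 1)⁻¹ * (∑ k ∈ K, ‖F k u‖ₑ ^ 2) ^ s) := by
        refine mul_le_mul_right (mul_le_mul_right (lintegral_mono fun u => ?_) _) _
        exact sum_pairs_weighted_le hs1 hs2 fun k => by simp
    _ = _ := by
        rw [lintegral_const_mul' _ _ ENNReal.ofReal_ne_top, hE]; ring

/-! ### Frequency projections attached to nodes -/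

/-- A kernel whose Fourier transform is one for `1/2 ≤ |ξ₁| ≤ 2`, `|ξ₂| ≤ Λ` and is supported in
`1/4 ≤ |ξ₁| ≤ 4`, `|ξ₂| ≤ 2 Λ`. -/
structure Projector (Λ : ℝ) (κ m : ℝ × ℝ → ℂ) : Prop where
  pair : KernelPair κ m
  eq_one : ∀ ξ : ℝ × ℝ, 1 / 2 ≤ |ξ.1| → |ξ.1| ≤ 2 → |ξ.2| ≤ Λ → m ξ = 1
  supp : ∀ ξ : ℝ × ℝ, m ξ ≠ 0 → 1 / 4 ≤ |ξ.1| ∧ |ξ.1| ≤ 4 ∧ |ξ.2| ≤ 2 * Λ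
  norm_le : ∀ ξ, ‖m ξ‖ ≤ 1
  decay : ∃ B : ℝ, 0 < B ∧ ∀ z, ‖κ z‖ ≤ B * tail z

theorem exists_projector {Λ : ℝ} (hΛ : 0 < Λ) : ∃ κ m, Projector Λ κ m := by
  obtain ⟨φ, χ, h1, h2, h3, h4, h5⟩ := exists_bandpass
  obtain ⟨φ', χ', k1, k2, k3, k4, k5⟩ := exists_lowpass hΛ
  refine ⟨_, _, h1.prod k1, fun ξ a b d => ?_, fun ξ hξ => ?_, fun ξ => ?_, ?_⟩
  · rw [h2 _ a b, k2 _ d, one_mul]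
  · obtain ⟨ha, hb⟩ := mul_ne_zero_iff.1 hξ
    refine ⟨(h3 _ ha).1, (h3 _ ha).2, ?_⟩
    by_contra h
    push Not at h
    exact hb (k3 _ h.le)
  · rw [norm_mul]
    exact mul_le_one₀ (h4 _) (norm_nonneg _) (k4 _)
  · obtain ⟨B, hB, hb⟩ := h5 3
    obtain ⟨B', hB', hb'⟩ := k5 3
    refine ⟨B * B', by positivity, fun z => ?_⟩
    rw [norm_mul, tail_eq_mul]
    calc _ ≤ (B * ((1 + z.1 ^ 2) ^ 3)⁻¹) * (B' * ((1 + z.2 ^ 2) ^ 3)⁻¹) :=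
          mul_le_mul (hb _) (hb' _) (norm_nonneg _) (by positivity)
      _ = _ := by ring

/-- The projection kernel at slope `s` and scale `n`. -/
noncomputable def projKernel (κ : ℝ × ℝ → ℂ) (s n : ℝ) (z : ℝ × ℝ) : ℂ :=
  ((n * n ^ 2 : ℝ) : ℂ) * κ (shear s n (n ^ 2) z)

/-- The multiplier of the projection kernel at slope `s` and scale `n`. -/
noncomputable def projMult (m : ℝ × ℝ → ℂ) (s n : ℝ) (ξ : ℝ × ℝ) : ℂ :=
  m (ξ.1 / n, (ξ.2 - s * ξ.1) / n ^ 2)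

/-- The frequency projection attached to a node. -/
noncomputable def proj (κ : ℝ × ℝ → ℂ) (σ : ℝ → ℝ) (ν : Node) : (ℝ × ℝ → ℂ) → ℝ × ℝ → ℂ :=
  cv (projKernel κ (ν.slope σ) ν.len)

section

variable {Λ : ℝ} {κ m : ℝ × ℝ → ℂ}

theorem Projector.kernelPair (h : Projector Λ κ m) (s : ℝ) {n : ℝ} (hn : 0 < n) :
    KernelPair (projKernel κ s n) (projMult m s n) :=
  h.pair.comp_shear hn (by positivity)

theorem Projector.continuous_proj (h : Projector Λ κ m) (σ : ℝ → ℝ) (ν : Node) {g : ℝ × ℝ → ℂ}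
    (hg : Integrable g) : Continuous (proj κ σ ν g) := by
  have hp := h.kernelPair (ν.slope σ) ν.len_pos
  have e : proj κ σ ν g = fun z => ∫ ξ, projMult m (ν.slope σ) ν.len ξ * planeFourier g ξ * wave ξ z :=
    funext fun z => cv_eq_integral_multiplier hp hg z
  have hi : Integrable fun ξ => projMult m (ν.slope σ) ν.len ξ * planeFourier g ξ :=
    hp.int_right.mul_bdd (c := ∫ z, ‖g z‖) (continuous_planeFourier hg).aestronglyMeasurable
      (.of_forall fun ξ => norm_planeFourier_le g ξ)
  rw [e]
  refine continuous_of_dominated (bound := fun ξ =>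
    ‖projMult m (ν.slope σ) ν.len ξ * planeFourier g ξ‖) (fun z => ?_) (fun z => ?_) hi.norm ?_
  · exact hi.aestronglyMeasurable.mul
      (continuous_wave continuous_id continuous_const).aestronglyMeasurable
  · exact .of_forall fun ξ => by rw [norm_mul _ (wave _ _), norm_wave, mul_one]
  · exact .of_forall fun ξ => continuous_const.mul (continuous_wave continuous_const continuous_id)

/-- The multiplier is 1 on all frequencies of the bilinear term: Whitney pairs have first difference
between `n/2` and `2n`, and tilted second difference at most `(4L) n²` from the curve plus `2D` from
the thickness. Pairing without conjugation tests the multiplier at negated frequencies, where the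
same symmetric bounds apply. -/
theorem integral_bilin_mul_eq {c L D : ℝ} {Γ σ : ℝ → ℝ} (hΓ : ConvexCurve c L Γ σ) (hD : 0 ≤ D)
    (h : Projector Λ κ m) (hΛ : 4 * L + 2 * D ≤ Λ) {K : Finset ℤ} {F : ℤ → ℝ × ℝ → ℂ}
    (hF : ∀ k ∈ K, HasSpectrum (capSet Γ D k) (F k)) {ν : Node} (hν : 1 ≤ ν.1)
    {g : ℝ × ℝ → ℂ} (hg : Integrable g) :
    ∫ z, bilin K F ν z * g z = ∫ z, bilin K F ν z * proj κ σ ν g z := by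
  have hn := ν.len_pos
  have hn1 := ν.one_le_len
  have hp := h.kernelPair (ν.slope σ) hn
  have hmem : ∀ P ∈ pairs K ν, P.1 ∈ K ∧ P.2 ∈ K := fun P hP =>
    Finset.mem_product.1 (Finset.mem_filter.1 hP).1
  have hspec : ∀ P ∈ pairs K ν, HasSpectrum _ (fun u => F P.1 u * conj (F P.2 u)) := fun P hP =>
    (hF _ (hmem P hP).1).mul (hF _ (hmem P hP).2).star
  have hexp : ∀ v : ℝ × ℝ → ℂ, Integrable v → ∫ z, bilin K F ν z * v z =
      ∑ P ∈ pairs K ν, ∫ z, (F P.1 z * conj (F P.2 z)) * v z := by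
    intro v hv
    simp_rw [bilin, Finset.sum_mul]
    refine integral_finsetSum _ fun P hP => ?_
    obtain ⟨C, hC⟩ := (hspec P hP).bounded
    exact hv.bdd_mul (c := C) (hspec P hP).continuous.aestronglyMeasurable (.of_forall hC)
  have hpg : Integrable (proj κ σ ν g) := integrable_cv hp.int_left hg
  rw [hexp g hg, hexp _ hpg]
  refine Finset.sum_congr rfl fun P hP => (hspec P hP).integral_mul_eq hg hpg ?_
  rintro ξ ⟨p, hp1, q', hq1, rfl⟩
  obtain ⟨q, rfl⟩ : ∃ q, q' = -q := ⟨-q', by simp⟩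
  simp only [Set.mem_ofPred_eq, neg_neg] at hq1
  rw [proj, integral_cv_mul_wave hp.int_left hg, ← neg_neg (p + -q), hp.fourier, neg_neg]
  have g1 : ν.len / 2 ≤ |p.1 - q.1| := half_len_le_abs_sub hν hP hp1.1 hq1.1
  have g2 : |p.1 - q.1| ≤ 2 * ν.len := abs_sub_le_two_len hP hp1.1 hq1.1
  have e1 : |(-(p + -q)).1| = |p.1 - q.1| := by
    rw [Prod.fst_neg, abs_neg, Prod.fst_add, Prod.fst_neg, sub_eq_add_neg]
  have hone : projMult m (ν.slope σ) ν.len (-(p + -q)) = 1 := by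
    refine h.eq_one _ ?_ ?_ ?_
    · rw [abs_div, abs_of_pos hn, e1, le_div_iff₀ hn]; linarith
    · rw [abs_div, abs_of_pos hn, e1, div_le_iff₀ hn]; linarith
    · have hmn := mem_nbrs_of_mem_pairs hP
      have t1 := hΓ.abs_tilt_le (t := ν.pt) (abs_sub_pt_le hmn.1 hp1.1) (abs_sub_pt_le hmn.2 hq1.1)
      have t2 : L * (2 * ν.len) * |p.1 - q.1| ≤ L * (2 * ν.len) * (2 * ν.len) :=
        mul_le_mul_of_nonneg_left g2 (mul_nonneg hΓ.pos'.le (by positivity))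
      have t3 := abs_le.1 (t1.trans t2)
      have t4 := abs_le.1 hp1.2
      have t5 := abs_le.1 hq1.2
      have t6 : D ≤ ν.len ^ 2 * D := by nlinarith [one_le_pow₀ hn1 (n := 2)]
      have t7 : (4 * L + 2 * D) * ν.len ^ 2 ≤ Λ * ν.len ^ 2 :=
        mul_le_mul_of_nonneg_right hΛ (by positivity)
      simp only
      rw [abs_div, abs_of_pos (by positivity : 0 < ν.len ^ 2), div_le_iff₀ (by positivity),
        Node.slope, abs_le]
      simp only [Prod.fst_neg, Prod.snd_neg, Prod.fst_add, Prod.snd_add]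
      constructor <;> linarith
  rw [hone, one_mul]

/-! ### Bessel's inequality -/

/-- The first frequency fixes the length of the node up to a factor 16, leaving at most nine levels.
At one level, `ξ₂ / ξ₁` fixes the slope up to a multiple of the length, and slopes at different
nodes are separated by convexity. -/
theorem card_filter_projMult_le {c L : ℝ} {Γ σ : ℝ → ℝ} (hΓ : ConvexCurve c L Γ σ)
    (h : Projector Λ κ m) {N : ℕ} (hN : 16 * Λ / c ≤ N) (S : Finset Node) (ξ : ℝ × ℝ) :
    (S.filter fun ν => projMult m (ν.slope σ) ν.len ξ ≠ 0).card ≤ (2 * N + 1) * 9 := by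
  set T := S.filter fun ν => projMult m (ν.slope σ) ν.len ξ ≠ 0 with hT
  have hmem : ∀ ν ∈ T, ν.len / 4 ≤ |ξ.1| ∧ |ξ.1| ≤ 4 * ν.len ∧
      |ξ.2 - ν.slope σ * ξ.1| ≤ 2 * Λ * ν.len ^ 2 := by
    intro ν hν
    have hn := ν.len_pos
    have := h.supp _ (Finset.mem_filter.1 hν).2
    simp only at this
    rw [abs_div, abs_div, abs_of_pos hn, abs_of_pos (by positivity : 0 < ν.len ^ 2),
      le_div_iff₀ hn, div_le_iff₀ hn, div_le_iff₀ (by positivity)] at this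
    exact ⟨by linarith [this.1], this.2.1, this.2.2⟩
  refine (Finset.card_le_mul_card_image (f := Prod.fst) T (2 * N + 1) ?_).trans
    (Nat.mul_le_mul_left _ ?_)
  · intro j hj
    obtain ⟨(ν₀ : Node), hν₀, rfl⟩ := Finset.mem_image.1 hj
    calc _ ≤ ((Finset.Icc (ν₀.2 - N) (ν₀.2 + N)).image fun M : ℤ => (ν₀.1, M)).card := by
          refine Finset.card_le_card fun (ν : Node) hν => ?_
          obtain ⟨hν, hν1⟩ := Finset.mem_filter.1 hν
          refine Finset.mem_image.2 ⟨ν.2, ?_, Prod.ext hν1.symm rfl⟩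
          have hlen : ν.len = ν₀.len := by rw [Node.len, hν1, Node.len]
          obtain ⟨a1, -, a3⟩ := hmem ν hν
          obtain ⟨-, -, b3⟩ := hmem ν₀ hν₀
          rw [hlen] at a1 a3
          have hn := ν₀.len_pos
          have hpt : ν.pt - ν₀.pt = ((ν.2 - ν₀.2 : ℤ) : ℝ) * ν₀.len := by
            rw [Node.pt, Node.pt, Node.len, hν1]; push_cast; ring
          have k1 := hΓ.le_abs_slope_sub ν.pt ν₀.pt
          rw [hpt, abs_mul, abs_of_pos hn] at k1
          have k2 : |σ ν.pt - σ ν₀.pt| * |ξ.1| ≤ 4 * Λ * ν₀.len ^ 2 := by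
            rw [← abs_mul]
            have e : (σ ν.pt - σ ν₀.pt) * ξ.1 =
              (ξ.2 - ν₀.slope σ * ξ.1) - (ξ.2 - ν.slope σ * ξ.1) := by
              simp only [Node.slope]; ring
            rw [e]
            refine (abs_sub _ _).trans ?_
            linarith
          have k3 : c * (|((ν.2 - ν₀.2 : ℤ) : ℝ)| * ν₀.len) * (ν₀.len / 4) ≤ 4 * Λ * ν₀.len ^ 2 :=
            (mul_le_mul k1 a1 (by positivity) (abs_nonneg _)).trans k2
          have k4 : c * |((ν.2 - ν₀.2 : ℤ) : ℝ)| ≤ 16 * Λ := by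
            have : (c * |((ν.2 - ν₀.2 : ℤ) : ℝ)|) * ν₀.len ^ 2 ≤ (16 * Λ) * ν₀.len ^ 2 := by
              nlinarith
            exact le_of_mul_le_mul_right this (by positivity)
          have k5 : |((ν.2 - ν₀.2 : ℤ) : ℝ)| ≤ N :=
            le_trans (by rw [le_div_iff₀ hΓ.pos]; linarith) hN
          have k6 : |ν.2 - ν₀.2| ≤ (N : ℤ) := by exact_mod_cast k5
          rw [abs_le] at k6
          rw [Finset.mem_Icc]; constructor <;> linarith
      _ ≤ (Finset.Icc (ν₀.2 - N) (ν₀.2 + N)).card := Finset.card_image_le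
      _ = 2 * N + 1 := by rw [Int.card_Icc]; omega
  · rcases T.eq_empty_or_nonempty with h0 | ⟨ν₀, hν₀⟩
    · simp [h0]
    calc _ ≤ (Finset.Icc (ν₀.1 - 4) (ν₀.1 + 4)).card := by
          refine Finset.card_le_card fun j hj => ?_
          obtain ⟨ν, hν, rfl⟩ := Finset.mem_image.1 hj
          have key : ∀ ν ∈ T, ∀ ν' ∈ T, ν.1 ≤ ν'.1 + 4 := by
            intro ν hν ν' hν'
            have h1 := (hmem ν hν).1
            have h2 := (hmem ν' hν').2.1
            have h3 : (2 : ℝ) ^ ν.1 ≤ 2 ^ (ν'.1 + 4) := by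
              rw [pow_add]
              have : ν.len ≤ 16 * ν'.len := by linarith
              unfold Node.len at this; linarith
            exact (pow_le_pow_iff_right₀ (by norm_num)).1 h3
          have h1 := key ν hν ν₀ hν₀
          have h2 := key ν₀ hν₀ ν hν
          rw [Finset.mem_Icc]; omega
      _ ≤ 9 := by rw [Nat.card_Icc]; omega

theorem measurableSet_square (R : ℝ) : MeasurableSet {ξ : ℝ × ℝ | |ξ.1| ≤ R ∧ |ξ.2| ≤ R} := by
  have h1 : IsClosed {ξ : ℝ × ℝ | |ξ.1| ≤ R} := isClosed_le (by fun_prop) (by fun_prop)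
  have h2 : IsClosed {ξ : ℝ × ℝ | |ξ.2| ≤ R} := isClosed_le (by fun_prop) (by fun_prop)
  have := h1.measurableSet.inter h2.measurableSet
  rwa [← Set.ofPred_and] at this

/-- A form of Plancherel's inequality, uniform in the square: convolve with a dilated low-pass
kernel whose multiplier is 1 there. The total mass of the kernel does not depend on the dilation. -/
theorem exists_lintegral_planeFourier_le : ∃ C : ℝ≥0, ∀ (R : ℝ) (g : ℝ × ℝ → ℂ), Integrable g →
    ∫⁻ ξ in {ξ : ℝ × ℝ | |ξ.1| ≤ R ∧ |ξ.2| ≤ R}, ‖planeFourier g ξ‖ₑ ^ 2 ≤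
      C * ∫⁻ z, ‖g z‖ₑ ^ 2 := by
  obtain ⟨φ, χ, h1, h2, -, h4, -⟩ := exists_lowpass (C := 1) one_pos
  have hp := h1.prod h1
  set k0 : ℝ × ℝ → ℂ := fun z => φ z.1 * φ z.2 with hk0
  have hA : (∫⁻ z, ‖k0 z‖ₑ) ^ 2 ≠ ∞ := ENNReal.pow_ne_top hp.int_left.2.ne
  refine ⟨((∫⁻ z, ‖k0 z‖ₑ) ^ 2).toNNReal, fun R g hg => ?_⟩
  rw [ENNReal.coe_toNNReal hA]
  set Q : ℝ := max R 1
  have hQ : 0 < Q := lt_max_of_lt_right one_pos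
  have hk := hp.comp_shear (s := 0) (A := Q) (B := Q) hQ hQ
  have hms := measurableSet_square R
  have h1' := lintegral_cv_sq hk hg (B := 1) fun ξ => by
    simp only
    rw [norm_mul]; exact mul_le_one₀ (h4 _) (norm_nonneg _) (h4 _)
  have hnorm : ∫⁻ z, ‖((Q * Q : ℝ) : ℂ) * k0 (shear 0 Q Q z)‖ₑ = ∫⁻ z, ‖k0 z‖ₑ := by
    have : ∀ u, ‖((Q * Q : ℝ) : ℂ) * k0 (shear 0 Q Q u)‖ₑ = ENNReal.ofReal (Q * Q) *
        (fun t => ‖k0 t‖ₑ) (shear 0 Q Q u) := fun u => by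
      rw [enorm_mul, ← ofReal_norm ((_ : ℝ) : ℂ), norm_real, Real.norm_of_nonneg (by positivity)]
    simp_rw [this]
    rw [lintegral_const_mul' _ _ ENNReal.ofReal_ne_top, lintegral_comp_shear hQ hQ
      (fun t => ‖k0 t‖ₑ), ← mul_assoc, ← ENNReal.ofReal_mul (by positivity),
      mul_inv_cancel₀ (by positivity), ENNReal.ofReal_one, one_mul]
  have h2' := lintegral_cv_sq_le hk.int_left hg
  rw [hnorm, h1'] at h2'
  refine le_trans ?_ h2'
  rw [← lintegral_indicator hms]
  refine lintegral_mono fun ξ => ?_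
  by_cases hξ : ξ ∈ {ξ : ℝ × ℝ | |ξ.1| ≤ R ∧ |ξ.2| ≤ R}
  · rw [Set.indicator_of_mem hξ]
    have hb : ∀ t : ℝ, |t| ≤ R → |t / Q| ≤ 1 := fun t ht => by
      rw [abs_div, abs_of_pos hQ, div_le_one hQ]; exact ht.trans (le_max_left _ _)
    simp only [zero_mul, sub_zero]
    rw [h2 _ (hb _ hξ.1), h2 _ (hb _ hξ.2)]
    simp
  · rw [Set.indicator_of_notMem hξ]; exact zero_le

theorem Projector.exists_bessel (h : Projector Λ κ m) (c L : ℝ) :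
    ∃ C : ℝ≥0, ∀ Γ σ : ℝ → ℝ, ConvexCurve c L Γ σ → ∀ (S : Finset Node) (g : ℝ × ℝ → ℂ),
      Integrable g → ∑ ν ∈ S, ∫⁻ z, ‖proj κ σ ν g z‖ₑ ^ 2 ≤ C * ∫⁻ z, ‖g z‖ₑ ^ 2 := by
  obtain ⟨C, hC⟩ := exists_lintegral_planeFourier_le
  obtain ⟨N, hN⟩ := exists_nat_ge (16 * Λ / c)
  refine ⟨((2 * N + 1) * 9 : ℕ) * C, fun Γ σ hΓ S g hg => ?_⟩
  have hpair := fun ν : Node => h.kernelPair (ν.slope σ) ν.len_pos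
  -- Finitely many compactly supported multipliers fit in a common square; its size does not enter
  -- the final constant.
  have hbound : ∃ R, ∀ ν ∈ S, ∀ ξ, projMult m (ν.slope σ) ν.len ξ ≠ 0 → |ξ.1| ≤ R ∧ |ξ.2| ≤ R := by
    have h1 : ∀ ν : Node, ∃ R, ∀ ξ, projMult m (ν.slope σ) ν.len ξ ≠ 0 → |ξ.1| ≤ R ∧ |ξ.2| ≤ R := by
      intro ν
      have hn := ν.len_pos
      refine ⟨max (4 * ν.len) (2 * Λ * ν.len ^ 2 + |ν.slope σ| * (4 * ν.len)), fun ξ hξ => ?_⟩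
      obtain ⟨-, h2, h3⟩ := h.supp _ hξ
      simp only at h2 h3
      rw [abs_div, abs_of_pos hn, div_le_iff₀ hn] at h2
      rw [abs_div, abs_of_pos (by positivity : 0 < ν.len ^ 2), div_le_iff₀ (by positivity)] at h3
      refine ⟨h2.trans (le_max_left _ _), le_trans ?_ (le_max_right _ _)⟩
      calc |ξ.2| = |(ξ.2 - ν.slope σ * ξ.1) + ν.slope σ * ξ.1| := by congr 1; ring
        _ ≤ |ξ.2 - ν.slope σ * ξ.1| + |ν.slope σ| * |ξ.1| := by
          rw [← abs_mul]; exact abs_add_le _ _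
        _ ≤ _ := by gcongr
    choose R hR using h1
    refine ⟨∑ ν ∈ S, |R ν|, fun ν hν ξ hξ => ?_⟩
    have : R ν ≤ ∑ ν ∈ S, |R ν| := (le_abs_self _).trans
      (Finset.single_le_sum (f := fun ν => |R ν|) (fun _ _ => abs_nonneg _) hν)
    exact ⟨(hR ν ξ hξ).1.trans this, (hR ν ξ hξ).2.trans this⟩
  obtain ⟨R, hR⟩ := hbound
  have hms := measurableSet_square R
  have e1 : ∀ ν ∈ S, ∫⁻ z, ‖proj κ σ ν g z‖ₑ ^ 2 =
      ∫⁻ ξ, ‖projMult m (ν.slope σ) ν.len ξ‖ₑ ^ 2 * ‖planeFourier g ξ‖ₑ ^ 2 := fun ν _ =>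
    lintegral_cv_sq (hpair ν) hg (B := 1) fun ξ => h.norm_le _
  have hm : ∀ ν ∈ S, Measurable fun ξ =>
      ‖projMult m (ν.slope σ) ν.len ξ‖ₑ ^ 2 * ‖planeFourier g ξ‖ₑ ^ 2 := fun ν _ =>
    ((hpair ν).cont_right.measurable.enorm.pow_const 2).mul
      ((continuous_planeFourier hg).measurable.enorm.pow_const 2)
  rw [Finset.sum_congr rfl e1, ← lintegral_finsetSum _ hm]
  have e2 : ∀ ξ, ∑ ν ∈ S, ‖projMult m (ν.slope σ) ν.len ξ‖ₑ ^ 2 * ‖planeFourier g ξ‖ₑ ^ 2 ≤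
      ((2 * N + 1) * 9 : ℕ) * ({ξ : ℝ × ℝ | |ξ.1| ≤ R ∧ |ξ.2| ≤ R}.indicator
        (fun ξ => ‖planeFourier g ξ‖ₑ ^ 2) ξ) := by
    intro ξ
    have hle1 : ∀ ν, ‖projMult m (Node.slope σ ν) ν.len ξ‖ₑ ^ 2 ≤ 1 := fun ν => by
      rw [← ofReal_norm]
      exact pow_le_one₀ zero_le (ENNReal.ofReal_le_one.2 (h.norm_le _))
    have hcard := card_filter_projMult_le hΓ h hN S ξ
    rw [← Finset.sum_filter_of_ne (p := fun ν => projMult m (Node.slope σ ν) ν.len ξ ≠ 0)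
      fun ν _ h0 h1 => h0 (by simp [h1])]
    set T := S.filter fun ν => projMult m (Node.slope σ ν) ν.len ξ ≠ 0 with hT
    rcases T.eq_empty_or_nonempty with h0 | ⟨ν₀, hν₀⟩
    · simp [h0]
    · have hmem : ξ ∈ {ξ : ℝ × ℝ | |ξ.1| ≤ R ∧ |ξ.2| ≤ R} :=
        hR ν₀ (Finset.mem_filter.1 hν₀).1 ξ (Finset.mem_filter.1 hν₀).2
      rw [Set.indicator_of_mem hmem]
      calc _ ≤ ∑ ν ∈ T, ‖planeFourier g ξ‖ₑ ^ 2 := Finset.sum_le_sum fun ν _ =>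
            (mul_le_mul_left (hle1 ν) _).trans (one_mul _).le
        _ = T.card * ‖planeFourier g ξ‖ₑ ^ 2 := by rw [Finset.sum_const, nsmul_eq_mul]
        _ ≤ _ := by gcongr
  refine (lintegral_mono e2).trans ?_
  rw [lintegral_const_mul' _ _ (ENNReal.natCast_ne_top _), lintegral_indicator hms, ENNReal.coe_mul,
    mul_assoc]
  exact mul_le_mul_right (hC R g hg) _

end

/-! ### Localisation of the projections to boxes -/

/-- The box with slope `s`, length `n⁻¹`, centre `c` (in sheared coordinates), dilated by `r`. -/
def box (s n : ℝ) (c : ℝ × ℝ) (r : ℝ) : Set (ℝ × ℝ) :=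
  {z | |(shear s 1 n z).1 - c.1| ≤ r ∧ |(shear s 1 n z).2 - c.2| ≤ r}

theorem measurableSet_box (s n : ℝ) (c : ℝ × ℝ) (r : ℝ) : MeasurableSet (box s n c r) := by
  have h1 : IsClosed {z : ℝ × ℝ | |(shear s 1 n z).1 - c.1| ≤ r} :=
    isClosed_le (by fun_prop) (by fun_prop)
  have h2 : IsClosed {z : ℝ × ℝ | |(shear s 1 n z).2 - c.2| ≤ r} :=
    isClosed_le (by fun_prop) (by fun_prop)
  have := h1.measurableSet.inter h2.measurableSet
  rwa [← Set.ofPred_and] at this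

theorem volume_box (s : ℝ) {n : ℝ} (hn : 0 < n) (c : ℝ × ℝ) (r : ℝ) :
    volume (box s n c r) = ENNReal.ofReal n⁻¹ * ENNReal.ofReal (2 * r) ^ 2 := by
  set Q : Set (ℝ × ℝ) := Set.Icc (c.1 - r) (c.1 + r) ×ˢ Set.Icc (c.2 - r) (c.2 + r) with hQ
  have hQm : MeasurableSet Q := measurableSet_Icc.prod measurableSet_Icc
  have e : ∀ z, (box s n c r).indicator (1 : ℝ × ℝ → ℝ≥0∞) z =
      (Q.indicator 1) (shear s 1 n z) := by
    intro z
    have : z ∈ box s n c r ↔ shear s 1 n z ∈ Q := by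
      simp only [box, hQ, Set.mem_ofPred_eq, Set.mem_prod, Set.mem_Icc, abs_le]
      constructor
      · rintro ⟨⟨_, _⟩, _, _⟩; refine ⟨⟨?_, ?_⟩, ?_, ?_⟩ <;> linarith
      · rintro ⟨⟨_, _⟩, _, _⟩; refine ⟨⟨?_, ?_⟩, ?_, ?_⟩ <;> linarith
    by_cases hz : z ∈ box s n c r
    · rw [Set.indicator_of_mem hz, Set.indicator_of_mem (this.1 hz)]; rfl
    · rw [Set.indicator_of_notMem hz, Set.indicator_of_notMem fun h => hz (this.2 h)]
  rw [← lintegral_indicator_one (measurableSet_box s n c r), lintegral_congr e,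
    lintegral_comp_shear one_pos hn (Q.indicator 1), lintegral_indicator_one hQm, one_mul, hQ,
    Measure.volume_eq_prod, Measure.prod_prod, Real.volume_Icc, Real.volume_Icc, sq]
  congr 3 <;> ring

theorem cv_add {K m g₁ g₂ : ℝ × ℝ → ℂ} (h : KernelPair K m) (h₁ : Integrable g₁)
    (h₂ : Integrable g₂) (z : ℝ × ℝ) :
    cv K (fun z => g₁ z + g₂ z) z = cv K g₁ z + cv K g₂ z := by
  have hb : ∀ z, ‖K z‖ ≤ ∫ ξ, ‖m ξ‖ := fun z => by
    rw [← h.fourierInv]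
    refine (norm_integral_le_integral_norm _).trans (le_of_eq ?_)
    simp
  have hi : ∀ {g : ℝ × ℝ → ℂ}, Integrable g → Integrable fun z' => K (z - z') * g z' := fun hg =>
    hg.bdd_mul (h.cont_left.comp (continuous_const.sub continuous_id)).aestronglyMeasurable
      (.of_forall fun z' => hb _)
  unfold cv
  rw [← integral_add (hi h₁) (hi h₂)]
  refine integral_congr_ae (.of_forall fun z' => ?_)
  simp only; ring

theorem sq_add_le (x y : ℝ≥0∞) : (x + y) ^ 2 ≤ 2 * (x ^ 2 + y ^ 2) := by
  have := ENNReal.rpow_add_le_mul_rpow_add_rpow x y (p := 2) (by norm_num)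
  norm_num at this
  exact this

/-- The node `ν` is at least as long as `ν'`, and close to it. -/
def Related (ν' ν : Node) : Prop := ν'.1 ≤ ν.1 ∧ |ν.pt - ν'.pt| ≤ 4 * ν.len

theorem Related.len_le {ν' ν : Node} (h : Related ν' ν) : ν'.len ≤ ν.len :=
  pow_le_pow_right₀ (by norm_num) h.1

/-- At most 17 related nodes per level, and a geometric sum over levels. This makes the far errors
in `Projector.exists_local` summable over nodes. -/
theorem sum_related_le {ν' : Node} {T : Finset Node} (hT : ∀ ν ∈ T, Related ν' ν) :
    ∑ ν ∈ T, (ν.len ^ 2)⁻¹ ≤ 34 := by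
  rw [← Finset.sum_fiberwise_of_maps_to (g := Prod.fst) (t := T.image Prod.fst)
    fun ν hν => Finset.mem_image_of_mem _ hν]
  calc _ ≤ ∑ j ∈ T.image Prod.fst, 17 * (1 / 2 : ℝ) ^ j := by
        refine Finset.sum_le_sum fun j hj => ?_
        obtain ⟨(ν₀ : Node), hν₀, rfl⟩ := Finset.mem_image.1 hj
        have hcard : (T.filter fun ν => ν.1 = ν₀.1).card ≤ 17 := by
          calc _ ≤ ((Finset.Icc (ν₀.2 - 8) (ν₀.2 + 8)).image fun M : ℤ => (ν₀.1, M)).card := by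
                refine Finset.card_le_card fun (ν : Node) hν => ?_
                obtain ⟨hν, hν1⟩ := Finset.mem_filter.1 hν
                refine Finset.mem_image.2 ⟨ν.2, ?_, Prod.ext hν1.symm rfl⟩
                have hlen : ν.len = ν₀.len := by rw [Node.len, hν1, Node.len]
                have hn := ν₀.len_pos
                have hpt : ν.pt - ν₀.pt = ((ν.2 - ν₀.2 : ℤ) : ℝ) * ν₀.len := by
                  rw [Node.pt, Node.pt, Node.len, hν1]; push_cast; ring
                have h1 : |ν.pt - ν₀.pt| ≤ 8 * ν₀.len := by
                  have a1 := (hT ν hν).2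
                  have a2 := (hT ν₀ hν₀).2
                  rw [hlen] at a1
                  rw [show ν.pt - ν₀.pt = (ν.pt - ν'.pt) - (ν₀.pt - ν'.pt) by ring]
                  refine (abs_sub _ _).trans ?_
                  linarith
                rw [hpt, abs_mul, abs_of_pos hn] at h1
                have h2 : |ν.2 - ν₀.2| ≤ (8 : ℤ) := by
                  exact_mod_cast le_of_mul_le_mul_right h1 hn
                rw [abs_le] at h2
                rw [Finset.mem_Icc]; constructor <;> linarith
            _ ≤ (Finset.Icc (ν₀.2 - 8) (ν₀.2 + 8)).card := Finset.card_image_le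
            _ = 17 := by rw [Int.card_Icc]; omega
        have hterm : ∀ ν ∈ T.filter fun ν => ν.1 = ν₀.1, (Node.len ν ^ 2)⁻¹ ≤ (1 / 2 : ℝ) ^ ν₀.1 := by
          intro ν hν
          have hlen : Node.len ν = 2 ^ ν₀.1 := by rw [Node.len, (Finset.mem_filter.1 hν).2]
          rw [hlen, one_div, inv_pow]
          exact inv_anti₀ (by positivity) (le_self_pow₀ (one_le_pow₀ (by norm_num)) (by norm_num))
        refine (Finset.sum_le_sum hterm).trans ?_
        rw [Finset.sum_const, nsmul_eq_mul]
        gcongr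
        exact_mod_cast hcard
    _ = 17 * ∑ j ∈ T.image Prod.fst, (1 / 2 : ℝ) ^ j := by rw [Finset.mul_sum]
    _ ≤ 17 * 2 := by
        gcongr
        refine le_trans (summable_geometric_two.sum_le_tsum _ fun _ _ => by positivity) ?_
        rw [tsum_geometric_two]
    _ = 34 := by norm_num

section

variable {Λ : ℝ} {κ m : ℝ × ℝ → ℂ}

/-- The kernel at scale n lives at distances `n⁻¹` and `n⁻²` along slope s. The box of a shorter
related node is much larger, and the difference in slope, at most `4 L n`, acts only on heights of
order `n⁻¹`. Leaving the doubled box thus means moving by about n kernel units. -/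
theorem far_from_box {L s s' n n' r : ℝ} (hL : 0 < L) (hn' : 1 ≤ n') (hn : n' ≤ n)
    (hs : |s - s'| ≤ 4 * L * n) (hr : 0 < r) {c z z' : ℝ × ℝ} (hz : z ∈ box s' n' c r)
    (hz' : z' ∉ box s' n' c (2 * r)) :
    n * r / (8 * L + 8) ≤ |(shear s n (n ^ 2) (z - z')).1| +
      |(shear s n (n ^ 2) (z - z')).2| := by
  by_contra hcon
  push Not at hcon
  have hn0 : 0 < n := by linarith
  have hn'0 : 0 < n' := by linarith
  simp only [shear, Prod.fst_sub, Prod.snd_sub] at hcon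
  set x := z.1 - z'.1 with hx
  set y := z.2 - z'.2 with hy
  rw [abs_mul, abs_mul, abs_of_pos hn0, abs_of_pos (by positivity : 0 < n ^ 2)] at hcon
  have h8 : 0 < 8 * L + 8 := by positivity
  have hr8 : r / (8 * L + 8) * (8 * L + 8) = r := div_mul_cancel₀ _ h8.ne'
  set ρ := r / (8 * L + 8) with hρ
  have hρ0 : 0 < ρ := by positivity
  have hcon' : |x + s * y| + n * |y| < ρ := by
    have : n * (|x + s * y| + n * |y|) < n * ρ := by
      rw [hρ, ← mul_div_assoc]; nlinarith
    exact lt_of_mul_lt_mul_left this hn0.le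
  have hy1 : n * |y| < ρ := by linarith [abs_nonneg (x + s * y)]
  have hx1 : |x + s * y| < ρ := by
    have : 0 ≤ n * |y| := by positivity
    linarith
  have hy2 : n' * |y| < r := by
    have : n' * |y| ≤ n * |y| := by gcongr
    nlinarith
  have hx2 : |x + s' * y| < r := by
    have e : x + s' * y = (x + s * y) - (s - s') * y := by ring
    have h1 : |(s - s') * y| ≤ 4 * L * ρ := by
      rw [abs_mul]
      calc |s - s'| * |y| ≤ 4 * L * n * |y| := by gcongr
        _ = 4 * L * (n * |y|) := by ring
        _ ≤ 4 * L * ρ := by gcongr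
    rw [e]
    refine (abs_sub _ _).trans_lt ?_
    nlinarith
  apply hz'
  simp only [box, shear, Set.mem_ofPred_eq] at hz ⊢
  constructor
  · have e : 1 * (z'.1 + s' * z'.2) - c.1 = (1 * (z.1 + s' * z.2) - c.1) - (x + s' * y) := by
      rw [hx, hy]; ring
    rw [e]
    refine (abs_sub _ _).trans ?_
    linarith [hz.1]
  · have e : n' * z'.2 - c.2 = (n' * z.2 - c.2) - n' * y := by rw [hy]; ring
    rw [e]
    refine (abs_sub _ _).trans ?_
    rw [abs_mul, abs_of_pos hn'0]
    linarith [hz.2]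

theorem Projector.lintegral_moment_ne_top (h : Projector Λ κ m) :
    ∫⁻ t, ‖κ t‖ₑ * ENNReal.ofReal (|t.1| + |t.2|) ≠ ∞ := by
  obtain ⟨B, hB, hb⟩ := h.decay
  have hi : Integrable fun t : ℝ × ℝ => B * ((1 + t.1 ^ 2)⁻¹ * (1 + t.2 ^ 2)⁻¹) :=
    (integrable_inv_one_add_sq.mul_prod integrable_inv_one_add_sq).const_mul B
  refine ne_top_of_le_ne_top hi.lintegral_lt_top.ne (lintegral_mono fun t => ?_)
  simp only
  rw [← ofReal_norm, ← ENNReal.ofReal_mul (norm_nonneg _)]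
  refine ENNReal.ofReal_le_ofReal ?_
  set X := 1 + t.1 ^ 2 with hX
  set Y := 1 + t.2 ^ 2 with hY
  have hX1 : 1 ≤ X := by nlinarith
  have hY1 : 1 ≤ Y := by nlinarith
  have hXY : 1 ≤ X * Y := by nlinarith
  have h1 : |t.1| + |t.2| ≤ X * Y := by
    have a1 : |t.1| ≤ (1 + t.1 ^ 2) / 2 := by nlinarith [sq_nonneg (|t.1| - 1), sq_abs t.1]
    have a2 : |t.2| ≤ (1 + t.2 ^ 2) / 2 := by nlinarith [sq_nonneg (|t.2| - 1), sq_abs t.2]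
    nlinarith
  calc ‖κ t‖ * (|t.1| + |t.2|) ≤ (B * tail t) * (X * Y) := by
        exact mul_le_mul (hb t) h1 (by positivity) (mul_nonneg hB.le (tail_pos t).le)
    _ = B * ((X * Y) ^ 2)⁻¹ := by
        have : X * Y ≠ 0 := by positivity
        rw [tail, ← hX, ← hY]; field_simp
    _ ≤ B * (X⁻¹ * Y⁻¹) := by
        rw [← mul_inv]
        gcongr
        exact le_self_pow₀ hXY (by norm_num)

/-- Outside the doubled box the kernel argument has size at least about `ν.len`, so the finite first
moment of the kernel gains a factor `ν.len⁻¹`. -/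
theorem Projector.exists_far (h : Projector Λ κ m) (c L : ℝ) :
    ∃ C : ℝ≥0, ∀ Γ σ : ℝ → ℝ, ConvexCurve c L Γ σ → ∀ ν' ν, Related ν' ν → ∀ (b : ℝ × ℝ) (r : ℝ),
      1 ≤ r → ∀ (g : ℝ × ℝ → ℂ) (G : ℝ≥0∞), (∀ z, ‖g z‖ₑ ≤ G) →
        (∀ z ∈ box (ν'.slope σ) ν'.len b (2 * r), g z = 0) →
          ∀ z ∈ box (ν'.slope σ) ν'.len b r,
            ‖proj κ σ ν g z‖ₑ ≤ C * (G * ENNReal.ofReal ν.len⁻¹) := by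
  set A := ∫⁻ t, ‖κ t‖ₑ * ENNReal.ofReal (|t.1| + |t.2|) with hA
  have hAt : A * ENNReal.ofReal (8 * L + 8) ≠ ∞ :=
    ENNReal.mul_ne_top h.lintegral_moment_ne_top (by simp)
  refine ⟨(A * ENNReal.ofReal (8 * L + 8)).toNNReal, fun Γ σ hΓ ν' ν hν b r hr g G hG hg z hz => ?_⟩
  rw [ENNReal.coe_toNNReal hAt]
  have hn := ν.len_pos
  have hL := hΓ.pos'
  have h8 : 0 < 8 * L + 8 := by positivity
  have hs : |ν.slope σ - ν'.slope σ| ≤ 4 * L * ν.len := by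
    refine (hΓ.abs_slope_sub_le _ _).trans ?_
    calc L * |ν.pt - ν'.pt| ≤ L * (4 * ν.len) := mul_le_mul_of_nonneg_left hν.2 hL.le
      _ = _ := by ring
  set J := ENNReal.ofReal ((8 * L + 8) * ν.len⁻¹) with hJ
  have hpt : ∀ z', ‖projKernel κ (ν.slope σ) ν.len (z - z')‖ₑ * ‖g z'‖ₑ ≤
      (J * G) * (ENNReal.ofReal (ν.len * ν.len ^ 2) * (fun t : ℝ × ℝ =>
        ‖κ t‖ₑ * ENNReal.ofReal (|t.1| + |t.2|)) (shear (ν.slope σ) ν.len (ν.len ^ 2) (z - z'))) := by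
    intro z'
    by_cases hz' : z' ∈ box (ν'.slope σ) ν'.len b (2 * r)
    · rw [hg z' hz']; simp
    have h1 := far_from_box hL ν'.one_le_len hν.len_le hs (by linarith) hz hz'
    simp only
    set t := shear (ν.slope σ) ν.len (ν.len ^ 2) (z - z') with ht
    -- Chebyshev's trick: a factor at least 1 is inserted to produce the first moment.
    have h2 : 1 ≤ J * ENNReal.ofReal (|t.1| + |t.2|) := by
      rw [hJ, ← ENNReal.ofReal_mul (by positivity), ENNReal.one_le_ofReal]
      have h3 : ν.len * 1 / (8 * L + 8) ≤ |t.1| + |t.2| := le_trans (by gcongr) h1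
      rw [div_le_iff₀ h8] at h3
      rw [mul_comm (8 * L + 8), mul_assoc, ← div_eq_inv_mul, le_div_iff₀ hn]
      linarith
    have e : ‖projKernel κ (ν.slope σ) ν.len (z - z')‖ₑ =
        ENNReal.ofReal (ν.len * ν.len ^ 2) * ‖κ t‖ₑ := by
      rw [projKernel, enorm_mul, ← ofReal_norm ((_ : ℝ) : ℂ), norm_real,
        Real.norm_of_nonneg (by positivity)]
    rw [e]
    calc ENNReal.ofReal (ν.len * ν.len ^ 2) * ‖κ t‖ₑ * ‖g z'‖ₑ
        ≤ ENNReal.ofReal (ν.len * ν.len ^ 2) * ‖κ t‖ₑ * G * 1 := by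
          rw [mul_one]; exact mul_le_mul_right (hG z') _
      _ ≤ ENNReal.ofReal (ν.len * ν.len ^ 2) * ‖κ t‖ₑ * G * (J * ENNReal.ofReal (|t.1| + |t.2|)) :=
          mul_le_mul_right h2 _
      _ = _ := by ring
  have hpk := (h.pair.comp_shear (s := ν.slope σ) hn (by positivity : 0 < ν.len ^ 2))
  have hm : Measurable fun z' => ENNReal.ofReal (ν.len * ν.len ^ 2) * (fun t : ℝ × ℝ =>
        ‖κ t‖ₑ * ENNReal.ofReal (|t.1| + |t.2|))
        (shear (ν.slope σ) ν.len (ν.len ^ 2) (z - z')) := by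
    have hc : Continuous fun z' => shear (ν.slope σ) ν.len (ν.len ^ 2) (z - z') := by fun_prop
    have hc1 : Measurable fun t : ℝ × ℝ => ‖κ t‖ₑ * ENNReal.ofReal (|t.1| + |t.2|) :=
      h.pair.cont_left.measurable.enorm.mul (by fun_prop)
    exact (hc1.comp hc.measurable).const_mul _
  refine (enorm_cv_le _ _ _).trans ((lintegral_mono hpt).trans ?_)
  rw [lintegral_const_mul _ hm, lintegral_const_mul' _ _ ENNReal.ofReal_ne_top,
    lintegral_sub_left_eq_self (fun u => (fun t : ℝ × ℝ =>
        ‖κ t‖ₑ * ENNReal.ofReal (|t.1| + |t.2|)) (shear (ν.slope σ) ν.len (ν.len ^ 2) u)) z,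
    lintegral_comp_shear hn (by positivity) (fun t : ℝ × ℝ =>
        ‖κ t‖ₑ * ENNReal.ofReal (|t.1| + |t.2|)), ← mul_assoc (ENNReal.ofReal (_ * _)),
    ← ENNReal.ofReal_mul (by positivity), mul_inv_cancel₀ (by positivity), ENNReal.ofReal_one,
    one_mul, hJ, ENNReal.ofReal_mul h8.le]
  apply le_of_eq
  ring

/-- A localised Bessel inequality: the part of g on the doubled box is handled by Bessel and its
area, the rest by the far estimate. Bounded g thus contributes only the area of the box, however
many related nodes there are. -/
theorem Projector.exists_local (h : Projector Λ κ m) (c L : ℝ) :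
    ∃ C : ℝ≥0, ∀ Γ σ : ℝ → ℝ, ConvexCurve c L Γ σ → ∀ (ν' : Node) (T : Finset Node),
      (∀ ν ∈ T, Related ν' ν) → ∀ (b : ℝ × ℝ) (r : ℝ), 1 ≤ r → ∀ (g : ℝ × ℝ → ℂ) (G : ℝ≥0∞),
        Integrable g → (∀ z, ‖g z‖ₑ ≤ G) →
          ∑ ν ∈ T, ∫⁻ z in box (ν'.slope σ) ν'.len b r, ‖proj κ σ ν g z‖ₑ ^ 2 ≤
            C * (G ^ 2 * ENNReal.ofReal (r ^ 2 * ν'.len⁻¹)) := by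
  obtain ⟨C₁, h1⟩ := h.exists_bessel c L
  obtain ⟨C₂, h2⟩ := h.exists_far c L
  refine ⟨2 * (C₁ * 16 + C₂ ^ 2 * 136), fun Γ σ hΓ ν' T hT b r hr g G hg hG => ?_⟩
  set D := box (ν'.slope σ) ν'.len b r with hD
  set D₂ := box (ν'.slope σ) ν'.len b (2 * r) with hD₂
  have hDm : MeasurableSet D := measurableSet_box _ _ _ _
  have hD₂m : MeasurableSet D₂ := measurableSet_box _ _ _ _
  set g₁ := D₂.indicator g with hg₁
  set g₂ := D₂ᶜ.indicator g with hg₂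
  have hi₁ : Integrable g₁ := hg.indicator hD₂m
  have hi₂ : Integrable g₂ := hg.indicator hD₂m.compl
  have hsum : g = fun z => g₁ z + g₂ z := by
    funext z; exact (congrFun (Set.indicator_self_add_compl D₂ g) z).symm
  have hG2 : ∀ z, ‖g₂ z‖ₑ ≤ G := fun z => by
    rw [hg₂]
    by_cases hz : z ∈ D₂ᶜ
    · rw [Set.indicator_of_mem hz]; exact hG z
    · rw [Set.indicator_of_notMem hz]; simp
  have hz2 : ∀ z ∈ D₂, g₂ z = 0 := fun z hz => Set.indicator_of_notMem (Set.notMem_compl_iff.2 hz) _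
  have hlen := ν'.len_pos
  have hvD : ∀ ρ : ℝ, 0 ≤ ρ → volume (box (ν'.slope σ) ν'.len b ρ) =
      4 * ENNReal.ofReal (ρ ^ 2 * ν'.len⁻¹) := by
    intro ρ hρ
    rw [volume_box _ hlen, ← ENNReal.ofReal_pow (by positivity), ← ENNReal.ofReal_mul (by positivity),
      ← ENNReal.ofReal_ofNat 4, ← ENNReal.ofReal_mul (by norm_num)]
    congr 1; ring
  have hstep : ∀ ν ∈ T, ∫⁻ z in D, ‖proj κ σ ν g z‖ₑ ^ 2 ≤
      2 * (∫⁻ z, ‖proj κ σ ν g₁ z‖ₑ ^ 2) +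
        2 * ((C₂ * G) ^ 2 * volume D) * ENNReal.ofReal (ν.len ^ 2)⁻¹ := by
    intro ν hν
    have hadd : ∀ z, proj κ σ ν g z = proj κ σ ν g₁ z + proj κ σ ν g₂ z := fun z => by
      conv_lhs => rw [hsum]
      exact cv_add (h.kernelPair _ ν.len_pos) hi₁ hi₂ z
    calc ∫⁻ z in D, ‖proj κ σ ν g z‖ₑ ^ 2
        ≤ ∫⁻ z in D, 2 * ‖proj κ σ ν g₁ z‖ₑ ^ 2 +
            2 * (C₂ * (G * ENNReal.ofReal ν.len⁻¹)) ^ 2 := by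
          refine setLIntegral_mono' hDm fun z hz => ?_
          rw [hadd, ← mul_add]
          refine (pow_le_pow_left₀ zero_le (enorm_add_le _ _) 2).trans
            ((sq_add_le _ _).trans ?_)
          gcongr
          exact h2 Γ σ hΓ ν' ν (hT ν hν) b r hr g₂ G hG2 hz2 z hz
      _ = 2 * (∫⁻ z in D, ‖proj κ σ ν g₁ z‖ₑ ^ 2) +
            2 * (C₂ * (G * ENNReal.ofReal ν.len⁻¹)) ^ 2 * volume D := by
          rw [lintegral_add_right _ measurable_const, lintegral_const_mul' _ _ (by simp),
            setLIntegral_const]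
      _ ≤ _ := by
          refine add_le_add (mul_le_mul_right (setLIntegral_le_lintegral _ _) _) (le_of_eq ?_)
          rw [← inv_pow, ENNReal.ofReal_pow (inv_nonneg.2 ν.len_pos.le)]
          ring
  have hg₁2 : ∫⁻ z, ‖g₁ z‖ₑ ^ 2 ≤ G ^ 2 * volume D₂ := by
    rw [← setLIntegral_const, ← lintegral_indicator hD₂m]
    refine lintegral_mono fun z => ?_
    by_cases hz : z ∈ D₂
    · rw [hg₁, Set.indicator_of_mem hz, Set.indicator_of_mem hz]
      exact pow_le_pow_left₀ zero_le (hG z) 2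
    · rw [hg₁, Set.indicator_of_notMem hz]; simp
  have hrel : ∑ ν ∈ T, ENNReal.ofReal (ν.len ^ 2)⁻¹ ≤ 34 := by
    rw [← ENNReal.ofReal_sum_of_nonneg fun ν _ => by positivity]
    refine (ENNReal.ofReal_le_ofReal (sum_related_le hT)).trans (by simp)
  calc _ ≤ ∑ ν ∈ T, (2 * (∫⁻ z, ‖proj κ σ ν g₁ z‖ₑ ^ 2) +
        2 * ((C₂ * G) ^ 2 * volume D) * ENNReal.ofReal (ν.len ^ 2)⁻¹) := Finset.sum_le_sum hstep
    _ = 2 * ∑ ν ∈ T, (∫⁻ z, ‖proj κ σ ν g₁ z‖ₑ ^ 2) +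
        2 * ((C₂ * G) ^ 2 * volume D) * ∑ ν ∈ T, ENNReal.ofReal (ν.len ^ 2)⁻¹ := by
      rw [Finset.sum_add_distrib, ← Finset.mul_sum, ← Finset.mul_sum]
    _ ≤ 2 * (C₁ * (G ^ 2 * volume D₂)) + 2 * ((C₂ * G) ^ 2 * volume D) * 34 := by
      gcongr
      exact (h1 Γ σ hΓ T g₁ hi₁).trans (mul_le_mul_right hg₁2 _)
    _ = _ := by
      rw [hvD r (by linarith), hvD (2 * r) (by linarith), mul_pow 2 r, mul_assoc (2 ^ 2),
        ENNReal.ofReal_mul (by norm_num)]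
      push_cast
      rw [show ENNReal.ofReal (2 ^ 2) = 4 by norm_num]
      ring

end

/-! ### Lattice sums and cells -/

/-- The polynomial weight on the lattice. -/
noncomputable def lat (ρ : ℤ × ℤ) : ℝ := (1 + (ρ.1 : ℝ) ^ 2) * (1 + (ρ.2 : ℝ) ^ 2)

theorem one_le_lat (ρ : ℤ × ℤ) : 1 ≤ lat ρ := by
  unfold lat
  nlinarith [sq_nonneg (ρ.1 : ℝ), sq_nonneg (ρ.2 : ℝ),
    mul_nonneg (sq_nonneg (ρ.1 : ℝ)) (sq_nonneg (ρ.2 : ℝ))]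

theorem lat_pos (ρ : ℤ × ℤ) : 0 < lat ρ := zero_lt_one.trans_le (one_le_lat ρ)

theorem summable_inv_one_add_sq_int : Summable fun k : ℤ => (1 + (k : ℝ) ^ 2)⁻¹ := by
  have h : Summable fun n : ℕ => (1 + (n : ℝ) ^ 2)⁻¹ := by
    have h1 : Summable fun n : ℕ => 2 * (1 / ((n + 1 : ℕ) : ℝ) ^ 2) :=
      ((summable_nat_add_iff 1).2 (Real.summable_one_div_nat_pow.2 one_lt_two)).mul_left 2
    refine Summable.of_nonneg_of_le (fun n => by positivity) (fun n => ?_) h1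
    rw [mul_one_div, inv_eq_one_div, div_le_div_iff₀ (by positivity) (by positivity)]
    push_cast
    nlinarith [sq_nonneg ((n : ℝ) - 1)]
  exact Summable.of_nat_of_neg (by simpa using h) (by simpa using h)

theorem summable_inv_lat : Summable fun ρ => (lat ρ)⁻¹ := by
  have := summable_inv_one_add_sq_int.mul_of_nonneg summable_inv_one_add_sq_int
    (fun k => by positivity) (fun k => by positivity)
  refine this.congr fun ρ => ?_
  rw [lat, mul_inv]

/-- The index of the cell containing `z`, for the tiling by boxes of slope `s` and length `n⁻¹`. -/
noncomputable def cellIdx (s n : ℝ) (z : ℝ × ℝ) : ℤ × ℤ :=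
  (⌊(shear s 1 n z).1⌋, ⌊(shear s 1 n z).2⌋)

/-- The cell with index `q`. -/
def cell (s n : ℝ) (q : ℤ × ℤ) : Set (ℝ × ℝ) := cellIdx s n ⁻¹' {q}

theorem mem_cell {s n : ℝ} {q : ℤ × ℤ} {z : ℝ × ℝ} : z ∈ cell s n q ↔ cellIdx s n z = q := Iff.rfl

theorem measurable_cellIdx (s n : ℝ) : Measurable (cellIdx s n) := by
  have h1 : Measurable fun z => (shear s 1 n z).1 :=
    (continuous_fst.comp (continuous_shear s 1 n)).measurable
  have h2 : Measurable fun z => (shear s 1 n z).2 :=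
    (continuous_snd.comp (continuous_shear s 1 n)).measurable
  exact (Int.measurable_floor.comp h1).prodMk (Int.measurable_floor.comp h2)

theorem measurableSet_cell (s n : ℝ) (q : ℤ × ℤ) : MeasurableSet (cell s n q) :=
  measurable_cellIdx s n (measurableSet_singleton q)

theorem cell_bounds {s n : ℝ} {q : ℤ × ℤ} {z : ℝ × ℝ} (hz : z ∈ cell s n q) :
    ((q.1 : ℝ) ≤ (shear s 1 n z).1 ∧ (shear s 1 n z).1 < q.1 + 1) ∧
      (q.2 : ℝ) ≤ (shear s 1 n z).2 ∧ (shear s 1 n z).2 < q.2 + 1 := by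
  rw [mem_cell] at hz
  obtain rfl := hz
  exact ⟨⟨Int.floor_le _, Int.lt_floor_add_one _⟩, Int.floor_le _, Int.lt_floor_add_one _⟩

theorem volume_cell_le (s : ℝ) {n : ℝ} (hn : 0 < n) (q : ℤ × ℤ) :
    volume (cell s n q) ≤ ENNReal.ofReal n⁻¹ := by
  have hsub : cell s n q ⊆ box s n (q.1 + 1 / 2, q.2 + 1 / 2) (1 / 2) := by
    intro z hz
    obtain ⟨⟨h1, h2⟩, h3, h4⟩ := cell_bounds hz
    refine ⟨abs_le.2 ⟨?_, ?_⟩, abs_le.2 ⟨?_, ?_⟩⟩ <;> simp only <;> linarith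
  refine (measure_mono hsub).trans (le_of_eq ?_)
  rw [volume_box _ hn]; norm_num

/-- Pigeonhole over the cells: the kernel decays like `lat⁻³`, so even thresholds growing like
`lat²` leave a summable `lat⁻¹`. The growth of the threshold later pays for the enlarged boxes
needed to reach distant cells. -/
theorem exists_heavy_cell : ∃ ε : ℝ, 0 < ε ∧ ∀ (s n : ℝ), 0 < n → ∀ (f : ℝ × ℝ → ℝ≥0∞)
    (β : ℝ≥0∞) (z : ℝ × ℝ), β < boxAvg s n f z →
      ∃ ρ, ENNReal.ofReal (ε * lat ρ ^ 2) * β <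
        ENNReal.ofReal n * ∫⁻ u in cell s n (cellIdx s n z + ρ), f u := by
  set Z := ∑' ρ, (lat ρ)⁻¹ with hZ
  have hZ0 : 0 < Z := summable_inv_lat.tsum_pos (fun ρ => (inv_pos.2 (lat_pos ρ)).le) 0
    (inv_pos.2 (lat_pos 0))
  -- Here `729 = 9³`: `lat` is at most 9 times the base of `tail`, a factor 3 per coordinate.
  refine ⟨(729 * Z)⁻¹, by positivity, fun s n hn f β z hβ => ?_⟩
  by_contra hcon
  push Not at hcon
  refine hβ.not_ge ?_
  have hcov : ⋃ ρ, cell s n (cellIdx s n z + ρ) = Set.univ := by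
    refine Set.eq_univ_of_forall fun u => Set.mem_iUnion.2 ⟨cellIdx s n u - cellIdx s n z, ?_⟩
    rw [mem_cell]; abel
  have hker : ∀ ρ, ∀ u ∈ cell s n (cellIdx s n z + ρ),
      f u * ENNReal.ofReal (n * tail (shear s 1 n (z - u))) ≤
        ENNReal.ofReal n * ENNReal.ofReal (729 * (lat ρ ^ 3)⁻¹) * f u := by
    intro ρ u hu
    obtain ⟨⟨h1, h2⟩, h3, h4⟩ := cell_bounds hu
    obtain ⟨⟨k1, k2⟩, k3, k4⟩ := cell_bounds (mem_cell.2 (rfl : cellIdx s n z = _))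
    rw [Prod.fst_add, Int.cast_add] at h1 h2
    rw [Prod.snd_add, Int.cast_add] at h3 h4
    have key : tail (shear s 1 n (z - u)) ≤ 729 * (lat ρ ^ 3)⁻¹ := by
      rw [shear_sub]
      set t := shear s 1 n z - shear s 1 n u with ht
      have g1 : 1 + (ρ.1 : ℝ) ^ 2 ≤ 3 * (1 + t.1 ^ 2) := by
        have : |t.1 + ρ.1| ≤ 1 := by
          rw [ht, Prod.fst_sub, abs_le]; constructor <;> linarith
        have := abs_le.1 this
        nlinarith [sq_nonneg (2 * t.1 + ρ.1), sq_nonneg (t.1 - (t.1 + ρ.1))]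
      have g2 : 1 + (ρ.2 : ℝ) ^ 2 ≤ 3 * (1 + t.2 ^ 2) := by
        have : |t.2 + ρ.2| ≤ 1 := by
          rw [ht, Prod.snd_sub, abs_le]; constructor <;> linarith
        have := abs_le.1 this
        nlinarith [sq_nonneg (2 * t.2 + ρ.2), sq_nonneg (t.2 - (t.2 + ρ.2))]
      have g3 : lat ρ ≤ 9 * ((1 + t.1 ^ 2) * (1 + t.2 ^ 2)) := by
        calc lat ρ ≤ (3 * (1 + t.1 ^ 2)) * (3 * (1 + t.2 ^ 2)) :=
              mul_le_mul g1 g2 (by positivity) (by positivity)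
          _ = _ := by ring
      have g4 : lat ρ ^ 3 ≤ 729 * ((1 + t.1 ^ 2) * (1 + t.2 ^ 2)) ^ 3 := by
        calc lat ρ ^ 3 ≤ (9 * ((1 + t.1 ^ 2) * (1 + t.2 ^ 2))) ^ 3 :=
              pow_le_pow_left₀ (lat_pos ρ).le g3 3
          _ = _ := by ring
      have hl : 0 < lat ρ ^ 3 := pow_pos (lat_pos ρ) 3
      rw [tail, ← div_eq_mul_inv, inv_eq_one_div, div_le_div_iff₀ (by positivity) hl]
      linarith
    calc _ ≤ f u * ENNReal.ofReal (n * (729 * (lat ρ ^ 3)⁻¹)) := by gcongr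
      _ = _ := by rw [ENNReal.ofReal_mul hn.le]; ring
  calc boxAvg s n f z
      = ∫⁻ u in ⋃ ρ, cell s n (cellIdx s n z + ρ),
          f u * ENNReal.ofReal (n * tail (shear s 1 n (z - u))) := by
        rw [hcov, setLIntegral_univ, boxAvg]
    _ ≤ ∑' ρ, ∫⁻ u in cell s n (cellIdx s n z + ρ),
          f u * ENNReal.ofReal (n * tail (shear s 1 n (z - u))) := lintegral_iUnion_le _ _
    _ ≤ ∑' ρ, ENNReal.ofReal ((729 * Z)⁻¹ * 729 * (lat ρ)⁻¹) * β := by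
        refine ENNReal.tsum_le_tsum fun ρ => ?_
        refine (setLIntegral_mono' (measurableSet_cell _ _ _) (hker ρ)).trans ?_
        rw [lintegral_const_mul' _ _ (by finiteness), mul_right_comm, mul_comm]
        refine (mul_le_mul_right (hcon ρ) _).trans (le_of_eq ?_)
        have hl := (lat_pos ρ).ne'
        rw [← mul_assoc, ← ENNReal.ofReal_mul (by have := lat_pos ρ; positivity)]
        congr 2
        field_simp
    _ = ENNReal.ofReal (∑' ρ, (729 * Z)⁻¹ * 729 * (lat ρ)⁻¹) * β := by
        rw [ENNReal.tsum_mul_right, ENNReal.ofReal_tsum_of_nonneg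
          (fun ρ => by have := lat_pos ρ; positivity) (summable_inv_lat.mul_left _)]
    _ = β := by
        rw [tsum_mul_left, ← hZ]
        have : (729 * Z)⁻¹ * 729 * Z = 1 := by field_simp
        rw [this, ENNReal.ofReal_one, one_mul]

/-- If the average of `f` over a cell exceeds `θ`, so does, up to a factor two, the average of the
part of `f` where a majorant of `f` exceeds `θ / 2`. -/
theorem heavy_cell_truncate {s n : ℝ} (hn : 0 < n) {q : ℤ × ℤ} {f a : ℝ × ℝ → ℝ≥0∞}
    (hf : ∀ z, f z ≤ a z) {θ : ℝ} (hθ : 0 ≤ θ)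
    (h : ENNReal.ofReal θ < ENNReal.ofReal n * ∫⁻ u in cell s n q, f u) :
    ENNReal.ofReal (θ * n⁻¹) ≤ 2 * ∫⁻ u in cell s n q,
      {z | ENNReal.ofReal (θ / 2) < a z}.indicator f u := by
  set A := {z | ENNReal.ofReal (θ / 2) < a z} with hA
  have h1 : ∫⁻ u in cell s n q, f u ≤
      (∫⁻ u in cell s n q, A.indicator f u) + ENNReal.ofReal (θ / 2) * ENNReal.ofReal n⁻¹ := by
    calc ∫⁻ u in cell s n q, f u
        ≤ ∫⁻ u in cell s n q, (A.indicator f u + ENNReal.ofReal (θ / 2)) := by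
          refine lintegral_mono fun u => ?_
          by_cases hu : u ∈ A
          · rw [Set.indicator_of_mem hu]; exact le_self_add
          · rw [Set.indicator_of_notMem hu, zero_add]
            exact (hf u).trans (not_lt.1 hu)
      _ = (∫⁻ u in cell s n q, A.indicator f u) + ENNReal.ofReal (θ / 2) * volume (cell s n q) := by
          rw [lintegral_add_right _ measurable_const, setLIntegral_const]
      _ ≤ _ := by gcongr; exact volume_cell_le s hn q
  set I := ∫⁻ u in cell s n q, A.indicator f u with hI
  have h2 : ENNReal.ofReal θ ≤ ENNReal.ofReal n * I + ENNReal.ofReal (θ / 2) := by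
    refine h.le.trans ((mul_le_mul_right h1 _).trans (le_of_eq ?_))
    rw [mul_add, mul_left_comm, ← ENNReal.ofReal_mul hn.le, mul_inv_cancel₀ hn.ne',
      ENNReal.ofReal_one, mul_one]
  have h3 : ENNReal.ofReal (θ / 2) ≤ ENNReal.ofReal n * I := by
    rw [show θ = θ / 2 + θ / 2 by ring, ENNReal.ofReal_add (by positivity) (by positivity),
      show (θ / 2 + θ / 2) / 2 = θ / 2 by ring] at h2
    exact (ENNReal.add_le_add_iff_right ENNReal.ofReal_ne_top).1 h2
  calc ENNReal.ofReal (θ * n⁻¹) = 2 * ENNReal.ofReal n⁻¹ * ENNReal.ofReal (θ / 2) := by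
        rw [← ENNReal.ofReal_ofNat 2, ← ENNReal.ofReal_mul (by norm_num),
          ← ENNReal.ofReal_mul (by positivity)]
        congr 1; ring
    _ ≤ 2 * ENNReal.ofReal n⁻¹ * (ENNReal.ofReal n * I) := mul_le_mul_right h3 _
    _ = 2 * I := by
        rw [mul_assoc, ← mul_assoc (ENNReal.ofReal n⁻¹), ← ENNReal.ofReal_mul (by positivity),
          inv_mul_cancel₀ hn.ne', ENNReal.ofReal_one, one_mul]

theorem tsum_ite_le_of_subsingleton {ι : Type*} (P : ι → Prop) [DecidablePred P]
    (hP : ∀ i j, P i → P j → i = j) (x : ℝ≥0∞) : ∑' i, (if P i then x else 0) ≤ x := by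
  by_cases h : ∃ i, P i
  · obtain ⟨i, hi⟩ := h
    rw [tsum_eq_single i fun j hj => if_neg fun hPj => hj (hP j i hPj hi), if_pos hi]
  · push Not at h
    simp [h]

/-- Cells may overlap in the plane; only their products with the index neighbourhoods are disjoint.
Hence each pair `(z, k)` is counted at most once, which is all that is needed. -/
theorem tsum_lintegral_cell_le {σ : ℝ → ℝ} {K : Finset ℤ} {A : ℤ → ℝ × ℝ → ℝ≥0∞}
    (hA : ∀ k ∈ K, Measurable (A k)) {u : Set (Node × (ℤ × ℤ))}
    (hu : u.PairwiseDisjoint fun b => (cell (b.1.slope σ) b.1.len b.2) ×ˢ (nbrs K b.1 : Set ℤ)) :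
    ∑' b : u, ∫⁻ z in cell (b.1.1.slope σ) b.1.1.len b.1.2, ∑ k ∈ nbrs K b.1.1, A k z ≤
      ∫⁻ z, ∑ k ∈ K, A k z := by
  classical
  have e1 : ∀ b : u, ∫⁻ z in cell (b.1.1.slope σ) b.1.1.len b.1.2, ∑ k ∈ nbrs K b.1.1, A k z =
      ∫⁻ z, ∑ k ∈ K, if z ∈ cell (b.1.1.slope σ) b.1.1.len b.1.2 ∧ k ∈ nbrs K b.1.1 then A k z
        else 0 := by
    intro b
    rw [← lintegral_indicator (measurableSet_cell _ _ _)]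
    refine lintegral_congr fun z => ?_
    by_cases hz : z ∈ cell (b.1.1.slope σ) b.1.1.len b.1.2
    · rw [Set.indicator_of_mem hz]
      simp only [hz, true_and]
      rw [← Finset.sum_filter]
      refine Finset.sum_congr ?_ fun _ _ => rfl
      ext k
      simp only [Finset.mem_filter]
      exact ⟨fun h => ⟨nbrs_subset K _ h, h⟩, fun h => h.2⟩
    · rw [Set.indicator_of_notMem hz]
      simp [hz]
  rw [tsum_congr e1, ← lintegral_tsum]
  · refine lintegral_mono fun z => ?_
    simp only
    rw [Summable.tsum_finsetSum fun _ _ => ENNReal.summable]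
    refine Finset.sum_le_sum fun k hk => tsum_ite_le_of_subsingleton _ ?_ _
    intro b b' hb hb'
    by_contra hne
    have := hu b.2 b'.2 fun h => hne (Subtype.ext h)
    exact Set.disjoint_left.1 this (show (z, k) ∈ _ from ⟨hb.1, hb.2⟩) ⟨hb'.1, hb'.2⟩
  · intro b
    refine (Finset.measurable_sum _ fun k hk => ?_).aemeasurable
    by_cases h : k ∈ nbrs K b.1.1
    · simp only [h, and_true]
      exact Measurable.ite (measurableSet_cell _ _ _) (hA k hk) measurable_const
    · simp [h]

/-! ### A Carleson embedding -/

/-- The square of the full square function. -/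
noncomputable def fullSum (K : Finset ℤ) (F : ℤ → ℝ × ℝ → ℂ) (z : ℝ × ℝ) : ℝ≥0∞ :=
  ∑ k ∈ K, ‖F k z‖ₑ ^ 2

theorem localSum_le_fullSum (K : Finset ℤ) (F : ℤ → ℝ × ℝ → ℂ) (ν : Node) (z : ℝ × ℝ) :
    localSum K F ν z ≤ fullSum K F z :=
  Finset.sum_le_sum_of_subset (nbrs_subset K ν)

theorem measurable_fullSum {K : Finset ℤ} {F : ℤ → ℝ × ℝ → ℂ} (hF : ∀ k ∈ K, Continuous (F k)) :
    Measurable (fullSum K F) :=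
  Finset.measurable_sum _ fun k hk => (hF k hk).measurable.enorm.pow_const 2

/-- The points such that the cell at offset `ρ` is heavy at height `θ`. -/
def heavySet (σ : ℝ → ℝ) (K : Finset ℤ) (F : ℤ → ℝ × ℝ → ℂ) (ν : Node) (ρ : ℤ × ℤ) (θ : ℝ) :
    Set (ℝ × ℝ) :=
  {z | ENNReal.ofReal θ < ENNReal.ofReal ν.len *
    ∫⁻ u in cell (ν.slope σ) ν.len (cellIdx (ν.slope σ) ν.len z + ρ), localSum K F ν u}

/-- Lengths are powers of two, so comparability up to a factor below 2 is a genuine ordering. -/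
theorem len_le_of_inv_le {ν ν' : Node} (h : ν.len⁻¹ ≤ 3 / 2 * ν'.len⁻¹) : ν'.1 ≤ ν.1 := by
  by_contra hlt
  push Not at hlt
  have hn := ν.len_pos
  have hn' := ν'.len_pos
  have h1 : 2 * ν.len ≤ ν'.len := by
    have : ν.len * 2 = 2 ^ (ν.1 + 1) := by rw [Node.len, pow_succ]
    rw [mul_comm, this]
    exact pow_le_pow_right₀ (by norm_num) hlt
  rw [← div_eq_mul_inv, inv_eq_one_div, div_le_div_iff₀ hn hn'] at h
  linarith

theorem related_of_mem {K : Finset ℤ} {ν ν' : Node} (h : ν'.1 ≤ ν.1) {k : ℤ} (hk : k ∈ nbrs K ν)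
    (hk' : k ∈ nbrs K ν') : Related ν' ν := by
  refine ⟨h, ?_⟩
  have h1 := abs_sub_pt_le hk (Int.floor_intCast (R := ℝ) k)
  have h2 := abs_sub_pt_le hk' (Int.floor_intCast (R := ℝ) k)
  have h3 : ν'.len ≤ ν.len := pow_le_pow_right₀ (by norm_num) h
  rw [show ν.pt - ν'.pt = ((k : ℝ) - ν'.pt) - (k - ν.pt) by ring]
  refine (abs_sub _ _).trans ?_
  linarith

/-- The dilation factor needed to reach the cells at offset `ρ`. -/
noncomputable def dil (L : ℝ) (ρ : ℤ × ℤ) : ℝ :=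
  (4 * L + 3) * ((1 + |(ρ.1 : ℝ)|) * (1 + |(ρ.2 : ℝ)|))

theorem one_le_dil {L : ℝ} (hL : 0 < L) (ρ : ℤ × ℤ) : 1 ≤ dil L ρ := by
  unfold dil
  have h1 : 1 ≤ 1 + |(ρ.1 : ℝ)| := le_add_of_nonneg_right (abs_nonneg _)
  have h2 : 1 ≤ 1 + |(ρ.2 : ℝ)| := le_add_of_nonneg_right (abs_nonneg _)
  exact one_le_mul_of_one_le_of_one_le (by linarith) (one_le_mul_of_one_le_of_one_le h1 h2)

theorem dil_sq_le (L : ℝ) (ρ : ℤ × ℤ) : dil L ρ ^ 2 ≤ (4 * L + 3) ^ 2 * 4 * lat ρ := by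
  unfold dil lat
  have h : ∀ x : ℝ, (1 + |x|) ^ 2 ≤ 2 * (1 + x ^ 2) := fun x => by
    nlinarith [sq_nonneg (|x| - 1), sq_abs x]
  calc _ = (4 * L + 3) ^ 2 * ((1 + |(ρ.1 : ℝ)|) ^ 2 * (1 + |(ρ.2 : ℝ)|) ^ 2) := by ring
    _ ≤ (4 * L + 3) ^ 2 * ((2 * (1 + (ρ.1 : ℝ) ^ 2)) * (2 * (1 + (ρ.2 : ℝ) ^ 2))) := by
        gcongr
        · exact h _
        · exact h _
    _ = _ := by ring

/-- The engulfing property of the Vitali argument: the cell of the longer node is shorter in space,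
and the change of slope costs at most `4 L` in normalised coordinates. Reaching the cell at offset ρ
costs the factor `dil`. -/
theorem mem_box_of_cells_meet {c L : ℝ} {Γ σ : ℝ → ℝ} (hΓ : ConvexCurve c L Γ σ) {ν ν' : Node}
    (h : Related ν' ν) {q' ρ : ℤ × ℤ} {z y : ℝ × ℝ}
    (hy : y ∈ cell (ν.slope σ) ν.len (cellIdx (ν.slope σ) ν.len z + ρ))
    (hy' : y ∈ cell (ν'.slope σ) ν'.len q') :
    z ∈ box (ν'.slope σ) ν'.len ((q'.1 : ℝ), (q'.2 : ℝ)) (dil L ρ) := by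
  have hn := ν.len_pos
  have hn' := ν'.len_pos
  have hL := hΓ.pos'
  have hs : |ν.slope σ - ν'.slope σ| ≤ 4 * L * ν.len := by
    refine (hΓ.abs_slope_sub_le _ _).trans ?_
    calc L * |ν.pt - ν'.pt| ≤ L * (4 * ν.len) := mul_le_mul_of_nonneg_left h.2 hL.le
      _ = _ := by ring
  obtain ⟨⟨h1, h2⟩, h3, h4⟩ := cell_bounds hy
  obtain ⟨⟨k1, k2⟩, k3, k4⟩ := cell_bounds hy'
  obtain ⟨⟨l1, l2⟩, l3, l4⟩ := cell_bounds (mem_cell.2 (rfl : cellIdx (ν.slope σ) ν.len z = _))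
  rw [Prod.fst_add, Int.cast_add] at h1 h2
  rw [Prod.snd_add, Int.cast_add] at h3 h4
  simp only [shear, one_mul] at h1 h2 h3 h4 k1 k2 k3 k4 l1 l2 l3 l4
  set a := |(ρ.1 : ℝ)| with ha
  set b := |(ρ.2 : ℝ)| with hb
  have ha0 : 0 ≤ a := abs_nonneg _
  have hb0 : 0 ≤ b := abs_nonneg _
  have hρ1 := abs_le.1 ha.ge
  have hρ2 := abs_le.1 hb.ge
  set x := z.1 - y.1 with hx
  set v := z.2 - y.2 with hv
  have e1 : |x + ν.slope σ * v| ≤ 1 + a := by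
    rw [abs_le, hx, hv]; constructor <;> linarith
  have e2 : ν.len * |v| ≤ 1 + b := by
    have : |ν.len * v| ≤ 1 + b := by rw [abs_le, hv]; constructor <;> linarith
    rwa [abs_mul, abs_of_pos hn] at this
  have e3 : ν'.len * |v| ≤ 1 + b := le_trans (by gcongr; exact h.len_le) e2
  have e4 : |x + ν'.slope σ * v| ≤ (1 + a) + 4 * L * (1 + b) := by
    have : x + ν'.slope σ * v = (x + ν.slope σ * v) - (ν.slope σ - ν'.slope σ) * v := by ring
    rw [this]
    refine (abs_sub _ _).trans (add_le_add e1 ?_)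
    rw [abs_mul]
    calc _ ≤ 4 * L * ν.len * |v| := by gcongr
      _ = 4 * L * (ν.len * |v|) := by ring
      _ ≤ _ := by gcongr
  have hab : 0 ≤ a * b := mul_nonneg ha0 hb0
  have hd : dil L ρ = (4 * L + 3) * ((1 + a) * (1 + b)) := rfl
  have hLab : 0 ≤ L * a ∧ 0 ≤ L * b ∧ 0 ≤ L * (a * b) :=
    ⟨by positivity, by positivity, by positivity⟩
  constructor
  · simp only [shear, one_mul]
    have e5 := abs_le.1 e4
    rw [hd, abs_le]
    constructor <;> nlinarith
  · simp only [shear]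
    have e5 : |ν'.len * v| ≤ 1 + b := by rw [abs_mul, abs_of_pos hn']; exact e3
    have e6 := abs_le.1 e5
    rw [hd, abs_le]
    constructor <;> nlinarith

section

variable {Λ : ℝ} {κ m : ℝ × ℝ → ℂ}

/-- Heavy cells are organised by a Vitali selection in the product of the plane and the index set.
All nodes engulfed by a selected cell are treated together by the local Bessel inequality at the
price of its area. Heaviness bounds that area by the mass in the cell, and the masses add up by
disjointness. -/
theorem Projector.exists_heavySet_bound (h : Projector Λ κ m) (c L : ℝ) :
    ∃ C : ℝ≥0, ∀ Γ σ : ℝ → ℝ, ConvexCurve c L Γ σ → ∀ (K : Finset ℤ) (F : ℤ → ℝ × ℝ → ℂ),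
      (∀ k ∈ K, Continuous (F k)) → ∀ (S : Finset Node) (g : ℝ × ℝ → ℂ) (G : ℝ≥0∞),
        Integrable g → (∀ z, ‖g z‖ₑ ≤ G) → ∀ (ρ : ℤ × ℤ) (θ : ℝ), 0 < θ →
          ENNReal.ofReal θ * ∑ ν ∈ S, ∫⁻ z in heavySet σ K F ν ρ θ, ‖proj κ σ ν g z‖ₑ ^ 2 ≤
            C * (G ^ 2 * ENNReal.ofReal (lat ρ)) *
              ∫⁻ z in {z | ENNReal.ofReal (θ / 2) < fullSum K F z}, fullSum K F z := by
  classical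
  obtain ⟨C, hC⟩ := h.exists_local c L
  refine ⟨C * (2 * ((4 * L + 3) ^ 2 * 4).toNNReal), fun Γ σ hΓ K F hF S g G hg hG ρ θ hθ => ?_⟩
  have hL := hΓ.pos'
  set t : Set (Node × (ℤ × ℤ)) := {b | b.1 ∈ S ∧ ENNReal.ofReal θ < ENNReal.ofReal b.1.len *
    ∫⁻ u in cell (b.1.slope σ) b.1.len b.2, localSum K F b.1 u} with ht
  set B : Node × (ℤ × ℤ) → Set ((ℝ × ℝ) × ℤ) := fun b =>
    cell (b.1.slope σ) b.1.len b.2 ×ˢ (nbrs K b.1 : Set ℤ) with hB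
  have hne : ∀ b ∈ t, (B b).Nonempty := by
    intro b hb
    rw [hB, Set.prod_nonempty_iff]
    refine ⟨?_, ?_⟩
    · by_contra h0
      rw [Set.not_nonempty_iff_eq_empty] at h0
      have := hb.2
      rw [h0] at this
      simp at this
    · by_contra h0
      rw [Set.not_nonempty_iff_eq_empty, Finset.coe_eq_empty] at h0
      have := hb.2
      simp [localSum, h0] at this
  -- The size is `len⁻¹`, so spatially large cells are selected first. The factor `3/2`, below the
  -- dyadic ratio 2, ensures that the selected node is no longer than the one it covers.
  obtain ⟨u, hut, hud, hcov⟩ := Vitali.exists_disjoint_subfamily_covering_enlargement B t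
    (fun b => b.1.len⁻¹) (3 / 2) (by norm_num) (fun b _ => (inv_pos.2 b.1.len_pos).le) 1
    (fun b _ => inv_le_one_of_one_le₀ b.1.one_le_len) hne
  set A : Set (ℝ × ℝ) := {z | ENNReal.ofReal (θ / 2) < fullSum K F z} with hA
  have hAm : MeasurableSet A := measurableSet_lt measurable_const (measurable_fullSum hF)
  set Dil : Node × (ℤ × ℤ) → Set (ℝ × ℝ) := fun b =>
    box (b.1.slope σ) b.1.len ((b.2.1 : ℝ), (b.2.2 : ℝ)) (dil L ρ) with hDil
  have hsub : ∀ ν ∈ S, heavySet σ K F ν ρ θ ⊆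
      ⋃ b : u, if Related b.1.1 ν then Dil b.1 else ∅ := by
    intro ν hν z hz
    obtain ⟨b, hb, ⟨⟨y, k⟩, ⟨hy, hk⟩, hy', hk'⟩, hδ⟩ :=
      hcov (ν, cellIdx (ν.slope σ) ν.len z + ρ) ⟨hν, hz⟩
    have hr : Related b.1 ν := related_of_mem (len_le_of_inv_le hδ) hk hk'
    refine Set.mem_iUnion.2 ⟨⟨b, hb⟩, ?_⟩
    rw [if_pos hr]
    exact mem_box_of_cells_meet hΓ hr hy hy'
  have hlocal : ∀ b : u, ∑ ν ∈ S.filter (Related b.1.1), ∫⁻ z in Dil b.1, ‖proj κ σ ν g z‖ₑ ^ 2 ≤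
      C * (G ^ 2 * ENNReal.ofReal (dil L ρ ^ 2 * b.1.1.len⁻¹)) := fun b =>
    hC Γ σ hΓ b.1.1 _ (fun ν hν => (Finset.mem_filter.1 hν).2) _ _ (one_le_dil hL ρ) g G hg hG
  have hmass : ∀ b : u, ENNReal.ofReal (θ * b.1.1.len⁻¹) ≤ 2 *
      ∫⁻ z in cell (b.1.1.slope σ) b.1.1.len b.1.2, ∑ k ∈ nbrs K b.1.1,
        A.indicator (fun z => ‖F k z‖ₑ ^ 2) z := by
    intro b
    refine (heavy_cell_truncate b.1.1.len_pos (localSum_le_fullSum K F b.1.1) hθ.le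
      (hut b.2).2).trans (le_of_eq ?_)
    congr 1
    refine lintegral_congr fun z => ?_
    by_cases hz : z ∈ A
    · simp only [← hA, Set.indicator_of_mem hz, localSum]
    · simp only [← hA, Set.indicator_of_notMem hz, Finset.sum_const_zero]
  have hpack : ∑' b : u, ∫⁻ z in cell (b.1.1.slope σ) b.1.1.len b.1.2, ∑ k ∈ nbrs K b.1.1,
        A.indicator (fun z => ‖F k z‖ₑ ^ 2) z ≤ ∫⁻ z in A, fullSum K F z := by
    refine (tsum_lintegral_cell_le (A := fun k => A.indicator (fun z => ‖F k z‖ₑ ^ 2))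
      (fun k hk => ((hF k hk).measurable.enorm.pow_const 2).indicator hAm) hud).trans
        (le_of_eq ?_)
    rw [← lintegral_indicator hAm]
    refine lintegral_congr fun z => ?_
    by_cases hz : z ∈ A
    · simp only [Set.indicator_of_mem hz, fullSum]
    · simp only [Set.indicator_of_notMem hz, Finset.sum_const_zero]
  have hmain : ∑ ν ∈ S, ∫⁻ z in heavySet σ K F ν ρ θ, ‖proj κ σ ν g z‖ₑ ^ 2 ≤
      ∑' b : u, C * (G ^ 2 * ENNReal.ofReal (dil L ρ ^ 2 * b.1.1.len⁻¹)) := by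
    calc _ ≤ ∑ ν ∈ S, ∑' b : u, ∫⁻ z in (if Related b.1.1 ν then Dil b.1 else ∅),
            ‖proj κ σ ν g z‖ₑ ^ 2 := by
          refine Finset.sum_le_sum fun ν hν => ?_
          exact (lintegral_mono_set (hsub ν hν)).trans (lintegral_iUnion_le _ _)
      _ = ∑' b : u, ∑ ν ∈ S.filter (Related b.1.1), ∫⁻ z in Dil b.1, ‖proj κ σ ν g z‖ₑ ^ 2 := by
          rw [← Summable.tsum_finsetSum fun _ _ => ENNReal.summable]
          refine tsum_congr fun b => ?_
          rw [Finset.sum_filter]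
          refine Finset.sum_congr rfl fun ν _ => ?_
          split_ifs <;> simp
      _ ≤ _ := ENNReal.tsum_le_tsum hlocal
  calc _ ≤ ENNReal.ofReal θ *
        ∑' b : u, C * (G ^ 2 * ENNReal.ofReal (dil L ρ ^ 2 * b.1.1.len⁻¹)) :=
        mul_le_mul_right hmain _
    _ = C * (G ^ 2 * ENNReal.ofReal (dil L ρ ^ 2)) * ∑' b : u, ENNReal.ofReal (θ * b.1.1.len⁻¹) := by
        rw [← ENNReal.tsum_mul_left, ← ENNReal.tsum_mul_left]
        refine tsum_congr fun b => ?_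
        rw [ENNReal.ofReal_mul hθ.le, ENNReal.ofReal_mul (by positivity)]
        ring
    _ ≤ C * (G ^ 2 * ENNReal.ofReal ((4 * L + 3) ^ 2 * 4 * lat ρ)) *
          (2 * ∫⁻ z in A, fullSum K F z) := by
        refine mul_le_mul' ?_ ?_
        · gcongr
          exact dil_sq_le L ρ
        · refine (ENNReal.tsum_le_tsum hmass).trans ?_
          rw [ENNReal.tsum_mul_left]
          exact mul_le_mul_right hpack _
    _ = _ := by
        rw [ENNReal.ofReal_mul (by positivity)]
        push_cast
        rw [ENNReal.ofReal]
        ring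

/-- A large average forces a heavy cell at some offset ρ with threshold `θ = ε lat(ρ)² β`. The
heavy-set bound costs `lat(ρ) / θ`, so the sum over offsets converges and leaves `β⁻¹`. -/
theorem Projector.exists_carleson (h : Projector Λ κ m) (c L : ℝ) :
    ∃ (C : ℝ≥0) (ε : ℝ), 0 < ε ∧ ∀ Γ σ : ℝ → ℝ, ConvexCurve c L Γ σ →
      ∀ (K : Finset ℤ) (F : ℤ → ℝ × ℝ → ℂ),
      (∀ k ∈ K, Continuous (F k)) → ∀ (S : Finset Node) (g : ℝ × ℝ → ℂ) (G : ℝ≥0∞),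
        Integrable g → (∀ z, ‖g z‖ₑ ≤ G) → ∀ β : ℝ, 0 < β →
          ∑ ν ∈ S, ∫⁻ z in {z | ENNReal.ofReal β < localAvg σ K F ν z}, ‖proj κ σ ν g z‖ₑ ^ 2 ≤
            C * (G ^ 2 * ENNReal.ofReal β⁻¹) *
              ∫⁻ z in {z | ENNReal.ofReal (ε * β) < fullSum K F z}, fullSum K F z := by
  obtain ⟨C, hC⟩ := h.exists_heavySet_bound c L
  obtain ⟨ε, hε, hheavy⟩ := exists_heavy_cell
  set Z := ∑' ρ, (lat ρ)⁻¹ with hZ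
  refine ⟨C * (ε⁻¹ * Z).toNNReal, ε / 2, by positivity,
    fun Γ σ hΓ K F hF S g G hg hG β hβ => ?_⟩
  set I := ∫⁻ z in {z | ENNReal.ofReal (ε / 2 * β) < fullSum K F z}, fullSum K F z with hI
  have hsub : ∀ ν, {z | ENNReal.ofReal β < localAvg σ K F ν z} ⊆
      ⋃ ρ, heavySet σ K F ν ρ (ε * lat ρ ^ 2 * β) := by
    intro ν z hz
    obtain ⟨ρ, hρ⟩ := hheavy _ _ ν.len_pos _ _ z hz
    refine Set.mem_iUnion.2 ⟨ρ, ?_⟩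
    rw [← ENNReal.ofReal_mul (by positivity)] at hρ
    exact hρ
  have hstep : ∀ ρ, ∑ ν ∈ S, ∫⁻ z in heavySet σ K F ν ρ (ε * lat ρ ^ 2 * β),
      ‖proj κ σ ν g z‖ₑ ^ 2 ≤ C * (G ^ 2 * ENNReal.ofReal β⁻¹) * I *
        ENNReal.ofReal (ε⁻¹ * (lat ρ)⁻¹) := by
    intro ρ
    have hl := lat_pos ρ
    have hl1 := one_le_lat ρ
    set θ := ε * lat ρ ^ 2 * β with hθ
    have hθ0 : 0 < θ := by positivity
    have h1 := hC Γ σ hΓ K F hF S g G hg hG ρ θ hθ0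
    set X := ∑ ν ∈ S, ∫⁻ z in heavySet σ K F ν ρ θ, ‖proj κ σ ν g z‖ₑ ^ 2
    have h2 : ∫⁻ z in {z | ENNReal.ofReal (θ / 2) < fullSum K F z}, fullSum K F z ≤ I := by
      refine lintegral_mono_set fun z hz => lt_of_le_of_lt (ENNReal.ofReal_le_ofReal ?_) hz
      rw [hθ]
      have : 1 ≤ lat ρ ^ 2 := one_le_pow₀ hl1
      have h3 : ε * β * 1 ≤ ε * β * lat ρ ^ 2 := by gcongr
      linarith
    calc X = ENNReal.ofReal θ⁻¹ * (ENNReal.ofReal θ * X) := by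
          rw [← mul_assoc, ← ENNReal.ofReal_mul (by positivity), inv_mul_cancel₀ hθ0.ne',
            ENNReal.ofReal_one, one_mul]
      _ ≤ ENNReal.ofReal θ⁻¹ * (C * (G ^ 2 * ENNReal.ofReal (lat ρ)) * I) :=
          mul_le_mul_right (h1.trans (mul_le_mul_right h2 _)) _
      _ = C * G ^ 2 * I * (ENNReal.ofReal θ⁻¹ * ENNReal.ofReal (lat ρ)) := by ring
      _ = C * G ^ 2 * I * (ENNReal.ofReal β⁻¹ * ENNReal.ofReal (ε⁻¹ * (lat ρ)⁻¹)) := by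
          rw [← ENNReal.ofReal_mul (by positivity), ← ENNReal.ofReal_mul (by positivity)]
          congr 2
          rw [hθ]; field_simp
      _ = _ := by ring
  calc _ ≤ ∑ ν ∈ S, ∑' ρ, ∫⁻ z in heavySet σ K F ν ρ (ε * lat ρ ^ 2 * β),
          ‖proj κ σ ν g z‖ₑ ^ 2 :=
        Finset.sum_le_sum fun ν _ =>
          (lintegral_mono_set (hsub ν)).trans (lintegral_iUnion_le _ _)
    _ = ∑' ρ, ∑ ν ∈ S, ∫⁻ z in heavySet σ K F ν ρ (ε * lat ρ ^ 2 * β),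
          ‖proj κ σ ν g z‖ₑ ^ 2 := (Summable.tsum_finsetSum fun _ _ => ENNReal.summable).symm
    _ ≤ ∑' ρ, C * (G ^ 2 * ENNReal.ofReal β⁻¹) * I * ENNReal.ofReal (ε⁻¹ * (lat ρ)⁻¹) :=
        ENNReal.tsum_le_tsum hstep
    _ = C * (G ^ 2 * ENNReal.ofReal β⁻¹) * I * ENNReal.ofReal (ε⁻¹ * Z) := by
        rw [ENNReal.tsum_mul_left, ← ENNReal.ofReal_tsum_of_nonneg
          (fun ρ => by have := lat_pos ρ; positivity) (summable_inv_lat.mul_left _),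
          tsum_mul_left]
    _ = _ := by rw [ENNReal.coe_mul]; simp only [ENNReal.ofReal]; ring

end

/-! ### The weighted square function estimate -/

/-- The layer-cake formula for the measure with density h. -/
theorem lintegral_mul_rpow_eq_layercake {h : ℝ × ℝ → ℝ≥0∞} (hh : Measurable h) {f : ℝ × ℝ → ℝ}
    (hf : Measurable f) (hf0 : ∀ z, 0 ≤ f z) {p : ℝ} (hp : 0 < p) :
    ∫⁻ z, h z * ENNReal.ofReal (f z ^ p) = ENNReal.ofReal p *
      ∫⁻ t in Set.Ioi (0 : ℝ), (∫⁻ z in {z | t < f z}, h z) * ENNReal.ofReal (t ^ (p - 1)) := by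
  have h1 := lintegral_rpow_eq_lintegral_meas_lt_mul (volume.withDensity h)
    (f := f) (.of_forall hf0) hf.aemeasurable hp
  rw [lintegral_withDensity_eq_lintegral_mul _ hh (hf.pow_const p).ennreal_ofReal] at h1
  refine h1.trans ?_
  congr 1
  refine lintegral_congr fun t => ?_
  rw [withDensity_apply _ (measurableSet_lt measurable_const hf)]

theorem antitone_setLIntegral_lt (h : ℝ × ℝ → ℝ≥0∞) (f : ℝ × ℝ → ℝ) :
    Antitone fun t => ∫⁻ z in {z | t < f z}, h z := fun _ _ hst =>
  lintegral_mono_set fun _ hz => lt_of_le_of_lt hst hz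

theorem measurable_layer (h : ℝ × ℝ → ℝ≥0∞) (f : ℝ × ℝ → ℝ) (p : ℝ) :
    Measurable fun t => (∫⁻ z in {z | t < f z}, h z) * ENNReal.ofReal (t ^ p) :=
  (antitone_setLIntegral_lt h f).measurable.mul (by fun_prop)

section

variable {Λ : ℝ} {κ m : ℝ × ℝ → ℂ}

/-- At height t, cut g at size `t^{s-1}`. The bounded part goes through the Carleson embedding,
giving `t^{2(s-1)} t⁻¹ = t^{2s-3}`; the large part goes through Bessel. -/
theorem Projector.exists_split_bound (h : Projector Λ κ m) (c L : ℝ) {s : ℝ} (hs1 : 1 < s) :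
    ∃ (C : ℝ≥0) (ε : ℝ), 0 < ε ∧ ∀ Γ σ : ℝ → ℝ, ConvexCurve c L Γ σ →
      ∀ (K : Finset ℤ) (F : ℤ → ℝ × ℝ → ℂ), (∀ k ∈ K, Continuous (F k)) →
      (∀ k ∈ K, ∃ B, ∀ z, ‖F k z‖ ≤ B) → ∀ (S : Finset Node) (g : ℝ × ℝ → ℂ),
        Measurable g → Integrable g → ∀ t : ℝ, 0 < t →
          ∑ ν ∈ S, ∫⁻ z in {z | t < (localAvg σ K F ν z).toReal}, ‖proj κ σ ν g z‖ₑ ^ 2 ≤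
            C * (ENNReal.ofReal (t ^ (2 * s - 3)) *
              (∫⁻ z in {z | t < (fullSum K F z).toReal * ε⁻¹}, fullSum K F z) +
              ∫⁻ z in {z | t < ‖g z‖ ^ (s - 1)⁻¹}, ‖g z‖ₑ ^ 2) := by
  obtain ⟨C₁, ε, hε, h1⟩ := h.exists_carleson c L
  obtain ⟨C₂, h2⟩ := h.exists_bessel c L
  refine ⟨2 * (C₁ + C₂), ε, hε, fun Γ σ hΓ K F hF hFb S g hgm hg t ht => ?_⟩
  have hs0 : 0 < s - 1 := by linarith
  set E : Set (ℝ × ℝ) := {z | t < ‖g z‖ ^ (s - 1)⁻¹} with hE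
  have hEm : MeasurableSet E := measurableSet_lt measurable_const (hgm.norm.pow_const _)
  set g₁ := Eᶜ.indicator g with hg₁
  set g₂ := E.indicator g with hg₂
  have hi₁ : Integrable g₁ := hg.indicator hEm.compl
  have hi₂ : Integrable g₂ := hg.indicator hEm
  have hsum : g = fun z => g₁ z + g₂ z := by
    funext z; exact (congrFun (Set.indicator_compl_add_self E g) z).symm
  have hG1 : ∀ z, ‖g₁ z‖ₑ ≤ ENNReal.ofReal (t ^ (s - 1)) := by
    intro z
    by_cases hz : z ∈ E
    · rw [hg₁, Set.indicator_of_notMem (Set.notMem_compl_iff.2 hz)]; simp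
    · rw [hg₁, Set.indicator_of_mem hz, ← ofReal_norm]
      refine ENNReal.ofReal_le_ofReal ?_
      have hz' : ‖g z‖ ^ (s - 1)⁻¹ ≤ t := not_lt.1 hz
      calc ‖g z‖ = (‖g z‖ ^ (s - 1)⁻¹) ^ (s - 1) :=
            (Real.rpow_inv_rpow (norm_nonneg _) hs0.ne').symm
        _ ≤ t ^ (s - 1) := Real.rpow_le_rpow (by positivity) hz' hs0.le
  have hset : ∀ ν, {z | t < (localAvg σ K F ν z).toReal} =
      {z | ENNReal.ofReal t < localAvg σ K F ν z} := fun ν => by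
    ext z
    exact (ENNReal.ofReal_lt_iff_lt_toReal ht.le (localAvg_ne_top σ hFb ν z)).symm
  have hfin : ∀ z, fullSum K F z ≠ ∞ := fun z => ENNReal.sum_ne_top.2 fun k _ => by simp
  have hset' : {z | ENNReal.ofReal (ε * t) < fullSum K F z} =
      {z | t < (fullSum K F z).toReal * ε⁻¹} := by
    ext z
    simp only [Set.mem_ofPred_eq]
    rw [ENNReal.ofReal_lt_iff_lt_toReal (by positivity) (hfin z), ← div_eq_mul_inv,
      lt_div_iff₀ hε, mul_comm]
  have hpt : ∀ ν z, ‖proj κ σ ν g z‖ₑ ^ 2 ≤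
      2 * ‖proj κ σ ν g₁ z‖ₑ ^ 2 + 2 * ‖proj κ σ ν g₂ z‖ₑ ^ 2 := by
    intro ν z
    have hadd : proj κ σ ν g z = proj κ σ ν g₁ z + proj κ σ ν g₂ z := by
      conv_lhs => rw [hsum]
      exact cv_add (h.kernelPair _ ν.len_pos) hi₁ hi₂ z
    rw [hadd, ← mul_add]
    exact (pow_le_pow_left₀ zero_le (enorm_add_le _ _) 2).trans (sq_add_le _ _)
  have hstep : ∀ ν ∈ S, ∫⁻ z in {z | t < (localAvg σ K F ν z).toReal}, ‖proj κ σ ν g z‖ₑ ^ 2 ≤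
      2 * (∫⁻ z in {z | ENNReal.ofReal t < localAvg σ K F ν z}, ‖proj κ σ ν g₁ z‖ₑ ^ 2) +
        2 * ∫⁻ z, ‖proj κ σ ν g₂ z‖ₑ ^ 2 := by
    intro ν _
    rw [hset]
    refine (lintegral_mono (hpt ν)).trans ?_
    rw [lintegral_add_right _ (((h.continuous_proj σ ν hi₂).measurable.enorm.pow_const 2).const_mul 2),
      lintegral_const_mul' _ _ (by simp), lintegral_const_mul' _ _ (by simp)]
    exact add_le_add_right (mul_le_mul_right (setLIntegral_le_lintegral _ _) _) _
  have hg₂2 : ∫⁻ z, ‖g₂ z‖ₑ ^ 2 = ∫⁻ z in E, ‖g z‖ₑ ^ 2 := by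
    rw [← lintegral_indicator hEm]
    refine lintegral_congr fun z => ?_
    by_cases hz : z ∈ E
    · rw [hg₂, Set.indicator_of_mem hz, Set.indicator_of_mem hz]
    · rw [hg₂, Set.indicator_of_notMem hz, Set.indicator_of_notMem hz]; simp
  have b1 := h1 Γ σ hΓ K F hF S g₁ _ hi₁ hG1 t ht
  have b2 := h2 Γ σ hΓ S g₂ hi₂
  rw [hset'] at b1
  rw [hg₂2] at b2
  set X := ∫⁻ z in {z | t < (fullSum K F z).toReal * ε⁻¹}, fullSum K F z
  set Y := ∫⁻ z in E, ‖g z‖ₑ ^ 2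
  have ht2 : ENNReal.ofReal (t ^ (s - 1)) ^ 2 * ENNReal.ofReal t⁻¹ =
      ENNReal.ofReal (t ^ (2 * s - 3)) := by
    rw [← ENNReal.ofReal_pow (by positivity), ← ENNReal.ofReal_mul (by positivity)]
    congr 1
    rw [← Real.rpow_natCast, ← Real.rpow_mul ht.le, ← Real.rpow_neg_one, ← Real.rpow_add ht]
    congr 1; push_cast; ring
  rw [ht2] at b1
  set P := ENNReal.ofReal (t ^ (2 * s - 3))
  calc _ ≤ ∑ ν ∈ S, _ := Finset.sum_le_sum hstep
    _ = 2 * (∑ ν ∈ S, ∫⁻ z in {z | ENNReal.ofReal t < localAvg σ K F ν z},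
          ‖proj κ σ ν g₁ z‖ₑ ^ 2) + 2 * ∑ ν ∈ S, ∫⁻ z, ‖proj κ σ ν g₂ z‖ₑ ^ 2 := by
        rw [Finset.sum_add_distrib, Finset.mul_sum, Finset.mul_sum]
    _ ≤ 2 * (C₁ * P * X) + 2 * (C₂ * Y) :=
        add_le_add (mul_le_mul_right b1 _) (mul_le_mul_right b2 _)
    -- The missing cross terms are added so that a single constant factors out.
    _ ≤ 2 * (C₁ * P * X) + 2 * (C₂ * Y) + (2 * (C₁ * Y) + 2 * (C₂ * (P * X))) := le_self_add
    _ = _ := by push_cast; ring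

/-- The second Cauchy–Schwarz factor. Integrating the split bound against `t^{1-s}` turns `t^{2s-3}`
into `t^{s-2}`, the layer-cake density for the power s of the full sum. The truncation level of g is
chosen so that the other term becomes exactly the dual power `s/(s-1)`. -/
theorem Projector.exists_weighted_square (h : Projector Λ κ m) (c L : ℝ) {s : ℝ} (hs1 : 1 < s)
    (hs2 : s ≤ 2) :
    ∃ C : ℝ≥0, ∀ Γ σ : ℝ → ℝ, ConvexCurve c L Γ σ →
      ∀ (K : Finset ℤ) (F : ℤ → ℝ × ℝ → ℂ), (∀ k ∈ K, Continuous (F k)) →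
      (∀ k ∈ K, ∃ B, ∀ z, ‖F k z‖ ≤ B) → ∀ (S : Finset Node) (g : ℝ × ℝ → ℂ),
        Measurable g → Integrable g →
          ∑ ν ∈ S, ∫⁻ z, ‖proj κ σ ν g z‖ₑ ^ 2 * localAvg σ K F ν z ^ (2 - s) ≤
            C * ((∫⁻ z, fullSum K F z ^ s) + ∫⁻ z, ‖g z‖ₑ ^ (s / (s - 1))) := by
  -- At `s = 2` the weight is trivial and Bessel suffices; the layer-cake formula needs a positive
  -- exponent `2 - s`.
  rcases hs2.eq_or_lt with rfl | hs2
  · obtain ⟨C, hC⟩ := h.exists_bessel c L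
    refine ⟨C, fun Γ σ hΓ K F hF hFb S g hgm hg => ?_⟩
    have h1 := hC Γ σ hΓ S g hg
    norm_num
    exact h1.trans (mul_le_mul_right le_add_self _)
  obtain ⟨C, ε, hε, hC⟩ := h.exists_split_bound c L hs1
  have hs0 : 0 < s - 1 := by linarith
  have hq : 0 < 2 - s := by linarith
  set E : ℝ≥0∞ := ENNReal.ofReal (2 - s) * (C * (ENNReal.ofReal (s - 1)⁻¹ *
    ENNReal.ofReal (ε⁻¹ ^ (s - 1)) + ENNReal.ofReal (2 - s)⁻¹)) with hEdef
  have hEt : E ≠ ∞ := by finiteness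
  refine ⟨E.toNNReal, fun Γ σ hΓ K F hF hFb S g hgm hg => ?_⟩
  rw [ENNReal.coe_toNNReal hEt]
  have hfin : ∀ z, fullSum K F z ≠ ∞ := fun z => ENNReal.sum_ne_top.2 fun k _ => by simp
  have hfm := measurable_fullSum hF
  have l1 : ∫⁻ t in Set.Ioi (0 : ℝ), (∫⁻ z in {z | t < (fullSum K F z).toReal * ε⁻¹},
      fullSum K F z) * ENNReal.ofReal (t ^ (s - 1 - 1)) =
      ENNReal.ofReal (s - 1)⁻¹ * ENNReal.ofReal (ε⁻¹ ^ (s - 1)) * ∫⁻ z, fullSum K F z ^ s := by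
    have := lintegral_mul_rpow_eq_layercake hfm (f := fun z => (fullSum K F z).toReal * ε⁻¹)
      (hfm.ennreal_toReal.mul_const _) (fun z => by positivity) hs0
    have e : ∀ z, fullSum K F z * ENNReal.ofReal (((fullSum K F z).toReal * ε⁻¹) ^ (s - 1)) =
        ENNReal.ofReal (ε⁻¹ ^ (s - 1)) * fullSum K F z ^ s := by
      intro z
      rw [Real.mul_rpow ENNReal.toReal_nonneg (by positivity),
        ENNReal.ofReal_mul (by positivity), ← ENNReal.ofReal_rpow_of_nonneg ENNReal.toReal_nonneg hs0.le,
        ENNReal.ofReal_toReal (hfin z)]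
      have : fullSum K F z ^ s = fullSum K F z * fullSum K F z ^ (s - 1) := by
        conv_rhs => rw [← ENNReal.rpow_one (fullSum K F z), ← ENNReal.rpow_mul, one_mul]
        rw [← ENNReal.rpow_add_of_nonneg _ _ zero_le_one hs0.le]; congr 1; ring
      rw [this]; ring
    rw [lintegral_congr e, lintegral_const_mul' _ _ ENNReal.ofReal_ne_top] at this
    rw [mul_assoc, this, ← mul_assoc, ← ENNReal.ofReal_mul (by positivity),
      inv_mul_cancel₀ hs0.ne', ENNReal.ofReal_one, one_mul]
  have l2 : ∫⁻ t in Set.Ioi (0 : ℝ), (∫⁻ z in {z | t < ‖g z‖ ^ (s - 1)⁻¹}, ‖g z‖ₑ ^ 2) *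
      ENNReal.ofReal (t ^ (2 - s - 1)) =
      ENNReal.ofReal (2 - s)⁻¹ * ∫⁻ z, ‖g z‖ₑ ^ (s / (s - 1)) := by
    have := lintegral_mul_rpow_eq_layercake (h := fun z => ‖g z‖ₑ ^ 2) (hgm.enorm.pow_const 2)
      (f := fun z => ‖g z‖ ^ (s - 1)⁻¹) (hgm.norm.pow_const _) (fun z => by positivity) hq
    have e : ∀ z, ‖g z‖ₑ ^ 2 * ENNReal.ofReal ((‖g z‖ ^ (s - 1)⁻¹) ^ (2 - s)) =
        ‖g z‖ₑ ^ (s / (s - 1)) := by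
      intro z
      have hnn : 0 ≤ (s - 1)⁻¹ * (2 - s) := by positivity
      rw [← Real.rpow_mul (norm_nonneg _), ← ENNReal.ofReal_rpow_of_nonneg (norm_nonneg _) hnn,
        ofReal_norm, ← ENNReal.rpow_natCast, ← ENNReal.rpow_add_of_nonneg _ _ (by positivity) hnn]
      congr 1
      push_cast; field_simp; ring
    rw [lintegral_congr e] at this
    rw [this, ← mul_assoc, ← ENNReal.ofReal_mul (by positivity),
      inv_mul_cancel₀ hq.ne', ENNReal.ofReal_one, one_mul]
  have l3 : ∀ ν ∈ S, ∫⁻ z, ‖proj κ σ ν g z‖ₑ ^ 2 * localAvg σ K F ν z ^ (2 - s) =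
      ENNReal.ofReal (2 - s) * ∫⁻ t in Set.Ioi (0 : ℝ),
        (∫⁻ z in {z | t < (localAvg σ K F ν z).toReal}, ‖proj κ σ ν g z‖ₑ ^ 2) *
          ENNReal.ofReal (t ^ (2 - s - 1)) := by
    intro ν _
    rw [← lintegral_mul_rpow_eq_layercake ((h.continuous_proj σ ν hg).measurable.enorm.pow_const 2)
      (measurable_localAvg σ hF ν).ennreal_toReal (fun z => ENNReal.toReal_nonneg) hq]
    refine lintegral_congr fun z => ?_
    rw [← ENNReal.ofReal_rpow_of_nonneg ENNReal.toReal_nonneg hq.le,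
      ENNReal.ofReal_toReal (localAvg_ne_top σ hFb ν z)]
  rw [Finset.sum_congr rfl l3, ← Finset.mul_sum,
    ← lintegral_finsetSum _ fun ν _ => measurable_layer _ _ _]
  calc _ ≤ ENNReal.ofReal (2 - s) * ∫⁻ t in Set.Ioi (0 : ℝ),
        C * ((∫⁻ z in {z | t < (fullSum K F z).toReal * ε⁻¹}, fullSum K F z) *
            ENNReal.ofReal (t ^ (s - 1 - 1)) +
          (∫⁻ z in {z | t < ‖g z‖ ^ (s - 1)⁻¹}, ‖g z‖ₑ ^ 2) *
            ENNReal.ofReal (t ^ (2 - s - 1))) := by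
        refine mul_le_mul_right (setLIntegral_mono' measurableSet_Ioi fun t ht => ?_) _
        have ht : 0 < t := ht
        rw [← Finset.sum_mul]
        refine (mul_le_mul_left (hC Γ σ hΓ K F hF hFb S g hgm hg t ht) _).trans (le_of_eq ?_)
        have e : ENNReal.ofReal (t ^ (2 * s - 3)) * ENNReal.ofReal (t ^ (2 - s - 1)) =
            ENNReal.ofReal (t ^ (s - 1 - 1)) := by
          rw [← ENNReal.ofReal_mul (by positivity), ← Real.rpow_add ht]
          congr 2; ring
        rw [← e]; ring
    _ = _ := by
        rw [lintegral_const_mul' _ _ (by simp), lintegral_add_left (measurable_layer _ _ _), l1, l2]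
    _ ≤ _ := by
        set X := ∫⁻ z, fullSum K F z ^ s
        set Y := ∫⁻ z, ‖g z‖ₑ ^ (s / (s - 1))
        rw [hEdef]
        set p1 := ENNReal.ofReal (2 - s)
        set p2 := ENNReal.ofReal (s - 1)⁻¹ * ENNReal.ofReal (ε⁻¹ ^ (s - 1))
        set p3 := ENNReal.ofReal (2 - s)⁻¹
        calc p1 * (C * (p2 * X + p3 * Y))
            ≤ p1 * (C * (p2 * X + p3 * Y)) + p1 * (C * (p2 * Y + p3 * X)) := le_self_add
          _ = _ := by ring

end

/-! ### The square function estimate in the plane -/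

/-- Orthogonality in the first frequency alone: caps with nonadjacent indices are at least 1 apart.
The transfer principle with constant weight avoids any square-integrability assumption. -/
theorem exists_square_function_two (D : ℝ) :
    ∃ C : ℝ≥0, ∀ Γ : ℝ → ℝ, ∀ (K : Finset ℤ) (F : ℤ → ℝ × ℝ → ℂ),
      (∀ k ∈ K, HasSpectrum (capSet Γ D k) (F k)) →
        ∫⁻ z, ‖∑ k ∈ K, F k z‖ₑ ^ 2 ≤ C * ∫⁻ z, fullSum K F z := by
  obtain ⟨w, hw⟩ := exists_profile
  obtain ⟨C, hC⟩ := hw.exists_transfer 3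
  refine ⟨C, fun Γ K F hF => ?_⟩
  have hc : ∀ k ∈ K, Continuous (F k) := fun k hk => (hF k hk).continuous
  have key := hC 0 1 one_pos (fun z => ‖∑ k ∈ K, F k z‖ₑ ^ 2) (fullSum K F)
    ((continuous_finsetSum _ hc).measurable.enorm.pow_const 2) (measurable_fullSum hc) ?_
    (fun _ => 1) measurable_const fun z u => by
      simpa using ENNReal.ofReal_le_ofReal (one_le_growth (shear 0 1 1 (z - u)))
  · simpa using key
  intro z
  have hint := (hw.integrable_boxWeight one_pos 0).comp_sub_left z
  refine lintegral_sum_sq_mul_le hc (fun k hk => (hF k hk).bounded) hint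
    (fun u => hw.boxWeight_nonneg one_pos _ _) (fun k l => |k - l| ≤ 1)
    (fun k l h => by rwa [abs_sub_comm]) (fun k _ => ?_) ?_
  · calc _ ≤ (Finset.Icc (k - 1) (k + 1)).card := by
          refine Finset.card_le_card fun l hl => ?_
          have := abs_le.1 (Finset.mem_filter.1 hl).2
          rw [Finset.mem_Icc]; constructor <;> linarith
      _ = 3 := by rw [Int.card_Icc]; omega
  · intro k hk l hl hkl
    refine ((hF k hk).mul (hF l hl).star).integral_mul_eq_zero hint.ofReal ?_
    rintro ζ ⟨p, hp, q', hq, rfl⟩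
    obtain ⟨q, rfl⟩ : ∃ q, q' = -q := ⟨-q', by simp⟩
    simp only [Set.mem_ofPred_eq, neg_neg] at hq
    refine hw.integral_boxWeight_sub_mul_wave one_pos 0 (Or.inl ?_) z
    have f1 := Int.floor_le p.1
    have f2 := Int.lt_floor_add_one p.1
    have f3 := Int.floor_le q.1
    have f4 := Int.lt_floor_add_one q.1
    rw [hp.1] at f1 f2
    rw [hq.1] at f3 f4
    rw [Prod.fst_add, Prod.fst_neg, le_abs]
    rcases lt_abs.1 (not_le.1 hkl) with h | h
    · left
      have : (2 : ℝ) ≤ (k : ℝ) - l := by exact_mod_cast h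
      linarith
    · right
      have : (2 : ℝ) ≤ -((k : ℝ) - l) := by exact_mod_cast h
      linarith

/-- Weighted Cauchy–Schwarz in pointwise form. The weight b may vanish: if `s < 2`, then `b^{s-2}`
is infinite and the bound is trivial unless `x = 0`. -/
theorem mul_le_weighted_add {x y b M : ℝ≥0∞} (hM : M ≠ 0) (hM' : M ≠ ∞) (hb : b ≠ ∞) {s : ℝ}
    (hs : s ≤ 2) :
    x * y ≤ M * (x ^ 2 * b ^ (s - 2)) + M⁻¹ * (y ^ 2 * b ^ (2 - s)) := by
  rcases hs.eq_or_lt with rfl | hs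
  · simp only [sub_self, ENNReal.rpow_zero, mul_one]
    rcases le_total y (M * x) with h | h
    · exact (mul_le_mul_right h x).trans ((le_of_eq (by ring)).trans le_self_add)
    · refine le_trans ?_ le_add_self
      have : x ≤ M⁻¹ * y := by
        rw [mul_comm, ← div_eq_mul_inv, ENNReal.le_div_iff_mul_le (Or.inl hM) (Or.inl hM'), mul_comm]
        exact h
      exact (mul_le_mul_left this y).trans (le_of_eq (by ring))
  by_cases hb0 : b = 0
  · by_cases hx : x = 0
    · simp [hx]
    · rw [hb0, ENNReal.zero_rpow_of_neg (by linarith), ENNReal.mul_top (by simpa using hx),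
        ENNReal.mul_top hM]
      simp
  have hc0 : b ^ (2 - s) ≠ 0 := by
    rw [ne_eq, ENNReal.rpow_eq_zero_iff_of_pos (by linarith)]
    exact hb0
  have hct : b ^ (2 - s) ≠ ∞ := ENNReal.rpow_ne_top_of_nonneg (by linarith) hb
  have hinv : b ^ (s - 2) = (b ^ (2 - s))⁻¹ := by
    rw [← ENNReal.rpow_neg]; congr 1; ring
  rw [hinv]
  set e := b ^ (2 - s)
  rcases le_total (y * e) (M * x) with h | h
  · refine le_trans ?_ le_self_add
    have : y ≤ M * x * e⁻¹ := by
      rw [← div_eq_mul_inv, ENNReal.le_div_iff_mul_le (Or.inl hc0) (Or.inl hct)]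
      exact h
    exact (mul_le_mul_right this x).trans (le_of_eq (by ring))
  · refine le_trans ?_ le_add_self
    have : x ≤ M⁻¹ * (y * e) := by
      rw [mul_comm, ← div_eq_mul_inv, ENNReal.le_div_iff_mul_le (Or.inl hM) (Or.inl hM'), mul_comm]
      exact h
    exact (mul_le_mul_left this y).trans (le_of_eq (by ring))

/-- Young's inequality by cases at `w = 12 a`, where `12 = 3 · 4` gives the absorbable coefficient
`1/4`. -/
theorem three_mul_mul_rpow_le (a w : ℝ≥0∞) {s : ℝ} (hs : 1 < s) :
    3 * a * w ^ (s - 1) ≤ 3 * 12 ^ (s - 1) * a ^ s + 4⁻¹ * w ^ s := by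
  have hs0 : 0 < s - 1 := by linarith
  have hsplit : ∀ x : ℝ≥0∞, x ^ s = x * x ^ (s - 1) := fun x => by
    conv_rhs => rw [← ENNReal.rpow_one x, ← ENNReal.rpow_mul, one_mul]
    rw [← ENNReal.rpow_add_of_nonneg _ _ zero_le_one hs0.le]; congr 1; ring
  rw [hsplit a, hsplit w]
  rcases le_total w (12 * a) with h | h
  · refine le_trans ?_ le_self_add
    calc 3 * a * w ^ (s - 1) ≤ 3 * a * (12 * a) ^ (s - 1) := by gcongr
      _ = _ := by rw [ENNReal.mul_rpow_of_nonneg _ _ hs0.le]; ring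
  · refine le_trans ?_ le_add_self
    rw [← mul_assoc]
    refine mul_le_mul_left ?_ _
    rw [mul_comm 4⁻¹, ← div_eq_mul_inv, ENNReal.le_div_iff_mul_le (by simp) (by simp)]
    calc 3 * a * 4 = 12 * a := by ring
      _ ≤ w := h

theorem enorm_near_sum_le {K : Finset ℤ} (f : ℤ → ℂ) :
    ‖∑ P ∈ (K ×ˢ K).filter (fun P => |P.1 - P.2| ≤ 1), f P.1 * conj (f P.2)‖ₑ ≤
      3 * ∑ k ∈ K, ‖f k‖ₑ ^ 2 := by
  have hcard : ∀ k : ℤ, (K.filter fun l => |k - l| ≤ 1).card ≤ 3 := fun k => by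
    calc _ ≤ (Finset.Icc (k - 1) (k + 1)).card := by
          refine Finset.card_le_card fun l hl => ?_
          have := abs_le.1 (Finset.mem_filter.1 hl).2
          rw [Finset.mem_Icc]; constructor <;> linarith
      _ = 3 := by rw [Int.card_Icc]; omega
  have hreal : ‖∑ P ∈ (K ×ˢ K).filter (fun P => |P.1 - P.2| ≤ 1), f P.1 * conj (f P.2)‖ ≤
      3 * ∑ k ∈ K, ‖f k‖ ^ 2 := by
    calc _ ≤ ∑ P ∈ (K ×ˢ K).filter (fun P => |P.1 - P.2| ≤ 1), (‖f P.1‖ ^ 2 / 2 + ‖f P.2‖ ^ 2 / 2) := by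
          refine (norm_sum_le _ _).trans (Finset.sum_le_sum fun P _ => ?_)
          rw [norm_mul, RCLike.norm_conj]
          nlinarith [sq_nonneg (‖f P.1‖ - ‖f P.2‖)]
      _ = ∑ k ∈ K, ∑ l ∈ K, (if |k - l| ≤ 1 then ‖f k‖ ^ 2 / 2 else 0) +
          ∑ k ∈ K, ∑ l ∈ K, (if |k - l| ≤ 1 then ‖f k‖ ^ 2 / 2 else 0) := by
          have hsw : ∑ k ∈ K, ∑ l ∈ K, (if |k - l| ≤ 1 then ‖f l‖ ^ 2 / 2 else 0) =
              ∑ k ∈ K, ∑ l ∈ K, (if |k - l| ≤ 1 then ‖f k‖ ^ 2 / 2 else 0) := by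
            rw [Finset.sum_comm]
            simp only [abs_sub_comm]
          conv_rhs => arg 2; rw [← hsw]
          rw [Finset.sum_filter, Finset.sum_product, ← Finset.sum_add_distrib]
          refine Finset.sum_congr rfl fun k _ => ?_
          rw [← Finset.sum_add_distrib]
          refine Finset.sum_congr rfl fun l _ => ?_
          simp only
          split_ifs <;> simp
      _ ≤ ∑ k ∈ K, 3 * (‖f k‖ ^ 2 / 2) + ∑ k ∈ K, 3 * (‖f k‖ ^ 2 / 2) := by
          have : ∀ k ∈ K, ∑ l ∈ K, (if |k - l| ≤ 1 then ‖f k‖ ^ 2 / 2 else 0) ≤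
              3 * (‖f k‖ ^ 2 / 2) := fun k _ => by
            rw [← Finset.sum_filter, Finset.sum_const, nsmul_eq_mul]
            gcongr
            exact_mod_cast hcard k
          exact add_le_add (Finset.sum_le_sum this) (Finset.sum_le_sum this)
      _ = _ := by
          rw [← Finset.sum_add_distrib, Finset.mul_sum]
          exact Finset.sum_congr rfl fun k _ => by ring
  rw [← ofReal_norm]
  refine (ENNReal.ofReal_le_ofReal hreal).trans (le_of_eq ?_)
  rw [ENNReal.ofReal_mul (by norm_num), ENNReal.ofReal_sum_of_nonneg fun _ _ => by positivity]
  simp only [ENNReal.ofReal_pow (norm_nonneg _), ofReal_norm]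
  simp

/-- The duality step: the `L^{2s}` norm over a bounded set is absorbed. -/
theorem exists_square_function_on_ball (c L D : ℝ) (hD : 0 ≤ D) {s : ℝ} (hs1 : 1 < s)
    (hs2 : s ≤ 2) :
    ∃ C : ℝ≥0, ∀ Γ σ : ℝ → ℝ, ConvexCurve c L Γ σ → ∀ (K : Finset ℤ) (F : ℤ → ℝ × ℝ → ℂ),
      (∀ k ∈ K, HasSpectrum (capSet Γ D k) (F k)) → ∀ r : ℝ,
        ∫⁻ z in Metric.closedBall 0 r, (‖∑ k ∈ K, F k z‖ₑ ^ 2) ^ s ≤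
          C * ∫⁻ z, fullSum K F z ^ s := by
  by_cases hL : 0 < L
  swap
  · exact ⟨0, fun Γ σ hΓ => absurd hΓ.pos' hL⟩
  obtain ⟨κ, m, h⟩ := exists_projector (Λ := 4 * L + 2 * D) (by linarith)
  obtain ⟨C₁, h1⟩ := exists_sum_bilin_weighted c L D hD hs1 hs2
  obtain ⟨C₂, h2⟩ := h.exists_weighted_square c L hs1 hs2
  -- This makes `C₂ / M ≤ 1/4`; together with the `1/4` from the near-diagonal part, half of the
  -- left side is absorbed.
  set M : ℝ≥0 := 4 * C₂ + 1 with hM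
  have hM0 : (M : ℝ≥0∞) ≠ 0 := by rw [hM]; simp
  set E : ℝ≥0∞ := 2 * (3 * 12 ^ (s - 1) + M * C₁ + 4⁻¹) with hE
  have hEt : E ≠ ∞ := by
    refine ENNReal.mul_ne_top (by simp) (ENNReal.add_ne_top.2 ⟨ENNReal.add_ne_top.2 ⟨?_, ?_⟩, by simp⟩)
    · exact ENNReal.mul_ne_top (by simp) (ENNReal.rpow_ne_top_of_nonneg (by linarith) (by simp))
    · exact ENNReal.mul_ne_top (by simp) (by simp)
  refine ⟨E.toNNReal, fun Γ σ hΓ K F hF r => ?_⟩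
  rw [ENNReal.coe_toNNReal hEt]
  have hs0 : 0 < s - 1 := by linarith
  set H : ℝ × ℝ → ℂ := fun z => ∑ k ∈ K, F k z with hH
  have hFc : ∀ k ∈ K, Continuous (F k) := fun k hk => (hF k hk).continuous
  have hHc : Continuous H := continuous_finsetSum _ hFc
  set U : Set (ℝ × ℝ) := Metric.closedBall 0 r with hU
  have hUc : IsCompact U := isCompact_closedBall _ _
  have hUm : MeasurableSet U := hUc.isClosed.measurableSet
  set g : ℝ × ℝ → ℂ := U.indicator fun z => ((‖H z‖ ^ (2 * (s - 1)) : ℝ) : ℂ) with hg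
  have hpc : Continuous fun z => ((‖H z‖ ^ (2 * (s - 1)) : ℝ) : ℂ) :=
    continuous_ofReal.comp (hHc.norm.rpow_const fun _ => Or.inr (by positivity))
  have hgm : Measurable g := hpc.measurable.indicator hUm
  have hgi : Integrable g :=
    (integrable_indicator_iff hUm).2 (hpc.continuousOn.integrableOn_compact hUc)
  set w : ℝ × ℝ → ℝ≥0∞ := fun z => ‖H z‖ₑ ^ 2 with hw
  have hwm : Measurable w := hHc.measurable.enorm.pow_const 2
  have hrp : ∀ (z : ℝ × ℝ) (q : ℝ), 0 ≤ q → ENNReal.ofReal (‖H z‖ ^ (2 * q)) = w z ^ q := by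
    intro z q hq
    rw [← ENNReal.ofReal_rpow_of_nonneg (norm_nonneg _) (by positivity), ofReal_norm,
      ENNReal.rpow_mul]
    norm_num [hw]
  have hge : ∀ z, ‖g z‖ₑ = U.indicator (fun z => w z ^ (s - 1)) z := by
    intro z
    by_cases hz : z ∈ U
    · rw [hg, Set.indicator_of_mem hz, Set.indicator_of_mem hz, ← ofReal_norm, norm_real,
        Real.norm_of_nonneg (by positivity), hrp _ _ hs0.le]
    · rw [hg, Set.indicator_of_notMem hz, Set.indicator_of_notMem hz]; simp
  set J := ∫⁻ z in U, w z ^ s with hJ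
  have hJi : IntegrableOn (fun z => ‖H z‖ ^ (2 * s)) U :=
    (hHc.norm.rpow_const fun _ => Or.inr (by linarith)).continuousOn.integrableOn_compact hUc
  have hJr : J = ENNReal.ofReal (∫ z in U, ‖H z‖ ^ (2 * s)) := by
    rw [ofReal_integral_eq_lintegral_ofReal hJi (.of_forall fun z => by positivity)]
    exact lintegral_congr fun z => (hrp z s (by linarith)).symm
  -- Finiteness legitimises the absorption and is the reason for working on a ball.
  have hJt : J ≠ ∞ := by rw [hJr]; exact ENNReal.ofReal_ne_top
  have hJg : ∫⁻ z, ‖g z‖ₑ ^ (s / (s - 1)) = J := by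
    rw [hJ, ← lintegral_indicator hUm]
    refine lintegral_congr fun z => ?_
    rw [hge]
    by_cases hz : z ∈ U
    · rw [Set.indicator_of_mem hz, Set.indicator_of_mem hz, ← ENNReal.rpow_mul]
      congr 1; field_simp
    · rw [Set.indicator_of_notMem hz, Set.indicator_of_notMem hz, ENNReal.zero_rpow_of_pos]
      positivity
  set near : ℝ × ℝ → ℂ := fun z =>
    ∑ P ∈ (K ×ˢ K).filter (fun P => |P.1 - P.2| ≤ 1), F P.1 z * conj (F P.2 z) with hnear
  have hwhit : ∀ z, H z * conj (H z) = near z + ∑ ν ∈ nodes K, bilin K F ν z := by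
    intro z
    rw [hH]; simp only
    rw [map_sum, Finset.sum_mul_sum, ← Finset.sum_product',
      sum_product_eq_whitney (fun P => F P.1 z * conj (F P.2 z))]
    rfl
  have hbdF : ∀ k ∈ K, ∃ B, ∀ z, ‖F k z‖ ≤ B := fun k hk => (hF k hk).bounded
  have hbd : ∀ T : Finset (ℤ × ℤ), T ⊆ K ×ˢ K →
      Integrable fun z => (∑ P ∈ T, F P.1 z * conj (F P.2 z)) * g z := by
    intro T hT
    have hmem : ∀ P ∈ T, P.1 ∈ K ∧ P.2 ∈ K := fun P hP => Finset.mem_product.1 (hT hP)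
    choose! B hB using hbdF
    refine hgi.bdd_mul (c := ∑ P ∈ T, B P.1 * B P.2)
      (continuous_finsetSum _ fun P hP => (hFc _ (hmem P hP).1).mul
        (continuous_conj.comp (hFc _ (hmem P hP).2))).aestronglyMeasurable (.of_forall fun z => ?_)
    refine (norm_sum_le _ _).trans (Finset.sum_le_sum fun P hP => ?_)
    rw [norm_mul, RCLike.norm_conj]
    exact mul_le_mul (hB _ (hmem P hP).1 z) (hB _ (hmem P hP).2 z) (norm_nonneg _)
      ((norm_nonneg _).trans (hB _ (hmem P hP).1 z))
  have hdual : J = ‖(∫ z, near z * g z) +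
      ∑ ν ∈ nodes K, ∫ z, bilin K F ν z * proj κ σ ν g z‖ₑ := by
    have e1 : ((∫ z in U, ‖H z‖ ^ (2 * s) : ℝ) : ℂ) = ∫ z, (H z * conj (H z)) * g z := by
      rw [← integral_complex_ofReal, ← integral_indicator hUm]
      refine integral_congr_ae (.of_forall fun z => ?_)
      simp only
      by_cases hz : z ∈ U
      · rw [hg, Set.indicator_of_mem hz, Set.indicator_of_mem hz, mul_conj, ← ofReal_mul,
          normSq_eq_norm_sq]
        congr 1
        rcases (norm_nonneg (H z)).eq_or_lt with h0 | h0
        · rw [← h0, Real.zero_rpow (by positivity)]; simp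
        · rw [← Real.rpow_natCast, ← Real.rpow_add h0]
          congr 1; push_cast; ring
      · rw [hg, Set.indicator_of_notMem hz, Set.indicator_of_notMem hz, mul_zero]
    have e2 : ∫ z, (H z * conj (H z)) * g z =
        (∫ z, near z * g z) + ∑ ν ∈ nodes K, ∫ z, bilin K F ν z * g z := by
      simp_rw [hwhit, add_mul, Finset.sum_mul]
      have i1 : Integrable fun z => near z * g z := hbd _ (Finset.filter_subset _ _)
      have i2 : ∀ ν ∈ nodes K, Integrable fun z => bilin K F ν z * g z := fun ν _ =>
        hbd _ (Finset.filter_subset _ _)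
      rw [integral_add i1 (integrable_finsetSum _ i2), integral_finsetSum _ i2]
    have e3 : ENNReal.ofReal (∫ z in U, ‖H z‖ ^ (2 * s)) =
        ‖((∫ z in U, ‖H z‖ ^ (2 * s) : ℝ) : ℂ)‖ₑ := by
      rw [← ofReal_norm, norm_real, Real.norm_of_nonneg]
      exact integral_nonneg fun z => by positivity
    rw [hJr, e3, e1, e2]
    congr 2
    exact Finset.sum_congr rfl fun ν hν =>
      integral_bilin_mul_eq hΓ hD h le_rfl hF (one_le_of_mem_nodes hν) hgi
  have hnearb : ‖∫ z, near z * g z‖ₑ ≤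
      3 * 12 ^ (s - 1) * (∫⁻ z, fullSum K F z ^ s) + 4⁻¹ * J := by
    calc _ ≤ ∫⁻ z, ‖near z * g z‖ₑ := enorm_integral_le_lintegral_enorm _
      _ ≤ ∫⁻ z, (3 * 12 ^ (s - 1) * fullSum K F z ^ s + 4⁻¹ * U.indicator (fun z => w z ^ s) z) := by
          refine lintegral_mono fun z => ?_
          rw [enorm_mul, hge]
          by_cases hz : z ∈ U
          · rw [Set.indicator_of_mem hz, Set.indicator_of_mem hz]
            exact (mul_le_mul_left (enorm_near_sum_le fun k => F k z) _).trans
              (three_mul_mul_rpow_le _ _ hs1)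
          · rw [Set.indicator_of_notMem hz, mul_zero]; exact zero_le
      _ = _ := by
          rw [lintegral_add_right _ (((hwm.pow_const s).indicator hUm).const_mul _),
            lintegral_const_mul' _ _ (by
              exact ENNReal.mul_ne_top (by simp)
                (ENNReal.rpow_ne_top_of_nonneg hs0.le (by simp))),
            lintegral_const_mul' _ _ (by simp), lintegral_indicator hUm]
  have hfarb : ‖∑ ν ∈ nodes K, ∫ z, bilin K F ν z * proj κ σ ν g z‖ₑ ≤
      M * (C₁ * ∫⁻ z, fullSum K F z ^ s) +
        (M : ℝ≥0∞)⁻¹ * (C₂ * ((∫⁻ z, fullSum K F z ^ s) + J)) := by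
    have hb2 : ∀ ν, Measurable fun z => ‖proj κ σ ν g z‖ₑ ^ 2 * localAvg σ K F ν z ^ (2 - s) :=
      fun ν => ((h.continuous_proj σ ν hgi).measurable.enorm.pow_const 2).mul
        ((measurable_localAvg σ hFc ν).pow_const _)
    calc _ ≤ ∑ ν ∈ nodes K, ∫⁻ z, ‖bilin K F ν z‖ₑ * ‖proj κ σ ν g z‖ₑ := by
          refine (enorm_sum_le _ _).trans (Finset.sum_le_sum fun ν _ => ?_)
          refine (enorm_integral_le_lintegral_enorm _).trans (le_of_eq ?_)
          exact lintegral_congr fun z => enorm_mul _ _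
      _ ≤ ∑ ν ∈ nodes K, (M * (∫⁻ z, ‖bilin K F ν z‖ₑ ^ 2 * localAvg σ K F ν z ^ (s - 2)) +
            (M : ℝ≥0∞)⁻¹ * ∫⁻ z, ‖proj κ σ ν g z‖ₑ ^ 2 * localAvg σ K F ν z ^ (2 - s)) := by
          refine Finset.sum_le_sum fun ν _ => ?_
          rw [← lintegral_const_mul' _ _ (by simp),
            ← lintegral_const_mul' _ _ (ENNReal.inv_ne_top.2 hM0),
            ← lintegral_add_right _ ((hb2 ν).const_mul _)]
          exact lintegral_mono fun z =>
            mul_le_weighted_add hM0 (by simp) (localAvg_ne_top σ hbdF ν z) hs2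
      _ ≤ _ := by
          rw [Finset.sum_add_distrib, ← Finset.mul_sum, ← Finset.mul_sum]
          refine add_le_add (mul_le_mul_right (h1 Γ σ hΓ K F hF) _) (mul_le_mul_right ?_ _)
          have := h2 Γ σ hΓ K F hFc hbdF (nodes K) g hgm hgi
          rwa [hJg] at this
  set A := ∫⁻ z, fullSum K F z ^ s with hA
  have hMC : (M : ℝ≥0∞)⁻¹ * C₂ ≤ 4⁻¹ := by
    rw [mul_comm, ← div_eq_mul_inv, ENNReal.div_le_iff hM0 (by simp), hM]
    push_cast
    rw [mul_add, ← mul_assoc, ENNReal.inv_mul_cancel (by simp) (by simp), one_mul]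
    exact le_self_add
  have htot : J ≤ (3 * 12 ^ (s - 1) + M * C₁ + 4⁻¹) * A + 2⁻¹ * J := by
    have h42 : (4⁻¹ : ℝ≥0∞) + 4⁻¹ = 2⁻¹ := by
      rw [← two_mul, show (4 : ℝ≥0∞) = 2 * 2 by norm_num,
        ENNReal.mul_inv (by simp) (by simp), ← mul_assoc, ENNReal.mul_inv_cancel (by simp) (by simp),
        one_mul]
    calc J ≤ (3 * 12 ^ (s - 1) * A + 4⁻¹ * J) + (M * (C₁ * A) + (M : ℝ≥0∞)⁻¹ * (C₂ * (A + J))) := by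
          conv_lhs => rw [hdual]
          exact (enorm_add_le _ _).trans (add_le_add hnearb hfarb)
      _ ≤ (3 * 12 ^ (s - 1) * A + 4⁻¹ * J) + (M * (C₁ * A) + 4⁻¹ * (A + J)) := by
          rw [← mul_assoc (M : ℝ≥0∞)⁻¹]
          gcongr
      _ = (3 * 12 ^ (s - 1) + M * C₁ + 4⁻¹) * A + (4⁻¹ + 4⁻¹) * J := by ring
      _ = _ := by rw [h42]
  set X := (3 * 12 ^ (s - 1) + M * C₁ + 4⁻¹) * A
  have hhalf : 2⁻¹ * J ≤ X := by
    have h2J : J = 2⁻¹ * J + 2⁻¹ * J := by rw [← add_mul, ENNReal.inv_two_add_inv_two, one_mul]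
    conv at htot => lhs; rw [h2J]
    exact (ENNReal.add_le_add_iff_right (ENNReal.mul_ne_top (by simp) hJt)).1 htot
  calc J = 2 * (2⁻¹ * J) := by rw [← mul_assoc, ENNReal.mul_inv_cancel (by simp) (by simp), one_mul]
    _ ≤ 2 * X := mul_le_mul_right hhalf _
    _ = E * A := by rw [hE, mul_assoc]

/-- The square function estimate for a convex curve in the plane. -/
theorem exists_plane_square_function (c L D : ℝ) (hD : 0 ≤ D) {s : ℝ} (hs1 : 1 ≤ s) (hs2 : s ≤ 2) :
    ∃ C : ℝ≥0, ∀ Γ σ : ℝ → ℝ, ConvexCurve c L Γ σ → ∀ (K : Finset ℤ) (F : ℤ → ℝ × ℝ → ℂ),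
      (∀ k ∈ K, HasSpectrum (capSet Γ D k) (F k)) →
        ∫⁻ z, (‖∑ k ∈ K, F k z‖ₑ ^ 2) ^ s ≤ C * ∫⁻ z, fullSum K F z ^ s := by
  rcases hs1.eq_or_lt with rfl | hs1
  · obtain ⟨C, hC⟩ := exists_square_function_two D
    refine ⟨C, fun Γ σ _ K F hF => ?_⟩
    simpa using hC Γ K F hF
  · obtain ⟨C, hC⟩ := exists_square_function_on_ball c L D hD hs1 hs2
    refine ⟨C, fun Γ σ hΓ K F hF => ?_⟩
    have hHm : Measurable fun z => (‖∑ k ∈ K, F k z‖ₑ ^ 2) ^ s :=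
      ((continuous_finsetSum _ fun k hk => (hF k hk).continuous).measurable.enorm.pow_const 2).pow_const s
    have hcov := aecover_closedBall (μ := (volume : Measure (ℝ × ℝ))) (x := 0)
      (tendsto_natCast_atTop_atTop (R := ℝ))
    exact le_of_tendsto' (hcov.lintegral_tendsto_of_nat hHm.aemeasurable)
      fun n => hC Γ σ hΓ K F hF n

/-! ### The model curve -/

/-- A globally defined increasing function with slope between `12` and `48`, equal to `4 t ^ 3` on
`[1, 2]`. -/
noncomputable def modelSlope (t : ℝ) : ℝ :=
  4 * (max 1 (min t 2)) ^ 3 + 48 * max (t - 2) 0 + 12 * min (t - 1) 0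

/-- A globally defined convex function extending `t ^ 4` from `[1, 2]`. -/
noncomputable def modelCurve (t : ℝ) : ℝ := 1 + ∫ u in (1 : ℝ)..t, modelSlope u

theorem continuous_modelSlope : Continuous modelSlope := by unfold modelSlope; fun_prop

theorem modelSlope_of_mem {t : ℝ} (ht : t ∈ Set.Icc (1 : ℝ) 2) : modelSlope t = 4 * t ^ 3 := by
  obtain ⟨h1, h2⟩ := ht
  rw [modelSlope, min_eq_left h2, max_eq_right h1, max_eq_right (by linarith),
    min_eq_right (by linarith)]
  ring

theorem modelCurve_of_mem {t : ℝ} (ht : t ∈ Set.Icc (1 : ℝ) 2) : modelCurve t = t ^ 4 := by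
  have h : ∫ u in (1 : ℝ)..t, modelSlope u = ∫ u in (1 : ℝ)..t, 4 * u ^ 3 := by
    refine intervalIntegral.integral_congr fun u hu => modelSlope_of_mem ?_
    rw [Set.uIcc_of_le ht.1] at hu
    exact ⟨hu.1, hu.2.trans ht.2⟩
  rw [modelCurve, h, intervalIntegral.integral_const_mul, integral_pow]
  norm_num
  ring

/-- The bounds are those of `12 t²` on `[1, 2]`, continued by the boundary values. A global curve is
needed since slabs protrude slightly beyond the arc and planar arguments use points off it. -/
theorem convexCurve_model : ConvexCurve 12 48 modelCurve modelSlope := by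
  have key : ∀ t t' : ℝ, t' ≤ t → 12 * (t - t') ≤ modelSlope t - modelSlope t' ∧
      modelSlope t - modelSlope t' ≤ 48 * (t - t') := by
    intro t t' h
    have hdec : ∀ x : ℝ, x = max 1 (min x 2) + max (x - 2) 0 + min (x - 1) 0 := by
      intro x
      rcases le_total x 1 with h1 | h1
      · rw [min_eq_left (by linarith), max_eq_left h1, max_eq_right (by linarith),
          min_eq_left (by linarith)]; ring
      rcases le_total x 2 with h2 | h2
      · rw [min_eq_left h2, max_eq_right h1, max_eq_right (by linarith),
          min_eq_right (by linarith)]; ring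
      · rw [min_eq_right h2, max_eq_right (by norm_num), max_eq_left (by linarith),
          min_eq_right (by linarith)]; ring
    have e := hdec t
    have e' := hdec t'
    have m1 : max 1 (min t' 2) ≤ max 1 (min t 2) := max_le_max le_rfl (min_le_min h le_rfl)
    have m2 : max (t' - 2) 0 ≤ max (t - 2) 0 := max_le_max (by linarith) le_rfl
    have m3 : min (t' - 1) 0 ≤ min (t - 1) 0 := min_le_min (by linarith) le_rfl
    have b1 : 1 ≤ max 1 (min t' 2) := le_max_left _ _
    have b2 : max 1 (min t 2) ≤ 2 := max_le (by norm_num) (min_le_right _ _)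
    unfold modelSlope
    set c := max 1 (min t 2)
    set c' := max 1 (min t' 2)
    set p := max (t - 2) 0
    set p' := max (t' - 2) 0
    set q := min (t - 1) 0
    set q' := min (t' - 1) 0
    have hc : c ^ 3 - c' ^ 3 = (c - c') * (c ^ 2 + c * c' + c' ^ 2) := by ring
    have l1 : 3 ≤ c ^ 2 + c * c' + c' ^ 2 := by nlinarith
    have l2 : c ^ 2 + c * c' + c' ^ 2 ≤ 12 := by nlinarith
    have l3 : (c - c') * 3 ≤ c ^ 3 - c' ^ 3 := by
      rw [hc]; exact mul_le_mul_of_nonneg_left l1 (by linarith)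
    have l4 : c ^ 3 - c' ^ 3 ≤ (c - c') * 12 := by
      rw [hc]; exact mul_le_mul_of_nonneg_left l2 (by linarith)
    constructor <;> linarith
  refine ⟨by norm_num, fun t => ?_, fun t t' h => (key t t' h).1, fun t t' h => (key t t' h).2⟩
  exact ((continuous_modelSlope.integral_hasStrictDerivAt 1 t).hasDerivAt).const_add 1

/-- Parabolic rescaling preserves the class of convex curves. -/
theorem ConvexCurve.rescale {c L : ℝ} {Γ σ : ℝ → ℝ} (h : ConvexCurve c L Γ σ) {q : ℝ} (hq : 0 < q)
    (α : ℝ) :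
    ConvexCurve c L (fun t => (q ^ 2)⁻¹ * Γ (α + q * t)) fun t => q⁻¹ * σ (α + q * t) := by
  refine ⟨h.pos, fun t => ?_, fun t t' ht => ?_, fun t t' ht => ?_⟩
  · have h1 : HasDerivAt (fun t => α + q * t) q t := by
      simpa using ((hasDerivAt_id t).const_mul q).const_add α
    have h2 := ((h.hasDerivAt (α + q * t)).comp t h1).const_mul (q ^ 2)⁻¹
    refine h2.congr_deriv ?_
    field_simp
  · have h1 := h.lower (α + q * t) (α + q * t') (by nlinarith)
    rw [← mul_sub, ← div_eq_inv_mul, le_div_iff₀ hq]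
    calc c * (t - t') * q = c * (α + q * t - (α + q * t')) := by ring
      _ ≤ _ := h1
  · have h1 := h.upper (α + q * t) (α + q * t') (by nlinarith)
    rw [← mul_sub, ← div_eq_inv_mul, div_le_iff₀ hq]
    calc _ ≤ L * (α + q * t - (α + q * t')) := h1
      _ = _ := by ring

/-! ### From slabs of the surface to caps of a planar curve -/

theorem isCompact_surfacePiece (R lam : ℝ) : IsCompact (surfacePiece R lam) := by
  have hc : Continuous fun p : ℝ × ℝ => (!₂[p.1, p.2, p.1 ^ 4 + p.2 ^ 4] : EuclideanSpace ℝ (Fin 3)) := by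
    refine (PiLp.continuous_toLp 2 _).comp (continuous_pi fun i => ?_)
    fin_cases i
    · exact continuous_fst
    · exact continuous_snd
    · exact (continuous_fst.pow 4).add (continuous_snd.pow 4)
  have := ((isCompact_Icc (a := lam) (b := 2 * lam)).prod
    (isCompact_Icc (a := (0 : ℝ)) (b := R ^ (-(1 / 4) : ℝ)))).image hc
  convert this using 1
  ext ξ
  simp only [surfacePiece, Set.mem_ofPred_eq, Set.mem_image, Set.mem_prod, Prod.exists]
  constructor
  · rintro ⟨h0, h1, h2⟩
    refine ⟨ξ 0, ξ 1, ⟨h0, h1⟩, ?_⟩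
    ext i
    fin_cases i
    · rfl
    · rfl
    · exact h2.symm
  · rintro ⟨x, y, ⟨hx, hy⟩, rfl⟩
    exact ⟨hx, hy, rfl⟩

/-- Here the surface becomes a curve: the second coordinate is at most `R^{-1/4}`, so its fourth
power only doubles the thickness. -/
theorem exists_near_of_mem_surfaceNhd {R lam : ℝ} (hR : 1 ≤ R) {ξ : EuclideanSpace ℝ (Fin 3)}
    (hξ : ξ ∈ surfaceNhd R lam) :
    ∃ x ∈ Set.Icc lam (2 * lam), |ξ 0 - x| ≤ R⁻¹ ∧ |ξ 2 - x ^ 4| ≤ 2 * R⁻¹ := by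
  have hR0 : 0 < R := by linarith
  rw [surfaceNhd, (isCompact_surfacePiece R lam).cthickening_eq_biUnion_closedBall (by positivity)]
    at hξ
  obtain ⟨η, ⟨h0, h1, h2⟩, hd⟩ := Set.mem_iUnion₂.1 hξ
  rw [Metric.mem_closedBall, dist_eq_norm] at hd
  have hi : ∀ i, |ξ i - η i| ≤ R⁻¹ := fun i => (PiLp.norm_apply_le (ξ - η) i).trans hd
  refine ⟨η 0, h0, hi 0, ?_⟩
  have hη1 : 0 ≤ η 1 ^ 4 ∧ η 1 ^ 4 ≤ R⁻¹ := by
    refine ⟨by positivity, (pow_le_pow_left₀ h1.1 h1.2 4).trans (le_of_eq ?_)⟩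
    rw [← Real.rpow_natCast, ← Real.rpow_mul hR0.le, ← Real.rpow_neg_one]
    norm_num
  have h3 := abs_le.1 (hi 2)
  rw [h2] at h3
  rw [abs_le]
  constructor <;> linarith [hη1.1, hη1.2]

/-- The ratio between the width of a slab and the distance to the origin. -/
noncomputable def relWidth (R lam : ℝ) : ℝ := slabWidth R lam / lam

/-- The rescaled curve. -/
noncomputable def rescaledCurve (R lam a : ℝ) (t : ℝ) : ℝ :=
  (relWidth R lam ^ 2)⁻¹ * modelCurve (a / lam + relWidth R lam * t)

theorem slabWidth_pos {R lam : ℝ} (hR : 1 ≤ R) (hlam : 0 < lam) : 0 < slabWidth R lam :=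
  mul_pos (inv_pos.2 hlam) (Real.rpow_pos_of_pos (by linarith) _)

theorem relWidth_pos {R lam : ℝ} (hR : 1 ≤ R) (hlam : 0 < lam) : 0 < relWidth R lam :=
  div_pos (slabWidth_pos hR hlam) hlam

theorem inv_relWidth_sq {R lam : ℝ} (hR : 1 ≤ R) (hlam : 0 < lam) :
    (relWidth R lam ^ 2)⁻¹ = R * lam ^ 4 := by
  have hR0 : 0 < R := by linarith
  have h1 : (R ^ (-(1 / 2) : ℝ)) ^ 2 = R⁻¹ := by
    rw [← Real.rpow_natCast, ← Real.rpow_mul hR0.le, ← Real.rpow_neg_one]; norm_num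
  have h2 : relWidth R lam ^ 2 = R⁻¹ * (lam ^ 4)⁻¹ := by
    rw [← h1, relWidth, slabWidth]; field_simp
  rw [h2, mul_inv, inv_inv, inv_inv]

/-- The height `18 = 2 + 16`: the neighbourhood contributes 2 after scaling by R, and moving the
base point by `R⁻¹` along the curve contributes `32 lam³ + 48 lam² ≤ 16`, since `lam ≤ 1/2`. -/
theorem mem_capSet_of_mem_slab {R lam a : ℝ} (hR : 1 ≤ R) (hlam : 0 < lam) (hlam' : lam ≤ 1 / 2)
    {k : ℤ} {ξ : EuclideanSpace ℝ (Fin 3)} (hξ : ξ ∈ slab R lam a k) :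
    ((ξ 0 - a) / slabWidth R lam, R * ξ 2) ∈ capSet (rescaledCurve R lam a) 18 k := by
  obtain ⟨hN, hk1, hk2⟩ := hξ
  have hR0 : 0 < R := by linarith
  have hΔ := slabWidth_pos hR hlam
  refine ⟨?_, ?_⟩
  · rw [Int.floor_eq_iff, le_div_iff₀ hΔ, div_lt_iff₀ hΔ]
    constructor <;> linarith
  · obtain ⟨x, hx, h0, h2⟩ := exists_near_of_mem_surfaceNhd hR hN
    have hrc : rescaledCurve R lam a ((ξ 0 - a) / slabWidth R lam) =
        R * lam ^ 4 * modelCurve (ξ 0 / lam) := by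
      rw [rescaledCurve, inv_relWidth_sq hR hlam]
      congr 2
      rw [relWidth]; field_simp; ring
    have hx' : x / lam ∈ Set.Icc (1 : ℝ) 2 := by
      constructor
      · rw [le_div_iff₀ hlam]; linarith [hx.1]
      · rw [div_le_iff₀ hlam]; exact hx.2
    set τ := ξ 0 / lam with hτ
    set τ₀ := x / lam with hτ₀
    have hmc : modelCurve τ₀ = τ₀ ^ 4 := modelCurve_of_mem hx'
    have hms : modelSlope τ₀ = 4 * τ₀ ^ 3 := modelSlope_of_mem hx'
    have hd : |τ - τ₀| ≤ R⁻¹ * lam⁻¹ := by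
      rw [hτ, hτ₀, ← sub_div, abs_div, abs_of_pos hlam, div_eq_mul_inv]
      gcongr
    have ht := convexCurve_model.abs_tilt_le (t := τ₀) (p := τ) (q := τ₀) (R := |τ - τ₀|) le_rfl
      (by simp)
    rw [hms] at ht
    have hRi : R⁻¹ ≤ 1 := inv_le_one_of_one_le₀ hR
    have hτ3 : 4 * τ₀ ^ 3 ≤ 32 := by
      have : τ₀ ^ 3 ≤ 2 ^ 3 := pow_le_pow_left₀ (by linarith [hx'.1]) hx'.2 3
      linarith
    have hτ30 : 0 ≤ 4 * τ₀ ^ 3 := by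
      have : 0 ≤ τ₀ := by linarith [hx'.1]
      positivity
    have hgd : |modelCurve τ - modelCurve τ₀| ≤ (32 + 48 * lam⁻¹) * (R⁻¹ * lam⁻¹) := by
      have h48 : |τ - τ₀| ≤ lam⁻¹ := hd.trans (by
        have : 0 < lam⁻¹ := inv_pos.2 hlam
        nlinarith)
      calc |modelCurve τ - modelCurve τ₀|
          = |(modelCurve τ - modelCurve τ₀ - 4 * τ₀ ^ 3 * (τ - τ₀)) + 4 * τ₀ ^ 3 * (τ - τ₀)| := by
            congr 1; ring
        _ ≤ 48 * |τ - τ₀| * |τ - τ₀| + 32 * |τ - τ₀| := by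
            refine (abs_add_le _ _).trans (add_le_add ht ?_)
            rw [abs_mul, abs_of_nonneg hτ30]
            gcongr
        _ = (32 + 48 * |τ - τ₀|) * |τ - τ₀| := by ring
        _ ≤ _ := by gcongr
    rw [hrc]
    have e : R * ξ 2 - R * lam ^ 4 * modelCurve τ =
        R * (ξ 2 - x ^ 4) - R * lam ^ 4 * (modelCurve τ - modelCurve τ₀) := by
      rw [hmc, hτ₀]; field_simp; ring
    rw [e]
    have f1 : |R * (ξ 2 - x ^ 4)| ≤ 2 := by
      rw [abs_mul, abs_of_pos hR0]
      calc R * |ξ 2 - x ^ 4| ≤ R * (2 * R⁻¹) := by gcongr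
        _ = 2 := by field_simp
    have f2 : |R * lam ^ 4 * (modelCurve τ - modelCurve τ₀)| ≤ 16 := by
      rw [abs_mul, abs_of_pos (by positivity)]
      calc R * lam ^ 4 * |modelCurve τ - modelCurve τ₀|
          ≤ R * lam ^ 4 * ((32 + 48 * lam⁻¹) * (R⁻¹ * lam⁻¹)) := by gcongr
        _ = 32 * lam ^ 3 + 48 * lam ^ 2 := by field_simp
        _ ≤ 32 * (1 / 2) ^ 3 + 48 * (1 / 2) ^ 2 := by gcongr
        _ = 16 := by norm_num
    refine (abs_sub _ _).trans ?_
    linarith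

/-! ### Slices -/

theorem fourierInv_eq_integral_ee (h : EuclideanSpace ℝ (Fin 3) → ℂ) (x : EuclideanSpace ℝ (Fin 3)) :
    𝓕⁻ h x = ∫ ξ, h ξ * ee (x 0 * ξ 0 + x 1 * ξ 1 + x 2 * ξ 2) := by
  rw [Real.fourierInv_eq]
  refine integral_congr_ae (.of_forall fun ξ => ?_)
  simp only
  rw [fourierChar_smul, PiLp.inner_apply, Fin.sum_univ_three]
  simp

theorem continuous_fourierInv_three {h : EuclideanSpace ℝ (Fin 3) → ℂ} (hh : Integrable h) :
    Continuous (𝓕⁻ h) := by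
  rw [show 𝓕⁻ h = _ from funext (fourierInv_eq_integral_ee h)]
  refine continuous_of_dominated (bound := fun ξ => ‖h ξ‖) (fun x => ?_) (fun x => ?_) hh.norm ?_
  · refine hh.aestronglyMeasurable.mul (Continuous.aestronglyMeasurable ?_)
    fun_prop
  · exact .of_forall fun ξ => by simp
  · exact .of_forall fun ξ => by fun_prop

theorem lintegral_eq_lintegral_slices {f : EuclideanSpace ℝ (Fin 3) → ℝ≥0∞} (hf : Measurable f) :
    ∫⁻ x, f x = ∫⁻ y : ℝ, ∫⁻ z : ℝ × ℝ, f !₂[z.1, y, z.2] := by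
  have h1 := (PiLp.volume_preserving_toLp (Fin 3)).lintegral_comp hf
  have h2 := (volume_preserving_piFinSuccAbove (fun _ : Fin 3 => ℝ) 1).symm
    |>.lintegral_comp_emb (MeasurableEquiv.measurableEmbedding _) (fun v => f (WithLp.toLp 2 v))
  rw [← h1, ← h2]
  have hm : Measurable fun p : ℝ × (Fin 2 → ℝ) =>
      f (WithLp.toLp 2 ((MeasurableEquiv.piFinSuccAbove (fun _ : Fin 3 => ℝ) 1).symm p)) :=
    hf.comp ((MeasurableEquiv.toLp 2 (Fin 3 → ℝ)).measurable.comp (MeasurableEquiv.measurable _))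
  rw [Measure.volume_eq_prod, lintegral_prod _ hm.aemeasurable]
  refine lintegral_congr fun y => ?_
  have h3 := (volume_preserving_finTwoArrow ℝ).symm
    |>.lintegral_comp_emb (MeasurableEquiv.measurableEmbedding _)
    (fun w => f (WithLp.toLp 2 ((MeasurableEquiv.piFinSuccAbove (fun _ : Fin 3 => ℝ) 1).symm (y, w))))
  rw [← h3]
  refine lintegral_congr fun z => ?_
  congr 1
  ext i
  fin_cases i <;> rfl

/-- Freezing the second variable only multiplies the density by a unimodular factor, and the
spectral measure is pushed forward to the other two frequencies; hence the generality of
`HasSpectrum`. The modulation recentres the first frequency at a without changing absolute values.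
-/
theorem hasSpectrum_slice {h : EuclideanSpace ℝ (Fin 3) → ℂ} (hh : Integrable h) {Δ R : ℝ}
    (hΔ : Δ ≠ 0) (a y : ℝ) {E : Set (ℝ × ℝ)} (hE : ∀ ξ, h ξ ≠ 0 → ((ξ 0 - a) / Δ, R * ξ 2) ∈ E) :
    HasSpectrum E fun z => ee (-(a * (Δ⁻¹ * z.1))) * 𝓕⁻ h !₂[Δ⁻¹ * z.1, y, R * z.2] := by
  refine ⟨EuclideanSpace ℝ (Fin 3), inferInstance, volume, fun ξ => h ξ * ee (y * ξ 1),
    fun ξ => ((ξ 0 - a) / Δ, R * ξ 2), inferInstance, ?_, ?_, fun ξ hξ => hE ξ ?_, fun z => ?_⟩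
  · refine hh.mul_bdd (c := 1) (Continuous.aestronglyMeasurable ?_) (.of_forall fun ξ => by simp)
    fun_prop
  · exact Continuous.measurable (by fun_prop)
  · exact left_ne_zero_of_mul hξ
  · simp only
    rw [fourierInv_eq_integral_ee, ← integral_const_mul]
    refine integral_congr_ae (.of_forall fun ξ => ?_)
    simp only [wave]
    rw [mul_left_comm, ← ee_add, mul_assoc, ← ee_add]
    congr 2
    simp
    field_simp
    ring

/-! ### The square function of the slabs -/

/-- The indices of the slabs which can be non-empty. -/
noncomputable def slabIndices (R lam a : ℝ) : Finset ℤ :=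
  Finset.Icc ⌊(-1 - a) / slabWidth R lam⌋ ⌊(2 - a) / slabWidth R lam⌋

section

variable {R lam : ℝ} (a : ℝ)

theorem floor_mem_slabIndices (hR : 1 ≤ R) (hlam : 0 < lam) (hlam' : lam ≤ 1 / 2)
    {ξ : EuclideanSpace ℝ (Fin 3)} (hξ : ξ ∈ surfaceNhd R lam) :
    ⌊(ξ 0 - a) / slabWidth R lam⌋ ∈ slabIndices R lam a := by
  obtain ⟨x, hx, h0, -⟩ := exists_near_of_mem_surfaceNhd hR hξ
  have hRi : R⁻¹ ≤ 1 := inv_le_one_of_one_le₀ hR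
  have h1 := abs_le.1 h0
  have hΔ := slabWidth_pos hR hlam
  refine Finset.mem_Icc.2 ⟨Int.floor_le_floor ?_, Int.floor_le_floor ?_⟩
  · gcongr; linarith [hx.1]
  · gcongr; linarith [hx.2]

theorem mem_slab_iff (hR : 1 ≤ R) (hlam : 0 < lam) {k : ℤ} {ξ : EuclideanSpace ℝ (Fin 3)} :
    ξ ∈ slab R lam a k ↔ ξ ∈ surfaceNhd R lam ∧ ⌊(ξ 0 - a) / slabWidth R lam⌋ = k := by
  have hΔ := slabWidth_pos hR hlam
  rw [Int.floor_eq_iff, le_div_iff₀ hΔ, div_lt_iff₀ hΔ]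
  refine and_congr_right fun _ => and_congr ?_ ?_ <;> constructor <;> intro h <;> linarith

theorem measurableSet_slab (k : ℤ) : MeasurableSet (slab R lam a k) := by
  have h0 : Measurable fun ξ : EuclideanSpace ℝ (Fin 3) => ξ 0 :=
    Continuous.measurable (by fun_prop)
  have h1 : MeasurableSet (surfaceNhd R lam) := Metric.isClosed_cthickening.measurableSet
  have h2 : MeasurableSet {ξ : EuclideanSpace ℝ (Fin 3) | a + k * slabWidth R lam ≤ ξ 0} :=
    measurableSet_le measurable_const h0
  have h3 : MeasurableSet {ξ : EuclideanSpace ℝ (Fin 3) | ξ 0 < a + (k + 1) * slabWidth R lam} :=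
    measurableSet_lt h0 measurable_const
  exact h1.inter (h2.inter h3)

theorem slabPiece_eq_zero (hR : 1 ≤ R) (hlam : 0 < lam) (hlam' : lam ≤ 1 / 2)
    (Fhat : EuclideanSpace ℝ (Fin 3) → ℂ) {k : ℤ} (hk : k ∉ slabIndices R lam a)
    (x : EuclideanSpace ℝ (Fin 3)) : slabPiece R lam a k Fhat x = 0 := by
  have h0 : (slab R lam a k).indicator Fhat = 0 := by
    funext ξ
    refine Set.indicator_of_notMem (fun hξ => hk ?_) _
    obtain ⟨h1, h2⟩ := (mem_slab_iff a hR hlam).1 hξ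
    rw [← h2]
    exact floor_mem_slabIndices a hR hlam hlam' h1
  rw [slabPiece, h0, fourierInv_eq_integral_ee]
  simp

theorem sum_slabPiece_eq (hR : 1 ≤ R) (hlam : 0 < lam) (hlam' : lam ≤ 1 / 2)
    {Fhat : EuclideanSpace ℝ (Fin 3) → ℂ} (hF : Integrable Fhat)
    (hsupp : Function.support Fhat ⊆ surfaceNhd R lam) (x : EuclideanSpace ℝ (Fin 3)) :
    ∑ k ∈ slabIndices R lam a, slabPiece R lam a k Fhat x = 𝓕⁻ Fhat x := by
  simp_rw [slabPiece, fourierInv_eq_integral_ee]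
  rw [← integral_finsetSum _ fun k _ => ?_]
  · refine integral_congr_ae (.of_forall fun ξ => ?_)
    simp only
    rw [← Finset.sum_mul]
    congr 1
    by_cases h0 : Fhat ξ = 0
    · rw [h0]
      refine Finset.sum_eq_zero fun k _ => ?_
      rw [Set.indicator_apply_eq_zero]; exact fun _ => h0
    · have hξ : ξ ∈ surfaceNhd R lam := hsupp h0
      rw [Finset.sum_eq_single_of_mem _ (floor_mem_slabIndices a hR hlam hlam' hξ)]
      · exact Set.indicator_of_mem ((mem_slab_iff a hR hlam).2 ⟨hξ, rfl⟩) _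
      · intro k _ hk
        exact Set.indicator_of_notMem (fun h => hk ((mem_slab_iff a hR hlam).1 h).2.symm) _
  · refine (hF.indicator (measurableSet_slab a k)).mul_bdd (c := 1)
      (Continuous.aestronglyMeasurable ?_) (.of_forall fun ξ => by simp)
    fun_prop

theorem enorm_slabSquareFunction_rpow (hR : 1 ≤ R) (hlam : 0 < lam) (hlam' : lam ≤ 1 / 2)
    (Fhat : EuclideanSpace ℝ (Fin 3) → ℂ) (x : EuclideanSpace ℝ (Fin 3)) {q : ℝ} :
    ‖slabSquareFunction R lam a Fhat x‖ₑ ^ q =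
      (∑ k ∈ slabIndices R lam a, ‖slabPiece R lam a k Fhat x‖ₑ ^ 2) ^ (q / 2) := by
  have hS : ∑' k : ℤ, ‖slabPiece R lam a k Fhat x‖ ^ 2 =
      ∑ k ∈ slabIndices R lam a, ‖slabPiece R lam a k Fhat x‖ ^ 2 :=
    tsum_eq_sum fun k hk => by rw [slabPiece_eq_zero a hR hlam hlam' Fhat hk]; simp
  have hsum : ∑ k ∈ slabIndices R lam a, ‖slabPiece R lam a k Fhat x‖ₑ ^ 2 =
      ENNReal.ofReal (∑ k ∈ slabIndices R lam a, ‖slabPiece R lam a k Fhat x‖ ^ 2) := by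
    rw [ENNReal.ofReal_sum_of_nonneg fun _ _ => by positivity]
    simp only [ENNReal.ofReal_pow (norm_nonneg _), ofReal_norm]
  rw [slabSquareFunction, hS, hsum, ← ofReal_norm, Real.norm_of_nonneg (Real.sqrt_nonneg _),
    Real.sqrt_eq_rpow, ← ENNReal.ofReal_rpow_of_nonneg (Finset.sum_nonneg fun _ _ => by positivity)
      (by norm_num), ← ENNReal.rpow_mul]
  congr 1; ring

end

/-- Tonelli over slices. The planar constant is uniform over the rescaled curves, and the Jacobian
of the rescaling is the same on both sides and cancels. -/
theorem exists_lintegral_slab_bound {s : ℝ} (hs1 : 1 ≤ s) (hs2 : s ≤ 2) :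
    ∃ C : ℝ≥0, ∀ R lam a : ℝ, 1 ≤ R → 0 < lam → lam ≤ 1 / 2 →
      ∀ Fhat : EuclideanSpace ℝ (Fin 3) → ℂ, Integrable Fhat →
        Function.support Fhat ⊆ surfaceNhd R lam →
        ∫⁻ x, (‖𝓕⁻ Fhat x‖ₑ ^ 2) ^ s ≤
          C * ∫⁻ x, (∑ k ∈ slabIndices R lam a, ‖slabPiece R lam a k Fhat x‖ₑ ^ 2) ^ s := by
  obtain ⟨C, hC⟩ := exists_plane_square_function 12 48 18 (by norm_num) hs1 hs2
  refine ⟨C, fun R lam a hR hlam hlam' Fhat hF hsupp => ?_⟩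
  have hR0 : 0 < R := by linarith
  have hΔ := slabWidth_pos hR hlam
  set Δ := slabWidth R lam with hΔdef
  set K := slabIndices R lam a
  have hcurve : ConvexCurve 12 48 (rescaledCurve R lam a) _ :=
    convexCurve_model.rescale (relWidth_pos hR hlam) (a / lam)
  have hFk : ∀ k, Integrable ((slab R lam a k).indicator Fhat) := fun k =>
    hF.indicator (measurableSet_slab a k)
  have hPc : ∀ k, Continuous (slabPiece R lam a k Fhat) := fun k =>
    continuous_fourierInv_three (hFk k)
  set H : ℝ → ℤ → ℝ × ℝ → ℂ := fun y k z =>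
    ee (-(a * (Δ⁻¹ * z.1))) * slabPiece R lam a k Fhat !₂[Δ⁻¹ * z.1, y, R * z.2] with hH
  have hspec : ∀ y, ∀ k ∈ K, HasSpectrum (capSet (rescaledCurve R lam a) 18 k) (H y k) := by
    intro y k _
    refine hasSpectrum_slice (hFk k) hΔ.ne' a y fun ξ hξ => ?_
    exact mem_capSet_of_mem_slab hR hlam hlam' (Set.mem_of_indicator_ne_zero hξ)
  have hplane := fun y => hC _ _ hcurve K (H y) (hspec y)
  have hm1 : Measurable fun x => (‖𝓕⁻ Fhat x‖ₑ ^ 2) ^ s :=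
    ((continuous_fourierInv_three hF).measurable.enorm.pow_const 2).pow_const s
  have hm2 : Measurable fun x => (∑ k ∈ K, ‖slabPiece R lam a k Fhat x‖ₑ ^ 2) ^ s :=
    (Finset.measurable_sum _ fun k _ => (hPc k).measurable.enorm.pow_const 2).pow_const s
  rw [lintegral_eq_lintegral_slices hm1, lintegral_eq_lintegral_slices hm2,
    ← lintegral_const_mul' _ _ (by simp)]
  refine lintegral_mono fun y => ?_
  have hΔi : 0 < Δ⁻¹ := inv_pos.2 hΔ
  have e1 : ∫⁻ z, (‖∑ k ∈ K, H y k z‖ₑ ^ 2) ^ s = ENNReal.ofReal (Δ⁻¹ * R)⁻¹ *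
      ∫⁻ z : ℝ × ℝ, (‖𝓕⁻ Fhat !₂[z.1, y, z.2]‖ₑ ^ 2) ^ s := by
    rw [← lintegral_comp_shear (s := 0) hΔi hR0]
    refine lintegral_congr fun z => ?_
    simp only [hH, shear]
    rw [← Finset.mul_sum, sum_slabPiece_eq a hR hlam hlam' hF hsupp, enorm_mul,
      ← ofReal_norm (ee _), norm_ee]
    simp
  have e2 : ∫⁻ z, fullSum K (H y) z ^ s = ENNReal.ofReal (Δ⁻¹ * R)⁻¹ *
      ∫⁻ z : ℝ × ℝ, (∑ k ∈ K, ‖slabPiece R lam a k Fhat !₂[z.1, y, z.2]‖ₑ ^ 2) ^ s := by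
    rw [← lintegral_comp_shear (s := 0) hΔi hR0]
    refine lintegral_congr fun z => ?_
    simp only [fullSum, hH, shear]
    congr 1
    refine Finset.sum_congr rfl fun k _ => ?_
    rw [enorm_mul, ← ofReal_norm (ee _), norm_ee]
    simp
  have key := hplane y
  rw [e1, e2, mul_left_comm] at key
  refine (ENNReal.mul_le_mul_iff_right ?_ ENNReal.ofReal_ne_top).1 key
  rw [ne_eq, ENNReal.ofReal_eq_zero, not_le]
  positivity

end SquareFunction

/-! ### The theorem in terms of norms, with `p = 2s` -/

theorem proposition3p3 (p : ℝ≥0∞) (hp2 : 2 ≤ p) (hp4 : p ≤ 4) :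
    ∃ C : ℝ≥0, ∀ R lam a : ℝ, 1 ≤ R → 0 < lam → lam ≤ 1 / 2 →
      ∀ F Fhat : EuclideanSpace ℝ (Fin 3) → ℂ,
        Integrable Fhat volume → F = 𝓕⁻ Fhat →
        Function.support Fhat ⊆ surfaceNhd R lam →
        eLpNorm F p volume ≤ C * eLpNorm (slabSquareFunction R lam a Fhat) p volume := by
  have hpt : p ≠ ∞ := ne_top_of_le_ne_top (by simp) hp4
  have hp0 : p ≠ 0 := (zero_lt_two.trans_le hp2).ne'
  have h2 : 2 ≤ p.toReal := by simpa using ENNReal.toReal_mono hpt hp2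
  have h4 : p.toReal ≤ 4 := by simpa using ENNReal.toReal_mono (by simp) hp4
  obtain ⟨C, hC⟩ := SquareFunction.exists_lintegral_slab_bound (s := p.toReal / 2)
    (by linarith) (by linarith)
  refine ⟨C ^ (1 / p.toReal), fun R lam a hR hlam hlam' F Fhat hF hFF hsupp => ?_⟩
  subst hFF
  rw [eLpNorm_eq_lintegral_rpow_enorm_toReal hp0 hpt, eLpNorm_eq_lintegral_rpow_enorm_toReal hp0 hpt,
    ENNReal.coe_rpow_of_nonneg _ (by positivity), ← ENNReal.mul_rpow_of_nonneg _ _ (by positivity)]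
  refine ENNReal.rpow_le_rpow ?_ (by positivity)
  have e1 : ∀ x, ‖𝓕⁻ Fhat x‖ₑ ^ p.toReal = (‖𝓕⁻ Fhat x‖ₑ ^ 2) ^ (p.toReal / 2) := fun x => by
    rw [← ENNReal.rpow_natCast, ← ENNReal.rpow_mul]
    congr 1; push_cast; ring
  rw [lintegral_congr e1, lintegral_congr fun x =>
    SquareFunction.enorm_slabSquareFunction_rpow a hR hlam hlam' Fhat x (q := p.toReal)]
  exact hC R lam a hR hlam hlam' Fhat hF hsupp
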